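/- Throughout, $\mathbb R^+=(0,\infty)$ carries Lebesgue measure, and functions that agree almost everywhere are identified. For $\gamma\in\mathbb R$, $L^\infty(\mathbb R^+;(1+\epsilon)^\gamma)$ denotes the measurable functions $h\ge 0$ on $\mathbb R^+$ with $\|h\|_\gamma=\operatorname{ess\,sup}_{\epsilon>0}(1+\epsilon)^\gamma h(\epsilon)<\infty$, and $L^\infty_{loc}([0,T);L^\infty(\mathbb R^+;(1+\epsilon)^\gamma))$ the measurable functions $f(t,\epsilon)\ge0$ on $[0,T)\times\mathbb R^+$ with $f(t,\cdot)\in L^\infty(\mathbb R^+;(1+\epsilon)^\gamma)$ for every $t$ and $\sup_{t\in K}\|f(t,\cdot)\|_\gamma<\infty$ for every compact $K\subset[0,T)$. The isotropic Nordheim equation is $$\partial_t f_1=\frac{8\pi^2}{\sqrt2}\iint_{\{\epsilon_3,\epsilon_4>0,\ \epsilon_2\ge 0\}}\bigl[f_3f_4(1+f_1+f_2)-f_1f_2(1+f_3+f_4)\bigr]W\,d\epsilon_3\,d\epsilon_4,$$ $$\epsilon_2=\epsilon_3+\epsilon_4-\epsilon_1,\qquad W=\frac{\min\{\sqrt{\epsilon_1},\sqrt{\epsilon_2},\sqrt{\epsilon_3},\sqrt{\epsilon_4}\}}{\sqrt{\epsilon_1}},\qquad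 f_j=f(t,\epsilon_j).$$ A mild solution on $[0,T)$, $0<T<\infty$, with initial datum $f_0$ is an $f\in L^\infty_{loc}([0,T);L^\infty(\mathbb R^+;(1+\epsilon)^\gamma))$ such that, for a.e. $t\in[0,T)$ and a.e. $\epsilon_1>0$, $$f(t,\epsilon_1)=f_0(\epsilon_1)\Psi(t,\epsilon_1)+\frac{8\pi^2}{\sqrt2}\int_0^t\frac{\Psi(t,\epsilon_1)}{\Psi(s,\epsilon_1)}\iint f_3f_4(1+f_1+f_2)W\,d\epsilon_3\,d\epsilon_4\,ds,$$ where $f_j=f(s,\epsilon_j)$ in the integral, $\Psi(t,\epsilon_1)=\exp\bigl(-\int_0^t a(s,\epsilon_1)\,ds\bigr)$, $a(s,\epsilon_1)=\frac{8\pi^2}{\sqrt2}\iint f_2(1+f_3+f_4)W\,d\epsilon_3\,d\epsilon_4$, and both double integrals are over the region above. **Theorem.** There exists $\theta_*>0$ such that for all $M,E>0$ there is $T_0=T_0(M,E)>0$ such that for all $\nu>0$ there are $\rho_0=\rho_0(M,E,\nu)>0$ and $K^*=K^*(M,E,\nu)>0$ with the following property for every $\gamma>3$. Let $f_0\in L^\infty(\mathbb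 R^+;(1+\epsilon)^\gamma)$ satisfy $$4\pi\sqrt2\int_0^\infty f_0(\epsilon)\sqrt{\epsilon}\,d\epsilon=M,\qquad 4\pi\sqrt2\int_0^\infty f_0(\epsilon)\sqrt{\epsilon^3}\,d\epsilon=E$$ and $$\sup_{0<\rho\le\rho_0}\min\left\{\inf_{0<R\le\rho}\frac1{\nu R^{3/2}}\int_0^Rf_0(\epsilon)\sqrt\epsilon\,d\epsilon,\ \frac1{K^*\rho^{\theta_*}}\int_0^\rho f_0(\epsilon)\sqrt\epsilon\,d\epsilon\right\}\ge1.$$ Then there are $T_{\max}\in(0,T_0)$ and a mild solution $f$ on $[0,T_{\max})$ with initial datum $f_0$ such that $$\limsup_{t\to T_{\max}^-}\|f(t,\cdot)\|_{L^\infty(\mathbb R^+)}=\infty,$$ even when null sets of times are disregarded in the limit superior. This $T_{\max}$ is the maximal existence time and $f$ is unique: if $u$ is a mild solution on $[0,T)$, $0<T<\infty$, with initial datum $f_0$, then $T\le T_{\max}$ and $u=f$ a.e. on $[0,T)\times\mathbb R^+$. -/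

import Mathlib

open MeasureTheory Set Filter Topology
open scoped ENNReal

noncomputable section

namespace Nordheim

/-- Lebesgue measure on the half line of energies. -/
def energyMeasure : Measure ℝ := volume.restrict (Ioi (0 : ℝ))

/-- The norm of `L^∞(ℝ⁺; (1+ε)^γ)`. -/
def weightedNorm (γ : ℝ) (h : ℝ → ℝ) : ℝ≥0∞ :=
  eLpNorm (fun ε => (1 + ε) ^ γ * h ε) ∞ energyMeasure

/-- `h` is a (nonnegative) density in `L^∞(ℝ⁺; (1+ε)^γ)`. -/
structure MemWeighted (γ : ℝ) (h : ℝ → ℝ) : Prop where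
  aemeasurable : AEMeasurable h energyMeasure
  nonneg : ∀ᵐ ε ∂energyMeasure, 0 ≤ h ε
  norm_lt_top : weightedNorm γ h < ∞

/-- `f = f(t, ε)` is a (nonnegative) element of `L^∞_loc([T₁, T₂); L^∞(ℝ⁺; (1+ε)^γ))`. -/
structure MemLocWeighted (γ T₁ T₂ : ℝ) (f : ℝ → ℝ → ℝ) : Prop where
  aemeasurable : AEMeasurable (fun p : ℝ × ℝ => f p.1 p.2)
    ((volume.restrict (Ico T₁ T₂)).prod energyMeasure)
  mem : ∀ t ∈ Ico T₁ T₂, MemWeighted γ (f t)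
  locallyBounded : ∀ K : Set ℝ, IsCompact K → K ⊆ Ico T₁ T₂ →
    (⨆ t ∈ K, weightedNorm γ (f t)) < ∞

/-- The kernel `W = min {√ε₁, √ε₂, √ε₃, √ε₄} / √ε₁` with `ε₂ = ε₃ + ε₄ - ε₁`.
Since `Real.sqrt` vanishes on negative numbers, `W = 0` where `ε₂ < 0`, so that integrals against
`W` only see the region `ε₂ ≥ 0`. -/
def kernelW (ε₁ ε₃ ε₄ : ℝ) : ℝ :=
  min (min (√ε₁) (√(ε₃ + ε₄ - ε₁))) (min (√ε₃) (√ε₄)) / √ε₁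

/-- The gain rate `(8π²/√2) ∫∫ f₃ f₄ (1 + f₁ + f₂) W dε₃ dε₄` at the energy `ε₁`. -/
def gain (h : ℝ → ℝ) (ε₁ : ℝ) : ℝ :=
  8 * Real.pi ^ 2 / √2 *
    ∫ ε₃ in Ioi (0 : ℝ), ∫ ε₄ in Ioi (0 : ℝ),
      h ε₃ * h ε₄ * (1 + h ε₁ + h (ε₃ + ε₄ - ε₁)) * kernelW ε₁ ε₃ ε₄

/-- The loss frequency `a = (8π²/√2) ∫∫ f₂ (1 + f₃ + f₄) W dε₃ dε₄` at the energy `ε₁`. -/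
def lossRate (h : ℝ → ℝ) (ε₁ : ℝ) : ℝ :=
  8 * Real.pi ^ 2 / √2 *
    ∫ ε₃ in Ioi (0 : ℝ), ∫ ε₄ in Ioi (0 : ℝ),
      h (ε₃ + ε₄ - ε₁) * (1 + h ε₃ + h ε₄) * kernelW ε₁ ε₃ ε₄

/-- `Ψ(t, ε₁) = exp (-∫_{T₁}^t a(s, ε₁) ds)`. -/
def Psi (T₁ : ℝ) (f : ℝ → ℝ → ℝ) (t ε₁ : ℝ) : ℝ :=
  Real.exp (-∫ s in T₁..t, lossRate (f s) ε₁)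

/-- Mild solutions on `[T₁, T₂)` of the isotropic Nordheim equation with initial datum `f₀`. -/
structure IsMildSolution (γ T₁ T₂ : ℝ) (f₀ : ℝ → ℝ) (f : ℝ → ℝ → ℝ) : Prop where
  mem : MemLocWeighted γ T₁ T₂ f
  eqn : ∀ᵐ t ∂(volume.restrict (Ico T₁ T₂)), ∀ᵐ ε₁ ∂energyMeasure,
    f t ε₁ = f₀ ε₁ * Psi T₁ f t ε₁ +
      ∫ s in T₁..t, Psi T₁ f t ε₁ / Psi T₁ f s ε₁ * gain (f s) ε₁

/-- The mass `4π√2 ∫ f(ε) √ε dε`. -/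
def mass (h : ℝ → ℝ) : ℝ :=
  4 * Real.pi * √2 * ∫ ε in Ioi (0 : ℝ), h ε * √ε

/-- The energy `4π√2 ∫ f(ε) √(ε³) dε`. -/
def energy (h : ℝ → ℝ) : ℝ :=
  4 * Real.pi * √2 * ∫ ε in Ioi (0 : ℝ), h ε * √(ε ^ 3)

/-- `∫_0^R f(ε) √ε dε`. -/
def massBelow (h : ℝ → ℝ) (R : ℝ) : ℝ :=
  ∫ ε in Ioc (0 : ℝ) R, h ε * √ε

/-- The concentration condition
`sup_{ρ ≤ ρ₀} min { inf_{R ≤ ρ} (1/(ν R^{3/2})) ∫_0^R f √ε,  (1/(K ρ^θ)) ∫_0^ρ f √ε } ≥ 1`,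
with `ρ` and `R` positive, as the quotients demand. The supremum and the infimum are taken in
`[0, ∞]`. -/
def Concentrated (ν ρ₀ K θ : ℝ) (h : ℝ → ℝ) : Prop :=
  1 ≤ ⨆ ρ ∈ Ioc (0 : ℝ) ρ₀,
    min (⨅ R ∈ Ioc (0 : ℝ) ρ, ENNReal.ofReal (1 / (ν * R ^ (3 / 2 : ℝ)) * massBelow h R))
      (ENNReal.ofReal (1 / (K * ρ ^ θ) * massBelow h ρ))

/-- The limit superior, as `t → T⁻`, of the norm of `f(t, ·)` in `L^∞(ℝ⁺)`, insensitive to null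
sets of times. It is at most the limit superior over all times `t → T⁻`. -/
def limsupNorm (f : ℝ → ℝ → ℝ) (T : ℝ) : ℝ≥0∞ :=
  limsup (fun t => eLpNorm (f t) ∞ energyMeasure) (𝓝[<] T ⊓ ae volume)

end Nordheim

end

/-!
# Finite-time blow-up for the isotropic Nordheim equation

*Existence, uniqueness and continuation.* Let a density be bounded by `N (1 + ε)^(-γ)` with `γ > 3`.
At high energies both rates grow like `√ε`: the loss frequency is at least
`(8π²/√2) √ε ∫ f √ε` up to a bounded error (`lossRate_ge`), while the gain is at most the fraction
`gainRatio γ = 2 / (γ - 1) < 1` of that, measured in the weight, up to moments of `f` (`gain_le`).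
So the damping absorbs the unbounded part of the gain. For the difference of two densities the same
holds in a weaker weight `β < γ`, with the ratio `contractRatio β < 1`, provided that the masses are
bounded below (`exists_rate_difference`). In a norm with a factor `e^{-λt}` the Duhamel map is then a
contraction, which yields classical solutions for short times (`exists_local_solution`) and their
uniqueness (`IsSolution.eq`). As the constant in `gain_le` involves moments only, a solution
with bounded moments stays bounded in its weight (`exists_apriori_bound`); since mass and energy are
conserved, a bound of the supremum norm suffices, and the solution on its maximal interval is
unbounded near the end, if this interval is finite (`limsupNorm_maximalSolution`). A mild solution
agrees almost everywhere with a classical solution off a null set of energies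
(`IsMildSolution.exists_isSolution`), so that maximality and uniqueness pass to mild solutions.

*Monotonicity.* In the symmetrized weak form (`two_mul_momentRate`), with the test function
`e^{-pε}`, the quadratic collisions decrease the Laplace transform of the mass distribution at most
at a bounded relative rate. The cubic collisions never decrease it: the sum of the balances over the
three roles in a triple of particles is nonnegative (`cubicSum_nonneg`), by convexity of the
exponential. Moreover, two particles with energies within `1/p` of each other and a third one far
below them contribute an increase proportional to the contribution of the third one
(`le_cubicSum`). Hence the Laplace transform at `p` grows exponentially, at a rate given by the squared
number of particles in an interval of length `1/p` (`le_momentRate_expTest`,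
`IsSolution.laplace_mul_exp_le`).

*Cascade.* Suppose that at some time there is a mass `s` below the energy `s^20`. By persistence, for
a time of order one a fixed fraction of it remains below `s^19`. With a small constant `ω`, if no mass
`ω s` entered the region below `(ω s)^20` during the time `s^10`, then a mass `ω s` would stay in the
layer between `(ω s)^20` and `s^19`. By the pigeonhole principle some interval of length `s^21` in this
layer would contain a number of particles whose square is of order `s^(-13)`, and the Laplace
transform at `p = s^(-21)` would be amplified by a factor `exp (c s^(-3))`. Its initial value is at
least of order `s^32` because of the lower bound `ν R^(3/2)` for the mass below `R`, so it would exceed the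
total mass. Therefore `ω s` takes the place of `s` within the time `s^10`
(`IsSolution.cascade_step`). These times sum up to less than `1/2`, but a bounded density cannot carry
a mass `s` below `s^20` for arbitrarily small `s` (`IsSolution.lt_half`). So every solution ends before
the time `1/2`, whatever `γ` is.
-/

namespace Nordheim

/-- The collision constant `8π²/√2`. -/
noncomputable def collisionConst : ℝ := 8 * Real.pi ^ 2 / √2

theorem collisionConst_pos : 0 < collisionConst := by
  unfold collisionConst; positivity

/-- The decaying weight `(1 + x)^(-β)` on the half line, extended by zero. -/
noncomputable def decay (β x : ℝ) : ℝ := if 0 < x then (1 + x) ^ (-β) else 0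

theorem decay_of_pos {β x : ℝ} (hx : 0 < x) : decay β x = (1 + x) ^ (-β) := if_pos hx

theorem decay_of_nonpos {β x : ℝ} (hx : x ≤ 0) : decay β x = 0 := if_neg (not_lt.2 hx)

theorem decay_nonneg (β x : ℝ) : 0 ≤ decay β x := by
  unfold decay
  split_ifs with h
  · positivity
  · exact le_rfl

theorem decay_pos {β x : ℝ} (hx : 0 < x) : 0 < decay β x := by
  rw [decay_of_pos hx]; positivity

theorem decay_le_one {β : ℝ} (hβ : 0 ≤ β) (x : ℝ) : decay β x ≤ 1 := by
  unfold decay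
  split_ifs with h
  · exact Real.rpow_le_one_of_one_le_of_nonpos (by linarith) (by linarith)
  · exact zero_le_one

theorem decay_le_decay {β γ : ℝ} (h : β ≤ γ) (x : ℝ) : decay γ x ≤ decay β x := by
  unfold decay
  split_ifs with hx
  · exact Real.rpow_le_rpow_of_exponent_le (by linarith) (by linarith)
  · exact le_rfl

theorem measurable_decay (β : ℝ) : Measurable (decay β) := by
  unfold decay
  exact Measurable.ite measurableSet_Ioi (by fun_prop) measurable_const

theorem decay_anti {β : ℝ} (hβ : 0 ≤ β) {x y : ℝ} (hx : 0 < x) (hxy : x ≤ y) :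
    decay β y ≤ decay β x := by
  rw [decay_of_pos hx, decay_of_pos (hx.trans_le hxy)]
  exact Real.rpow_le_rpow_of_nonpos (by linarith) (by linarith) (by linarith)

/-- Halving the energy costs a factor `2^β`. -/
theorem decay_half_le {β : ℝ} (hβ : 0 ≤ β) {x y : ℝ} (hx : 0 < x) (hxy : x / 2 ≤ y) :
    decay β y ≤ 2 ^ β * decay β x := by
  refine (decay_anti hβ (by linarith : (0 : ℝ) < x / 2) hxy).trans ?_
  rw [decay_of_pos hx, decay_of_pos (by linarith), Real.rpow_neg (by linarith),
    Real.rpow_neg (by linarith), ← div_eq_mul_inv, inv_eq_one_div,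
    div_le_div_iff₀ (by positivity) (by positivity), one_mul, ← Real.mul_rpow (by norm_num)
    (by linarith)]
  exact Real.rpow_le_rpow (by linarith) (by linarith) hβ

theorem le_decay_of_le_one {β : ℝ} (hβ : 0 ≤ β) {x : ℝ} (hx : 0 < x) (hx1 : x ≤ 1) :
    1 ≤ 2 ^ β * decay β x := by
  rw [decay_of_pos hx, Real.rpow_neg (by linarith), ← div_eq_mul_inv,
    le_div_iff₀ (by positivity), one_mul]
  exact Real.rpow_le_rpow (by linarith) (by linarith) hβ

theorem integrable_decay {β : ℝ} (hβ : 1 < β) : Integrable (decay β) := by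
  have h : IntegrableOn (fun x : ℝ => (x + 1) ^ (-β)) (Ioi 0) :=
    integrableOn_add_rpow_Ioi_of_lt (by linarith) (by norm_num)
  have h2 := (integrable_indicator_iff measurableSet_Ioi).2 h
  refine h2.congr (Eventually.of_forall fun x => ?_)
  by_cases hx : 0 < x
  · simp [decay, hx, indicator, add_comm]
  · simp [decay, hx, indicator]

theorem decay_mul_sq (β x : ℝ) : decay β x * (1 + x) ^ 2 = decay (β - 2) x := by
  unfold decay
  split_ifs with h
  · rw [← Real.rpow_natCast, ← Real.rpow_add (by linarith)]; congr 1; push_cast; ring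
  · simp

/-- `∫_x^∞ (1 + y)^(-β) dy`. -/
theorem integral_tail_decay {β : ℝ} (hβ : 1 < β) {x : ℝ} (hx : 0 ≤ x) :
    ∫ y in Ioi x, decay β y = (1 + x) ^ (1 - β) / (β - 1) := by
  have h1 : ∫ y in Ioi x, decay β y = ∫ y in Ioi x, (y + 1) ^ (-β) :=
    setIntegral_congr_fun measurableSet_Ioi fun y hy => by
      rw [decay_of_pos (hx.trans_lt hy), add_comm]
  have h2 : ∫ y in Ioi x, (y + 1) ^ (-β) = ∫ y in Ioi (x + 1), y ^ (-β) := by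
    have := (measurePreserving_add_right (volume : Measure ℝ) 1).setIntegral_preimage_emb
      (measurableEmbedding_addRight 1) (fun y => y ^ (-β)) (Ioi (x + 1))
    rw [← this]
    congr 2
    ext y; simp
  rw [h1, h2, integral_Ioi_rpow_of_lt (by linarith) (by linarith),
    show -β + 1 = -(β - 1) by ring, show 1 - β = -(β - 1) by ring, neg_div_neg_eq, add_comm]

/-- The weight `1 + x^(3/2)` of the moments that control the collision rates. -/
noncomputable def momentWeight (x : ℝ) : ℝ := 1 + x * √x

theorem measurable_momentWeight : Measurable momentWeight := by
  unfold momentWeight; fun_prop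

theorem mul_sqrt_nonneg (x : ℝ) : 0 ≤ x * √x := by
  rcases le_total 0 x with h | h
  · positivity
  · simp [Real.sqrt_eq_zero_of_nonpos h]

theorem one_le_momentWeight (x : ℝ) : 1 ≤ momentWeight x := by
  unfold momentWeight; linarith [mul_sqrt_nonneg x]

theorem sqrt_le_momentWeight (x : ℝ) : √x ≤ momentWeight x := by
  unfold momentWeight
  rcases le_total x 1 with h | h
  · have := Real.sqrt_le_one.2 h
    linarith [mul_sqrt_nonneg x]
  · have : 1 * √x ≤ x * √x := mul_le_mul_of_nonneg_right h (Real.sqrt_nonneg x)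
    linarith

theorem le_momentWeight (x : ℝ) : x ≤ momentWeight x := by
  unfold momentWeight
  rcases le_total x 1 with h | h
  · linarith [mul_sqrt_nonneg x]
  · have : x * 1 ≤ x * √x := mul_le_mul_of_nonneg_left (Real.one_le_sqrt.2 h) (by linarith)
    linarith

theorem mul_sqrt_le_momentWeight (x : ℝ) : x * √x ≤ momentWeight x := by
  unfold momentWeight; linarith

theorem sqrt_le_one_add {x : ℝ} (hx : 0 ≤ x) : √x ≤ 1 + x := by
  rw [Real.sqrt_le_left (by linarith)]; nlinarith

theorem momentWeight_le_sq {x : ℝ} (hx : 0 ≤ x) : momentWeight x ≤ (1 + x) ^ 2 := by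
  unfold momentWeight
  nlinarith [sqrt_le_one_add hx, mul_le_mul_of_nonneg_left (sqrt_le_one_add hx) hx]

/-- `h` is a measurable density on the half line, extended by zero, with
`0 ≤ h ≤ H (1 + x)^(-β)` everywhere. -/
structure IsDensity (β H : ℝ) (h : ℝ → ℝ) : Prop where
  meas : Measurable h
  nonneg : ∀ x, 0 ≤ h x
  le : ∀ x, h x ≤ H * decay β x

/-- The mass moment `∫ h √x`. -/
noncomputable def massMoment (h : ℝ → ℝ) : ℝ := ∫ x, h x * √x

/-- The moment `∫ h (1 + x^(3/2))`. -/
noncomputable def fullMoment (h : ℝ → ℝ) : ℝ := ∫ x, h x * momentWeight x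

/-- The constant `∫ (1 + x)^(2 - β)`. -/
noncomputable def decayMoment (β : ℝ) : ℝ := ∫ x, decay (β - 2) x

theorem decayMoment_nonneg (β : ℝ) : 0 ≤ decayMoment β := integral_nonneg fun _ => decay_nonneg _ _

namespace IsDensity

variable {β H : ℝ} {h : ℝ → ℝ}

theorem eq_zero (hh : IsDensity β H h) {x : ℝ} (hx : x ≤ 0) : h x = 0 :=
  le_antisymm (by simpa [decay_of_nonpos hx] using hh.le x) (hh.nonneg x)

theorem bound_nonneg (hh : IsDensity β H h) : 0 ≤ H := by
  have h1 := (hh.nonneg 1).trans (hh.le 1)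
  exact nonneg_of_mul_nonneg_left h1 (decay_pos one_pos)

theorem mono_exponent {α : ℝ} (hh : IsDensity β H h) (hα : α ≤ β) : IsDensity α H h :=
  ⟨hh.meas, hh.nonneg, fun x =>
    (hh.le x).trans (mul_le_mul_of_nonneg_left (decay_le_decay hα x) hh.bound_nonneg)⟩

theorem mono_bound {H' : ℝ} (hh : IsDensity β H h) (hH : H ≤ H') : IsDensity β H' h :=
  ⟨hh.meas, hh.nonneg, fun x =>
    (hh.le x).trans (mul_le_mul_of_nonneg_right hH (decay_nonneg _ _))⟩

theorem le_bound (hh : IsDensity β H h) (hβ : 0 ≤ β) (x : ℝ) : h x ≤ H :=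
  (hh.le x).trans (mul_le_of_le_one_right hh.bound_nonneg (decay_le_one hβ x))

/-- Every weight up to `(1 + x)^2` can be integrated against a density with `β > 3`. -/
theorem integrable_mul (hh : IsDensity β H h) (hβ : 3 < β) {ψ : ℝ → ℝ} (hψ : Measurable ψ)
    {c : ℝ} (hc : ∀ x, 0 < x → |ψ x| ≤ c * (1 + x) ^ 2) : Integrable (fun x => h x * ψ x) := by
  refine ((integrable_decay (show 1 < β - 2 by linarith)).const_mul (H * c)).mono'
    (hh.meas.mul hψ).aestronglyMeasurable (Eventually.of_forall fun x => ?_)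
  rw [Real.norm_eq_abs, abs_mul, abs_of_nonneg (hh.nonneg x)]
  rcases le_or_gt x 0 with hx | hx
  · simp [hh.eq_zero hx, decay_of_nonpos hx]
  · calc h x * |ψ x| ≤ H * decay β x * (c * (1 + x) ^ 2) :=
          mul_le_mul (hh.le x) (hc x hx) (abs_nonneg _)
            (mul_nonneg hh.bound_nonneg (decay_nonneg _ _))
      _ = H * c * (decay β x * (1 + x) ^ 2) := by ring
      _ = _ := by rw [decay_mul_sq]

theorem integrable_mul_momentWeight (hh : IsDensity β H h) (hβ : 3 < β) :
    Integrable (fun x => h x * momentWeight x) :=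
  hh.integrable_mul hβ measurable_momentWeight (c := 1) fun x hx => by
    rw [abs_of_nonneg (by linarith [one_le_momentWeight x]), one_mul]
    exact momentWeight_le_sq hx.le

/-- Weights below `1 + x^(3/2)` can be integrated against a density with `β > 3`. -/
theorem integrable_mul_of_le (hh : IsDensity β H h) (hβ : 3 < β) {ψ : ℝ → ℝ} (hψ : Measurable ψ)
    (hc : ∀ x, 0 < x → |ψ x| ≤ momentWeight x) : Integrable (fun x => h x * ψ x) :=
  hh.integrable_mul hβ hψ (c := 1) fun x hx => by
    rw [one_mul]; exact (hc x hx).trans (momentWeight_le_sq hx.le)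

theorem integral_mul_le (hh : IsDensity β H h) (hβ : 3 < β) {ψ : ℝ → ℝ} (hψ : Measurable ψ)
    (hc : ∀ x, 0 < x → |ψ x| ≤ momentWeight x) : ∫ x, h x * ψ x ≤ fullMoment h := by
  refine integral_mono (hh.integrable_mul_of_le hβ hψ hc) (hh.integrable_mul_momentWeight hβ)
    fun x => ?_
  rcases le_or_gt x 0 with hx | hx
  · simp [hh.eq_zero hx]
  · exact mul_le_mul_of_nonneg_left ((le_abs_self _).trans (hc x hx)) (hh.nonneg x)

theorem integrable (hh : IsDensity β H h) (hβ : 3 < β) : Integrable h := by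
  simpa using hh.integrable_mul_of_le hβ (ψ := fun _ => 1) measurable_const
    fun x _ => by simpa using one_le_momentWeight x

theorem integral_le (hh : IsDensity β H h) (hβ : 3 < β) : ∫ x, h x ≤ fullMoment h := by
  simpa using hh.integral_mul_le hβ (ψ := fun _ => 1) measurable_const
    fun x _ => by simpa using one_le_momentWeight x

theorem integral_nonneg (hh : IsDensity β H h) : 0 ≤ ∫ x, h x :=
  MeasureTheory.integral_nonneg hh.nonneg

theorem integrable_mul_sqrt (hh : IsDensity β H h) (hβ : 3 < β) :
    Integrable (fun x => h x * √x) :=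
  hh.integrable_mul_of_le hβ (by fun_prop) fun x _ => by
    rw [abs_of_nonneg (Real.sqrt_nonneg x)]; exact sqrt_le_momentWeight x

theorem massMoment_le (hh : IsDensity β H h) (hβ : 3 < β) : massMoment h ≤ fullMoment h :=
  hh.integral_mul_le hβ (by fun_prop) fun x _ => by
    rw [abs_of_nonneg (Real.sqrt_nonneg x)]; exact sqrt_le_momentWeight x

theorem massMoment_nonneg (hh : IsDensity β H h) : 0 ≤ massMoment h :=
  MeasureTheory.integral_nonneg fun x => mul_nonneg (hh.nonneg x) (Real.sqrt_nonneg x)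

theorem integrable_mul_id (hh : IsDensity β H h) (hβ : 3 < β) :
    Integrable (fun x => h x * x) :=
  hh.integrable_mul_of_le hβ measurable_id fun x hx => by
    rw [abs_of_pos hx]; exact le_momentWeight x

theorem integral_mul_id_le (hh : IsDensity β H h) (hβ : 3 < β) :
    ∫ x, h x * x ≤ fullMoment h :=
  hh.integral_mul_le hβ measurable_id fun x hx => by
    rw [abs_of_pos hx]; exact le_momentWeight x

theorem integrable_mul_mul_sqrt (hh : IsDensity β H h) (hβ : 3 < β) :
    Integrable (fun x => h x * (x * √x)) :=
  hh.integrable_mul_of_le hβ (by fun_prop) fun x _ => by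
    rw [abs_of_nonneg (mul_sqrt_nonneg x)]; exact mul_sqrt_le_momentWeight x

theorem integral_mul_mul_sqrt_le (hh : IsDensity β H h) (hβ : 3 < β) :
    ∫ x, h x * (x * √x) ≤ fullMoment h :=
  hh.integral_mul_le hβ (by fun_prop) fun x _ => by
    rw [abs_of_nonneg (mul_sqrt_nonneg x)]; exact mul_sqrt_le_momentWeight x

theorem fullMoment_nonneg (hh : IsDensity β H h) : 0 ≤ fullMoment h :=
  MeasureTheory.integral_nonneg fun x => mul_nonneg (hh.nonneg x)
    (by linarith [one_le_momentWeight x])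

theorem fullMoment_le (hh : IsDensity β H h) (hβ : 3 < β) :
    fullMoment h ≤ H * decayMoment β := by
  unfold fullMoment decayMoment
  rw [← integral_const_mul]
  refine integral_mono (hh.integrable_mul_momentWeight hβ)
    ((integrable_decay (show 1 < β - 2 by linarith)).const_mul _) fun x => ?_
  rcases le_or_gt x 0 with hx | hx
  · simp [hh.eq_zero hx, decay_of_nonpos hx]
  · calc h x * momentWeight x ≤ H * decay β x * (1 + x) ^ 2 :=
          mul_le_mul (hh.le x) (momentWeight_le_sq hx.le) (by linarith [one_le_momentWeight x])
            (mul_nonneg hh.bound_nonneg (decay_nonneg _ _))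
      _ = H * (decay β x * (1 + x) ^ 2) := by ring
      _ = _ := by rw [decay_mul_sq]

end IsDensity

/-! ### The kernel -/

theorem kernelW_nonneg (e x y : ℝ) : 0 ≤ kernelW e x y := by
  unfold kernelW; positivity

theorem kernelW_le_one (e x y : ℝ) : kernelW e x y ≤ 1 := by
  unfold kernelW
  exact div_le_one_of_le₀ ((min_le_left _ _).trans (min_le_left _ _)) (Real.sqrt_nonneg _)

theorem kernelW_symm (e x y : ℝ) : kernelW e x y = kernelW e y x := by
  unfold kernelW; rw [add_comm x y, min_comm (√x)]

theorem kernelW_le_left (e x y : ℝ) : kernelW e x y ≤ √x / √e := by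
  unfold kernelW
  exact div_le_div_of_nonneg_right ((min_le_right _ _).trans (min_le_left _ _))
    (Real.sqrt_nonneg _)

theorem kernelW_le_right (e x y : ℝ) : kernelW e x y ≤ √y / √e := by
  rw [kernelW_symm]; exact kernelW_le_left e y x

theorem kernelW_le_second (e x y : ℝ) : kernelW e x y ≤ √(x + y - e) / √e := by
  unfold kernelW
  exact div_le_div_of_nonneg_right ((min_le_left _ _).trans (min_le_right _ _))
    (Real.sqrt_nonneg _)

theorem kernelW_eq_zero_of_left {e x y : ℝ} (hx : x ≤ 0) : kernelW e x y = 0 :=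
  le_antisymm ((kernelW_le_left e x y).trans (by simp [Real.sqrt_eq_zero_of_nonpos hx]))
    (kernelW_nonneg _ _ _)

theorem kernelW_eq_zero_of_right {e x y : ℝ} (hy : y ≤ 0) : kernelW e x y = 0 := by
  rw [kernelW_symm]; exact kernelW_eq_zero_of_left hy

theorem kernelW_eq_zero_of_second {e x y : ℝ} (h : x + y ≤ e) : kernelW e x y = 0 :=
  le_antisymm ((kernelW_le_second e x y).trans
    (by simp [Real.sqrt_eq_zero_of_nonpos (show x + y - e ≤ 0 by linarith)]))
    (kernelW_nonneg _ _ _)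

theorem kernelW_eq_zero_of_first {e x y : ℝ} (h : e ≤ 0) : kernelW e x y = 0 := by
  simp [kernelW, Real.sqrt_eq_zero_of_nonpos h]

theorem measurable_kernelW : Measurable fun q : ℝ × ℝ × ℝ => kernelW q.1 q.2.1 q.2.2 := by
  unfold kernelW; fun_prop

@[fun_prop]
theorem measurable_kernelW_comp {α : Type*} [MeasurableSpace α] {a b c : α → ℝ}
    (ha : Measurable a) (hb : Measurable b) (hc : Measurable c) :
    Measurable fun q => kernelW (a q) (b q) (c q) :=
  measurable_kernelW.comp (ha.prodMk (hb.prodMk hc))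

theorem abs_mul_kernelW_le {a b : ℝ} (h : |a| ≤ b) (e x y : ℝ) : |a * kernelW e x y| ≤ b := by
  rw [abs_mul, abs_of_nonneg (kernelW_nonneg _ _ _)]
  exact (mul_le_of_le_one_right (abs_nonneg a) (kernelW_le_one _ _ _)).trans h

/-- The shear `(ε₃, ε₄) ↦ (ε₃, ε₂)` with `ε₂ = ε₃ + ε₄ - e`. -/
def shear (e : ℝ) : ℝ × ℝ ≃ᵐ ℝ × ℝ where
  toFun p := (p.1, p.1 + p.2 - e)
  invFun p := (p.1, p.2 + e - p.1)
  left_inv p := by ext <;> simp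
  right_inv p := by ext <;> simp
  measurable_toFun := by simp only [Equiv.coe_fn_mk]; fun_prop
  measurable_invFun := by simp only [Equiv.coe_fn_symm_mk]; fun_prop

theorem measurePreserving_shear (e : ℝ) : MeasurePreserving (shear e) := by
  refine (MeasurePreserving.id (volume : Measure ℝ)).skew_product
    (μc := (volume : Measure ℝ)) (g := fun x y => x + y - e) (by
      show Measurable fun p : ℝ × ℝ => p.1 + p.2 - e
      fun_prop) (Eventually.of_forall fun x => ?_)
  have := (measurePreserving_add_left (volume : Measure ℝ) (x - e)).map_eq
  simpa [add_sub_right_comm] using this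

theorem integral_shear (e : ℝ) (F : ℝ × ℝ → ℝ) :
    ∫ p : ℝ × ℝ, F (p.1, p.1 + p.2 - e) = ∫ p, F p :=
  (measurePreserving_shear e).integral_comp' (g := F)

theorem integrable_shear {e : ℝ} {F : ℝ × ℝ → ℝ} (hF : Integrable F) :
    Integrable fun p : ℝ × ℝ => F (p.1, p.1 + p.2 - e) :=
  ((measurePreserving_shear e).integrable_comp_emb (shear e).measurableEmbedding).2 hF

theorem integral_swap_real (F : ℝ × ℝ → ℝ) : ∫ p : ℝ × ℝ, F (p.2, p.1) = ∫ p, F p :=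
  integral_prod_swap (μ := (volume : Measure ℝ)) (ν := (volume : Measure ℝ)) F

theorem integrable_swap_real {F : ℝ × ℝ → ℝ} (hF : Integrable F) :
    Integrable fun p : ℝ × ℝ => F (p.2, p.1) :=
  Integrable.swap (μ := (volume : Measure ℝ)) (ν := (volume : Measure ℝ)) hF

/-! ### Integrals of the kernel -/

theorem integrable_mul_kernelW {F : ℝ × ℝ → ℝ} (hF : Integrable F) (e : ℝ) :
    Integrable fun p : ℝ × ℝ => F p * kernelW e p.1 p.2 := by
  refine hF.norm.mono' (hF.aestronglyMeasurable.mul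
    (measurable_kernelW_comp measurable_const measurable_fst measurable_snd).aestronglyMeasurable)
    (Eventually.of_forall fun p => ?_)
  exact abs_mul_kernelW_le le_rfl _ _ _

theorem integral_mul_kernelW_le {F : ℝ × ℝ → ℝ} (hF : Integrable F) (hF0 : ∀ p, 0 ≤ F p)
    (e : ℝ) : ∫ p : ℝ × ℝ, F p * kernelW e p.1 p.2 ≤ ∫ p, F p :=
  integral_mono (integrable_mul_kernelW hF e) hF fun p =>
    mul_le_of_le_one_right (hF0 p) (kernelW_le_one _ _ _)

theorem integrable_left_right {f g : ℝ → ℝ} (hf : Integrable f) (hg : Integrable g) :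
    Integrable fun p : ℝ × ℝ => f p.1 * g p.2 :=
  hf.mul_prod hg

theorem integral_left_right (f g : ℝ → ℝ) :
    ∫ p : ℝ × ℝ, f p.1 * g p.2 = (∫ x, f x) * ∫ x, g x :=
  integral_prod_mul (μ := (volume : Measure ℝ)) (ν := (volume : Measure ℝ)) f g

theorem integrable_left_second {f g : ℝ → ℝ} (hf : Integrable f) (hg : Integrable g) (e : ℝ) :
    Integrable fun p : ℝ × ℝ => f p.1 * g (p.1 + p.2 - e) :=
  integrable_shear (F := fun p => f p.1 * g p.2) (integrable_left_right hf hg)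

theorem integral_left_second (f g : ℝ → ℝ) (e : ℝ) :
    ∫ p : ℝ × ℝ, f p.1 * g (p.1 + p.2 - e) = (∫ x, f x) * ∫ x, g x := by
  rw [← integral_left_right f g]
  exact integral_shear e (fun p => f p.1 * g p.2)

theorem integrable_right_second {f g : ℝ → ℝ} (hf : Integrable f) (hg : Integrable g) (e : ℝ) :
    Integrable fun p : ℝ × ℝ => f p.2 * g (p.1 + p.2 - e) := by
  have := integrable_swap_real (integrable_left_second hf hg e)
  simpa [add_comm] using this

theorem integral_right_second (f g : ℝ → ℝ) (e : ℝ) :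
    ∫ p : ℝ × ℝ, f p.2 * g (p.1 + p.2 - e) = (∫ x, f x) * ∫ x, g x := by
  rw [← integral_left_second f g e,
    ← integral_swap_real (fun p => f p.1 * g (p.1 + p.2 - e))]
  simp [add_comm]

section Slice

variable {e y : ℝ}

theorem kernelW_slice_le (e y z : ℝ) :
    kernelW e z (y + e - z) ≤ (Ioo 0 (y + e)).indicator (fun _ => min 1 (√y / √e)) z := by
  by_cases hz : z ∈ Ioo 0 (y + e)
  · rw [indicator_of_mem hz]
    refine le_min (kernelW_le_one _ _ _) ((kernelW_le_second _ _ _).trans_eq ?_)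
    congr 2; ring
  · rw [indicator_of_notMem hz]
    rcases not_and_or.1 hz with h | h
    · rw [kernelW_eq_zero_of_left (not_lt.1 h)]
    · rw [kernelW_eq_zero_of_right (by linarith [not_lt.1 h])]

theorem integrable_slice_bound (a c : ℝ) :
    Integrable ((Ioo 0 a).indicator (fun _ : ℝ => c)) :=
  (integrable_indicator_iff measurableSet_Ioo).2 (by simp)

theorem integrable_kernelW_slice (e y : ℝ) :
    Integrable fun z => kernelW e z (y + e - z) :=
  (integrable_slice_bound (y + e) (min 1 (√y / √e))).mono'
    (Measurable.aestronglyMeasurable (by fun_prop)) (Eventually.of_forall fun z => by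
      rw [Real.norm_eq_abs, abs_of_nonneg (kernelW_nonneg _ _ _)]
      exact kernelW_slice_le e y z)

/-- The pairs `(ε₃, ε₄)` with a given sum `y + e` form a segment of length `y + e`, on which the
kernel is at most `min 1 √(y / e)`. -/
theorem integral_kernelW_slice_le (he : 0 < e) (hy : 0 < y) :
    ∫ z, kernelW e z (y + e - z) ≤ √e * √y + y := by
  have h1 := integral_mono (integrable_kernelW_slice e y)
    (integrable_slice_bound (y + e) (min 1 (√y / √e))) (kernelW_slice_le e y)
  have h2 : ∫ z, (Ioo 0 (y + e)).indicator (fun _ : ℝ => min 1 (√y / √e)) z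
      = (y + e) * min 1 (√y / √e) := by
    rw [integral_indicator measurableSet_Ioo]
    simp [Measure.real, ENNReal.toReal_ofReal (by linarith : 0 ≤ y + e)]
  rw [h2] at h1
  refine h1.trans ?_
  have hse := Real.sqrt_pos.2 he
  have hsy := Real.sqrt_pos.2 hy
  have hee := Real.mul_self_sqrt he.le
  have hyy := Real.mul_self_sqrt hy.le
  rcases le_total y e with h | h
  · have hle := Real.sqrt_le_sqrt h
    calc (y + e) * min 1 (√y / √e) ≤ (y + e) * (√y / √e) :=
          mul_le_mul_of_nonneg_left (min_le_right _ _) (by linarith)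
      _ = y * (√y / √e) + √e * √y * (√e / √e) := by
          field_simp; nlinarith
      _ ≤ y * 1 + √e * √y * 1 := by
          gcongr
          · exact div_le_one_of_le₀ hle hse.le
          · exact div_le_one_of_le₀ le_rfl hse.le
      _ = _ := by ring
  · have hle := Real.sqrt_le_sqrt h
    calc (y + e) * min 1 (√y / √e) ≤ (y + e) * 1 :=
          mul_le_mul_of_nonneg_left (min_le_left _ _) (by linarith)
      _ ≤ _ := by nlinarith

/-- If `y ≤ ε₃ ≤ e` on the segment `ε₃ + ε₄ = y + e`, then `ε₂ = y` is the smallest of the four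
energies and the kernel equals `√y / √e`. For `e < y` the lower bound is trivial. -/
theorem le_integral_kernelW_slice (e y : ℝ) :
    √y * (e - y) / √e ≤ ∫ z, kernelW e z (y + e - z) := by
  rcases le_total e y with h | h
  · refine le_trans ?_ (integral_nonneg fun z => kernelW_nonneg _ _ _)
    exact div_nonpos_of_nonpos_of_nonneg
      (mul_nonpos_of_nonneg_of_nonpos (Real.sqrt_nonneg _) (by linarith)) (Real.sqrt_nonneg _)
  · have h1 : ∫ z in Ioo y e, √y / √e ≤ ∫ z in Ioo y e, kernelW e z (y + e - z) := by
      refine setIntegral_mono_on (by simp) (integrable_kernelW_slice e y).integrableOn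
        measurableSet_Ioo fun z hz => ?_
      unfold kernelW
      refine div_le_div_of_nonneg_right (le_min (le_min (Real.sqrt_le_sqrt h) ?_)
        (le_min (Real.sqrt_le_sqrt hz.1.le) ?_)) (Real.sqrt_nonneg _)
      · exact Real.sqrt_le_sqrt (by linarith)
      · exact Real.sqrt_le_sqrt (by linarith [hz.2])
    have h2 : ∫ z in Ioo y e, √y / √e = √y * (e - y) / √e := by
      simp [Measure.real, ENNReal.toReal_ofReal (by linarith : 0 ≤ e - y)]; ring
    rw [← h2]
    exact h1.trans (setIntegral_le_integral (integrable_kernelW_slice e y)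
      (Eventually.of_forall fun z => kernelW_nonneg _ _ _))

end Slice

theorem second_kernel_eq (k : ℝ → ℝ) (e : ℝ) (p : ℝ × ℝ) :
    k (p.1 + p.2 - e) * kernelW e p.1 p.2 =
      (fun q : ℝ × ℝ => k q.2 * kernelW e q.1 (q.2 + e - q.1)) (p.1, p.1 + p.2 - e) := by
  simp

theorem integrable_second_kernel_aux {β H e : ℝ} {k : ℝ → ℝ} (hk : IsDensity β H k) (hβ : 3 < β)
    (he : 0 < e) : Integrable fun q : ℝ × ℝ => k q.2 * kernelW e q.1 (q.2 + e - q.1) := by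
  have hm : Measurable fun q : ℝ × ℝ => k q.2 * kernelW e q.1 (q.2 + e - q.1) :=
    (hk.meas.comp measurable_snd).mul (by fun_prop)
  refine (integrable_prod_iff' (μ := (volume : Measure ℝ)) (ν := (volume : Measure ℝ))
    hm.aestronglyMeasurable).2 ⟨Eventually.of_forall fun y => ?_, ?_⟩
  · rcases le_or_gt y 0 with hy | hy
    · simp [hk.eq_zero hy]
    · exact (integrable_kernelW_slice e y).const_mul (k y)
  · refine ((hk.integrable_mul_sqrt hβ).const_mul (√e) |>.add (hk.integrable_mul_id hβ)).mono'
      (hm.norm.aestronglyMeasurable.prod_swap.integral_prod_right')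
      (Eventually.of_forall fun y => ?_)
    rw [Real.norm_eq_abs, abs_of_nonneg (integral_nonneg fun _ => norm_nonneg _)]
    simp only [norm_mul, Real.norm_eq_abs, abs_of_nonneg (kernelW_nonneg _ _ _),
      abs_of_nonneg (hk.nonneg y), integral_const_mul, Pi.add_apply]
    rcases le_or_gt y 0 with hy | hy
    · simp [hk.eq_zero hy]
    · have := mul_le_mul_of_nonneg_left (integral_kernelW_slice_le he hy) (hk.nonneg y)
      linarith

/-- `h(ε₂) W` is integrable in `(ε₃, ε₄)`, although `h(ε₂)` alone is not. -/
theorem integrable_second_kernel {β H : ℝ} {k : ℝ → ℝ} (hk : IsDensity β H k) (hβ : 3 < β)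
    (e : ℝ) : Integrable fun p : ℝ × ℝ => k (p.1 + p.2 - e) * kernelW e p.1 p.2 := by
  rcases le_or_gt e 0 with he | he
  · simp [kernelW_eq_zero_of_first he]
  · simp only [second_kernel_eq]
    exact integrable_shear (integrable_second_kernel_aux hk hβ he)

/-- Integration along the segments on which `ε₂` is constant. -/
theorem integral_second_kernel_eq {β H e : ℝ} {k : ℝ → ℝ} (hk : IsDensity β H k) (hβ : 3 < β)
    (he : 0 < e) : ∫ p : ℝ × ℝ, k (p.1 + p.2 - e) * kernelW e p.1 p.2 =
      ∫ y, k y * ∫ z, kernelW e z (y + e - z) := by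
  simp only [second_kernel_eq]
  rw [integral_shear e (fun q : ℝ × ℝ => k q.2 * kernelW e q.1 (q.2 + e - q.1))]
  refine (integral_prod_symm (μ := (volume : Measure ℝ)) (ν := (volume : Measure ℝ)) _
    (integrable_second_kernel_aux hk hβ he)).trans ?_
  simp only [integral_const_mul]

theorem integrable_mul_slice {β H e : ℝ} {k : ℝ → ℝ} (hk : IsDensity β H k) (hβ : 3 < β)
    (he : 0 < e) : Integrable fun y => k y * ∫ z, kernelW e z (y + e - z) := by
  have := (integrable_second_kernel_aux hk hβ he).integral_prod_right
    (μ := (volume : Measure ℝ)) (ν := (volume : Measure ℝ))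
  simpa only [integral_const_mul] using this

theorem integral_second_kernel_le {β H e : ℝ} {k : ℝ → ℝ} (hk : IsDensity β H k) (hβ : 3 < β)
    (he : 0 < e) : ∫ p : ℝ × ℝ, k (p.1 + p.2 - e) * kernelW e p.1 p.2 ≤
      √e * massMoment k + ∫ y, k y * y := by
  rw [integral_second_kernel_eq hk hβ he, massMoment, ← integral_const_mul,
    ← integral_add ((hk.integrable_mul_sqrt hβ).const_mul _) (hk.integrable_mul_id hβ)]
  refine integral_mono (integrable_mul_slice hk hβ he)
    (((hk.integrable_mul_sqrt hβ).const_mul _).add (hk.integrable_mul_id hβ)) fun y => ?_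
  rcases le_or_gt y 0 with hy | hy
  · simp [hk.eq_zero hy]
  · have := mul_le_mul_of_nonneg_left (integral_kernelW_slice_le he hy) (hk.nonneg y)
    linarith

theorem le_integral_second_kernel {β H e : ℝ} {k : ℝ → ℝ} (hk : IsDensity β H k) (hβ : 3 < β)
    (he : 0 < e) : √e * massMoment k - fullMoment k ≤
      ∫ p : ℝ × ℝ, k (p.1 + p.2 - e) * kernelW e p.1 p.2 := by
  rcases le_total e 1 with h1 | h1
  · refine le_trans ?_ (integral_nonneg fun p => mul_nonneg (hk.nonneg _) (kernelW_nonneg _ _ _))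
    have := mul_le_mul_of_nonneg_right (Real.sqrt_le_one.2 h1) hk.massMoment_nonneg
    linarith [hk.massMoment_le hβ]
  · have hse : 1 ≤ √e := Real.one_le_sqrt.2 h1
    have hee := Real.mul_self_sqrt he.le
    have hI := (hk.integrable_mul_sqrt hβ).const_mul (√e)
    have hJ := (hk.integrable_mul_mul_sqrt hβ).const_mul (1 / √e)
    have key : √e * massMoment k - 1 / √e * ∫ y, k y * (y * √y) ≤
        ∫ p : ℝ × ℝ, k (p.1 + p.2 - e) * kernelW e p.1 p.2 := by
      rw [integral_second_kernel_eq hk hβ he, massMoment, ← integral_const_mul,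
        ← integral_const_mul, ← integral_sub hI hJ]
      refine integral_mono (hI.sub hJ) (integrable_mul_slice hk hβ he) fun y => ?_
      rcases le_or_gt y 0 with hy | hy
      · simp [hk.eq_zero hy]
      · have := mul_le_mul_of_nonneg_left (le_integral_kernelW_slice e y) (hk.nonneg y)
        refine le_trans (le_of_eq ?_) this
        have : √e ≠ 0 := by positivity
        field_simp
        rw [Real.sq_sqrt he.le]
    have h2 : 1 / √e * ∫ y, k y * (y * √y) ≤ fullMoment k := by
      refine le_trans ?_ (hk.integral_mul_mul_sqrt_le hβ)
      refine mul_le_of_le_one_left (integral_nonneg fun y =>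
        mul_nonneg (hk.nonneg y) (mul_sqrt_nonneg y)) ?_
      rw [div_le_one (by linarith)]; exact hse
    linarith

/-! ### The collision rates as integrals over the plane -/

/-- The integrand of the gain rate. -/
noncomputable def gainIntegrand (h : ℝ → ℝ) (e : ℝ) (p : ℝ × ℝ) : ℝ :=
  h p.1 * h p.2 * (1 + h e + h (p.1 + p.2 - e)) * kernelW e p.1 p.2

/-- The integrand of the loss frequency. -/
noncomputable def lossIntegrand (h : ℝ → ℝ) (e : ℝ) (p : ℝ × ℝ) : ℝ :=
  h (p.1 + p.2 - e) * (1 + h p.1 + h p.2) * kernelW e p.1 p.2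

section Rates

variable {β H : ℝ} {h : ℝ → ℝ}

theorem gainIntegrand_nonneg (hh : IsDensity β H h) (e : ℝ) (p : ℝ × ℝ) :
    0 ≤ gainIntegrand h e p := by
  have h1 := hh.nonneg p.1
  have h2 := hh.nonneg p.2
  have h3 := hh.nonneg e
  have h4 := hh.nonneg (p.1 + p.2 - e)
  have h5 := kernelW_nonneg e p.1 p.2
  unfold gainIntegrand; positivity

theorem lossIntegrand_nonneg (hh : IsDensity β H h) (e : ℝ) (p : ℝ × ℝ) :
    0 ≤ lossIntegrand h e p := by
  have h1 := hh.nonneg p.1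
  have h2 := hh.nonneg p.2
  have h4 := hh.nonneg (p.1 + p.2 - e)
  have h5 := kernelW_nonneg e p.1 p.2
  unfold lossIntegrand; positivity

theorem measurable_gainIntegrand (hh : Measurable h) :
    Measurable fun q : ℝ × ℝ × ℝ => gainIntegrand h q.1 q.2 := by
  unfold gainIntegrand; fun_prop

theorem measurable_lossIntegrand (hh : Measurable h) :
    Measurable fun q : ℝ × ℝ × ℝ => lossIntegrand h q.1 q.2 := by
  unfold lossIntegrand; fun_prop

theorem gainIntegrand_le (hh : IsDensity β H h) (hβ : 0 ≤ β) (e : ℝ) (p : ℝ × ℝ) :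
    gainIntegrand h e p ≤ (1 + 2 * H) * (h p.1 * h p.2) := by
  have h1 := hh.nonneg p.1
  have h2 := hh.nonneg p.2
  have h3 := hh.le_bound hβ e
  have h4 := hh.le_bound hβ (p.1 + p.2 - e)
  have h12 : 0 ≤ h p.1 * h p.2 := by positivity
  have hs : 0 ≤ 1 + h e + h (p.1 + p.2 - e) := by
    linarith [hh.nonneg e, hh.nonneg (p.1 + p.2 - e)]
  unfold gainIntegrand
  refine (mul_le_of_le_one_right (mul_nonneg h12 hs) (kernelW_le_one _ _ _)).trans ?_
  rw [mul_comm]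
  exact mul_le_mul_of_nonneg_right (by linarith) h12

theorem lossIntegrand_le (hh : IsDensity β H h) (hβ : 0 ≤ β) (e : ℝ) (p : ℝ × ℝ) :
    lossIntegrand h e p ≤ (1 + 2 * H) * (h (p.1 + p.2 - e) * kernelW e p.1 p.2) := by
  have h3 := hh.le_bound hβ p.1
  have h4 := hh.le_bound hβ p.2
  have h5 := mul_nonneg (hh.nonneg (p.1 + p.2 - e)) (kernelW_nonneg e p.1 p.2)
  unfold lossIntegrand
  calc _ = (1 + h p.1 + h p.2) * (h (p.1 + p.2 - e) * kernelW e p.1 p.2) := by ring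
    _ ≤ _ := mul_le_mul_of_nonneg_right (by linarith) h5

theorem integrable_gainIntegrand (hh : IsDensity β H h) (hβ : 3 < β) (e : ℝ) :
    Integrable (gainIntegrand h e) := by
  have hi := hh.integrable hβ
  refine ((integrable_left_right hi hi).const_mul (1 + 2 * H)).mono'
    ((measurable_gainIntegrand hh.meas).comp measurable_prodMk_left).aestronglyMeasurable
    (Eventually.of_forall fun p => ?_)
  rw [Real.norm_eq_abs, abs_of_nonneg (gainIntegrand_nonneg hh e p)]
  exact gainIntegrand_le hh (by linarith) e p

theorem integrable_lossIntegrand (hh : IsDensity β H h) (hβ : 3 < β) (e : ℝ) :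
    Integrable (lossIntegrand h e) := by
  refine ((integrable_second_kernel hh hβ e).const_mul (1 + 2 * H)).mono'
    ((measurable_lossIntegrand hh.meas).comp measurable_prodMk_left).aestronglyMeasurable
    (Eventually.of_forall fun p => ?_)
  rw [Real.norm_eq_abs, abs_of_nonneg (lossIntegrand_nonneg hh e p)]
  exact lossIntegrand_le hh (by linarith) e p

/-- Iterated integrals over the quadrant of functions that vanish off it. -/
theorem iterated_integral_Ioi_eq {F : ℝ × ℝ → ℝ} (hF : Integrable F)
    (h1 : ∀ p : ℝ × ℝ, p.1 ≤ 0 → F p = 0) (h2 : ∀ p : ℝ × ℝ, p.2 ≤ 0 → F p = 0) :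
    ∫ x in Ioi (0 : ℝ), ∫ y in Ioi (0 : ℝ), F (x, y) = ∫ p, F p := by
  have hin : ∀ x, ∫ y in Ioi (0 : ℝ), F (x, y) = ∫ y, F (x, y) := fun x =>
    setIntegral_eq_integral_of_forall_compl_eq_zero fun y hy => h2 _ (not_lt.1 hy)
  simp only [hin]
  rw [setIntegral_eq_integral_of_forall_compl_eq_zero fun x hx => by
    simp [h1 (x, _) (not_lt.1 hx)]]
  exact (integral_prod (μ := (volume : Measure ℝ)) (ν := (volume : Measure ℝ)) _ hF).symm

theorem gain_eq (hh : IsDensity β H h) (hβ : 3 < β) (e : ℝ) :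
    gain h e = collisionConst * ∫ p, gainIntegrand h e p := by
  unfold gain collisionConst
  rw [← iterated_integral_Ioi_eq (integrable_gainIntegrand hh hβ e)]
  · rfl
  · intro p hp; simp [gainIntegrand, kernelW_eq_zero_of_left hp]
  · intro p hp; simp [gainIntegrand, kernelW_eq_zero_of_right hp]

theorem lossRate_eq (hh : IsDensity β H h) (hβ : 3 < β) (e : ℝ) :
    lossRate h e = collisionConst * ∫ p, lossIntegrand h e p := by
  unfold lossRate collisionConst
  rw [← iterated_integral_Ioi_eq (integrable_lossIntegrand hh hβ e)]
  · rfl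
  · intro p hp; simp [lossIntegrand, kernelW_eq_zero_of_left hp]
  · intro p hp; simp [lossIntegrand, kernelW_eq_zero_of_right hp]

theorem gain_nonneg (hh : IsDensity β H h) (hβ : 3 < β) (e : ℝ) : 0 ≤ gain h e := by
  rw [gain_eq hh hβ]
  exact mul_nonneg collisionConst_pos.le (integral_nonneg (gainIntegrand_nonneg hh e))

theorem lossRate_nonneg (hh : IsDensity β H h) (hβ : 3 < β) (e : ℝ) : 0 ≤ lossRate h e := by
  rw [lossRate_eq hh hβ]
  exact mul_nonneg collisionConst_pos.le (integral_nonneg (lossIntegrand_nonneg hh e))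

/-- The growth `√e` of the loss frequency at high energies, with its sharp constant. -/
theorem lossRate_ge (hh : IsDensity β H h) (hβ : 3 < β) {e : ℝ} (he : 0 < e) :
    collisionConst * (√e * massMoment h - fullMoment h) ≤ lossRate h e := by
  rw [lossRate_eq hh hβ]
  refine mul_le_mul_of_nonneg_left ((le_integral_second_kernel hh hβ he).trans ?_)
    collisionConst_pos.le
  refine integral_mono (integrable_second_kernel hh hβ e) (integrable_lossIntegrand hh hβ e)
    fun p => ?_
  unfold lossIntegrand
  refine mul_le_mul_of_nonneg_right ?_ (kernelW_nonneg _ _ _)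
  exact le_mul_of_one_le_right (hh.nonneg _) (by linarith [hh.nonneg p.1, hh.nonneg p.2])

/-- The loss frequency grows at most like `√e`. -/
theorem lossRate_le (hh : IsDensity β H h) (hβ : 3 < β) {e : ℝ} (he : 0 < e) :
    lossRate h e ≤ collisionConst * (1 + 2 * H) * fullMoment h * (1 + √e) := by
  have h1 : ∫ p, lossIntegrand h e p ≤
      (1 + 2 * H) * ∫ p : ℝ × ℝ, h (p.1 + p.2 - e) * kernelW e p.1 p.2 := by
    rw [← integral_const_mul]
    exact integral_mono (integrable_lossIntegrand hh hβ e)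
      ((integrable_second_kernel hh hβ e).const_mul _) (lossIntegrand_le hh (by linarith) e)
  have h2 := integral_second_kernel_le hh hβ he
  have h3 : √e * massMoment h ≤ √e * fullMoment h :=
    mul_le_mul_of_nonneg_left (hh.massMoment_le hβ) (Real.sqrt_nonneg _)
  have h4 := hh.integral_mul_id_le hβ
  have hH := hh.bound_nonneg
  rw [lossRate_eq hh hβ]
  calc _ ≤ collisionConst * ((1 + 2 * H) * (√e * fullMoment h + fullMoment h)) := by
        refine mul_le_mul_of_nonneg_left (h1.trans ?_) collisionConst_pos.le
        exact mul_le_mul_of_nonneg_left (by linarith) (by linarith)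
    _ = _ := by ring

end Rates

/-! ### Collision integrals in weighted spaces -/

/-- If `x` and `y` collide to produce `e`, then `x ≥ max (e - y) (e / 2)` when `x` is the larger
one; the tail of the decay beyond that point is its tail beyond `e`, up to a relative error
`y / (1 + e)`. -/
theorem tail_shift_le {β e y : ℝ} (hβ : 3 < β) (he : 0 < e) (hy : 0 < y) :
    (1 + max (e - y) (e / 2)) ^ (1 - β) ≤
      (1 + e) ^ (1 - β) * (1 + 2 ^ β * (y / (1 + e))) := by
  have h1e : 0 < 1 + e := by linarith
  have hX1 := le_max_left (e - y) (e / 2)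
  have hX2 := le_max_right (e - y) (e / 2)
  set X := max (e - y) (e / 2)
  have hdouble : (2 : ℝ) ^ β = 2 * 2 ^ (β - 1) := by
    rw [Real.rpow_sub (by norm_num), Real.rpow_one]; ring
  have hneg : ∀ t : ℝ, 0 < t → t ^ (1 - β) = (t ^ (β - 1))⁻¹ := fun t ht => by
    rw [← Real.rpow_neg ht.le]; congr 1; ring
  have key : ∀ c : ℝ, 0 < c → (1 + e) / c ≤ 1 + X →
      (1 + X) ^ (1 - β) ≤ (1 + e) ^ (1 - β) * c ^ (β - 1) := by
    intro c hc hcX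
    calc (1 + X) ^ (1 - β) ≤ ((1 + e) / c) ^ (1 - β) :=
          Real.rpow_le_rpow_of_nonpos (by positivity) hcX (by linarith)
      _ = (1 + e) ^ (1 - β) * c ^ (β - 1) := by
          rw [Real.div_rpow h1e.le hc.le, hneg c hc, div_inv_eq_mul]
  set z := y / (1 + e) with hz
  have hz0 : 0 < z := by positivity
  have hyz : y = (1 + e) * z := by rw [hz]; field_simp
  have h2pos : (0 : ℝ) < 2 ^ (β - 1) := by positivity
  have h1ep : 0 < (1 + e) ^ (1 - β) := by positivity
  -- for `z < 1/2` use `1 + X ≥ (1 + e) (1 - z)`, and that `c ^ (β - 1)` lies below its chord on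
  -- `[1, 2]`; for larger `z` it is enough that `X ≥ e / 2`
  rcases le_or_gt (1 / 2) z with h | h
  · refine (key 2 two_pos (by linarith)).trans (mul_le_mul_of_nonneg_left ?_ h1ep.le)
    rw [hdouble]; nlinarith
  · have hc : 0 < 1 + 2 * z := by linarith
    refine (key (1 + 2 * z) hc ?_).trans (mul_le_mul_of_nonneg_left ?_ h1ep.le)
    · rw [div_le_iff₀ hc]
      have : (1 + e) * 1 ≤ (1 + e) * ((1 - z) * (1 + 2 * z)) :=
        mul_le_mul_of_nonneg_left (by nlinarith) h1e.le
      have h3 : (1 + e) * (1 - z) ≤ 1 + X := by nlinarith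
      nlinarith [mul_le_mul_of_nonneg_right h3 hc.le]
    · have hcv := convexOn_rpow (show 1 ≤ β - 1 by linarith)
      have := hcv.2 (show (1 : ℝ) ∈ Ici 0 by simp) (show (2 : ℝ) ∈ Ici 0 by simp)
        (show 0 ≤ 1 - 2 * z by linarith) (show 0 ≤ 2 * z by linarith) (by ring)
      simp only [smul_eq_mul, Real.one_rpow, mul_one] at this
      rw [show 1 - 2 * z + 2 * z * 2 = 1 + 2 * z by ring] at this
      rw [hdouble]; nlinarith

section Collision

variable {β γ A B e : ℝ} {f g k : ℝ → ℝ}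

theorem integral_far_le (hf : IsDensity β A f) (hβ : 3 < β) {x : ℝ} (hx : 0 ≤ x) :
    ∫ y in Ici x, f y ≤ A * ((1 + x) ^ (1 - β) / (β - 1)) := by
  rw [integral_Ici_eq_integral_Ioi, ← integral_tail_decay (by linarith) hx,
    ← integral_const_mul]
  exact setIntegral_mono (hf.integrable hβ).integrableOn
    ((integrable_decay (by linarith)).const_mul A).integrableOn hf.le

/-- The pairs of energies whose larger member is the first one, as far as collisions that produce
`e` are concerned. -/
def farSet (e : ℝ) : Set (ℝ × ℝ) := {p | max (e - p.2) (e / 2) ≤ p.1}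

theorem measurableSet_farSet (e : ℝ) : MeasurableSet (farSet e) :=
  measurableSet_le (by fun_prop) (by fun_prop)

theorem integrable_far (hf : IsDensity β A f) (hg : IsDensity γ B g) (hβ : 3 < β) (hγ : 3 < γ)
    (e : ℝ) : Integrable ((farSet e).indicator fun p : ℝ × ℝ => f p.1 * (g p.2 * √p.2)) :=
  (integrable_left_right (hf.integrable hβ) (hg.integrable_mul_sqrt hγ)).indicator
    (measurableSet_farSet e)

/-- For the smaller energy fixed, the larger one is integrated over its tail. The leading term is
the tail `(1 + e)^(1 - β) / (β - 1)` of the decay, times the mass of the other density. -/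
theorem integral_far_pair_le (hf : IsDensity β A f) (hg : IsDensity γ B g) (hβ : 3 < β)
    (hγ : 3 < γ) (he : 1 ≤ e) :
    ∫ p, (farSet e).indicator (fun p : ℝ × ℝ => f p.1 * (g p.2 * √p.2)) p ≤
      √e * (A * decay β e * (√e * massMoment g / (β - 1) + (1 + 2 ^ β) * fullMoment g)) := by
  have he0 : 0 < e := by linarith
  have hA := hf.bound_nonneg
  have hint := integrable_far hf hg hβ hγ e
  have h1 := (integral_prod_symm (μ := (volume : Measure ℝ)) (ν := (volume : Measure ℝ)) _ hint)
  have hI1 := hg.integrable_mul_sqrt hγ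
  have hI2 := (hg.integrable_mul_mul_sqrt hγ).const_mul (2 ^ β / (1 + e))
  set c := A * ((1 + e) ^ (1 - β) / (β - 1)) with hc
  have hc0 : 0 ≤ c := mul_nonneg hA (div_nonneg (by positivity) (by linarith))
  have h2 : ∫ p, (farSet e).indicator (fun p : ℝ × ℝ => f p.1 * (g p.2 * √p.2)) p ≤
      c * (massMoment g + 2 ^ β / (1 + e) * ∫ y, g y * (y * √y)) := by
    rw [show (∫ p, (farSet e).indicator (fun p : ℝ × ℝ => f p.1 * (g p.2 * √p.2)) p) = _ from h1,
      massMoment, ← integral_const_mul, ← integral_add hI1 hI2, ← integral_const_mul]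
    refine integral_mono hint.integral_prod_right ((hI1.add hI2).const_mul c) fun y => ?_
    rcases le_or_gt y 0 with hy | hy
    · simp [indicator, hg.eq_zero hy]
    have hX : 0 ≤ max (e - y) (e / 2) := le_max_of_le_right (by linarith)
    have h3 : ∫ x, (farSet e).indicator (fun p : ℝ × ℝ => f p.1 * (g p.2 * √p.2)) (x, y) =
        (g y * √y) * ∫ x in Ici (max (e - y) (e / 2)), f x := by
      rw [← integral_const_mul, ← integral_indicator measurableSet_Ici]
      congr 1; ext x
      by_cases hx : max (e - y) (e / 2) ≤ x
      · rw [indicator_of_mem (show (x, y) ∈ farSet e from hx),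
          indicator_of_mem (show x ∈ Ici _ from hx)]; ring
      · rw [indicator_of_notMem (show (x, y) ∉ farSet e from hx),
          indicator_of_notMem (show x ∉ Ici _ from hx)]
    have hgy : 0 ≤ g y * √y := mul_nonneg (hg.nonneg y) (Real.sqrt_nonneg y)
    calc _ = (g y * √y) * ∫ x in Ici (max (e - y) (e / 2)), f x := h3
      _ ≤ (g y * √y) * (A * ((1 + max (e - y) (e / 2)) ^ (1 - β) / (β - 1))) :=
          mul_le_mul_of_nonneg_left (integral_far_le hf hβ hX) hgy
      _ ≤ (g y * √y) * (A * ((1 + e) ^ (1 - β) * (1 + 2 ^ β * (y / (1 + e))) / (β - 1))) := by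
          refine mul_le_mul_of_nonneg_left (mul_le_mul_of_nonneg_left
            (div_le_div_of_nonneg_right (tail_shift_le hβ he0 hy) (by linarith)) hA) hgy
      _ = c * (g y * √y + 2 ^ β / (1 + e) * (g y * (y * √y))) := by rw [hc]; ring
  refine h2.trans ?_
  have hm := hg.massMoment_le hγ
  have hm0 := hg.massMoment_nonneg
  have hv := hg.integral_mul_mul_sqrt_le hγ
  have hG := hg.fullMoment_nonneg
  have hse : 1 ≤ √e := Real.one_le_sqrt.2 he
  have hee := Real.mul_self_sqrt he0.le
  have hcd : c = A * decay β e * ((1 + e) / (β - 1)) := by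
    rw [hc, decay_of_pos he0, sub_eq_add_neg 1 β, Real.rpow_add (by linarith), Real.rpow_one]
    ring
  have hAd : 0 ≤ A * decay β e := mul_nonneg hA (decay_nonneg _ _)
  have h2β : (0 : ℝ) < 2 ^ β := by positivity
  have hb1 : 1 ≤ β - 1 := by linarith
  calc c * (massMoment g + 2 ^ β / (1 + e) * ∫ y, g y * (y * √y))
      ≤ c * (massMoment g + 2 ^ β / (1 + e) * fullMoment g) := by gcongr
    _ = A * decay β e * ((e * massMoment g) / (β - 1)
          + (massMoment g + 2 ^ β * fullMoment g) / (β - 1)) := by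
        rw [hcd]; field_simp; ring
    _ ≤ A * decay β e * ((e * massMoment g) / (β - 1)
          + (fullMoment g + 2 ^ β * fullMoment g) / 1) := by gcongr
    _ ≤ A * decay β e * ((e * massMoment g) / (β - 1)
          + √e * ((1 + 2 ^ β) * fullMoment g)) := by
        have : 0 ≤ (1 + 2 ^ β) * fullMoment g := by positivity
        refine mul_le_mul_of_nonneg_left ?_ hAd
        nlinarith
    _ = _ := by
        rw [show e * massMoment g = √e * √e * massMoment g by rw [hee]]; ring

/-- The kernel is at most the square root of the smaller one of `ε₃`, `ε₄` over `√e`, and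
the pair lies in `farSet e` once its larger member is put first. -/
theorem pair_kernel_le (hf : IsDensity β A f) (hg : IsDensity γ B g) (he : 0 < e) (p : ℝ × ℝ) :
    f p.1 * g p.2 * kernelW e p.1 p.2 ≤
      1 / √e * ((farSet e).indicator (fun p : ℝ × ℝ => f p.1 * (g p.2 * √p.2)) p +
        (farSet e).indicator (fun p : ℝ × ℝ => g p.1 * (f p.2 * √p.2)) (p.2, p.1)) := by
  have hse := Real.sqrt_pos.2 he
  have hi1 : 0 ≤ (farSet e).indicator (fun p : ℝ × ℝ => f p.1 * (g p.2 * √p.2)) p :=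
    indicator_nonneg (fun p _ => mul_nonneg (hf.nonneg _)
      (mul_nonneg (hg.nonneg _) (Real.sqrt_nonneg _))) _
  have hi2 : 0 ≤ (farSet e).indicator (fun p : ℝ × ℝ => g p.1 * (f p.2 * √p.2)) (p.2, p.1) :=
    indicator_nonneg (fun p _ => mul_nonneg (hg.nonneg _)
      (mul_nonneg (hf.nonneg _) (Real.sqrt_nonneg _))) _
  have hfg : 0 ≤ f p.1 * g p.2 := mul_nonneg (hf.nonneg _) (hg.nonneg _)
  rcases le_or_gt (p.1 + p.2) e with h | h
  · rw [kernelW_eq_zero_of_second h]; simp only [mul_zero]; positivity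
  rcases le_total p.2 p.1 with h2 | h2
  · have hmem : p ∈ farSet e :=
      show max (e - p.2) (e / 2) ≤ p.1 from max_le (by linarith) (by linarith)
    calc _ ≤ f p.1 * g p.2 * (√p.2 / √e) :=
          mul_le_mul_of_nonneg_left (kernelW_le_right _ _ _) hfg
      _ = 1 / √e * (f p.1 * (g p.2 * √p.2)) := by ring
      _ ≤ _ := by
          refine mul_le_mul_of_nonneg_left ?_ (by positivity)
          rw [indicator_of_mem hmem]; linarith
  · have hmem : (p.2, p.1) ∈ farSet e :=
      show max (e - p.1) (e / 2) ≤ p.2 from max_le (by linarith) (by linarith)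
    calc _ ≤ f p.1 * g p.2 * (√p.1 / √e) :=
          mul_le_mul_of_nonneg_left (kernelW_le_left _ _ _) hfg
      _ = 1 / √e * (g p.2 * (f p.1 * √p.1)) := by ring
      _ ≤ _ := by
          refine mul_le_mul_of_nonneg_left ?_ (by positivity)
          rw [indicator_of_mem hmem]; simp only; linarith

/-- The constant of the bilinear collision estimate. -/
noncomputable def pairConst (β : ℝ) : ℝ := 1 + 2 ^ β + 2 ^ β * decayMoment β

theorem pairConst_pos (β : ℝ) : 0 < pairConst β := by
  have := decayMoment_nonneg β
  unfold pairConst; positivity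

/-- The bilinear collision integral `∬ f(ε₃) g(ε₄) W`. -/
noncomputable def pairIntegral (f g : ℝ → ℝ) (e : ℝ) : ℝ :=
  ∫ p : ℝ × ℝ, f p.1 * g p.2 * kernelW e p.1 p.2

theorem pairIntegral_le_mul (hf : IsDensity β A f) (hg : IsDensity γ B g) (hβ : 3 < β)
    (hγ : 3 < γ) (e : ℝ) : pairIntegral f g e ≤ fullMoment f * fullMoment g := by
  refine (integral_mul_kernelW_le (integrable_left_right (hf.integrable hβ) (hg.integrable hγ))
    (fun p => mul_nonneg (hf.nonneg _) (hg.nonneg _)) e).trans ?_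
  rw [integral_left_right]
  exact mul_le_mul (hf.integral_le hβ) (hg.integral_le hγ) hg.integral_nonneg hf.fullMoment_nonneg

/-- The bilinear collision estimate. The factor `1 / (β - 1)` in front of the leading term `√e` is
the one that decides which decay rates are propagated. -/
theorem pairIntegral_le (hf : IsDensity β A f) (hg : IsDensity γ B g) (hβ : 3 < β)
    (hγ : 3 < γ) (he : 0 < e) :
    pairIntegral f g e ≤
      A * decay β e * (√e * massMoment g / (β - 1) + pairConst β * fullMoment g) +
      B * decay γ e * (√e * massMoment f / (γ - 1) + pairConst γ * fullMoment f) := by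
  have hA := hf.bound_nonneg
  have hB := hg.bound_nonneg
  have hmf := hf.massMoment_nonneg
  have hmg := hg.massMoment_nonneg
  have hFf := hf.fullMoment_nonneg
  have hFg := hg.fullMoment_nonneg
  have hdβ := decay_nonneg β e
  have hdγ := decay_nonneg γ e
  have hJβ := decayMoment_nonneg β
  have hJγ := decayMoment_nonneg γ
  have hb : 0 < β - 1 := by linarith
  have hc : 0 < γ - 1 := by linarith
  rcases le_total 1 e with h1 | h1
  · have hse := Real.sqrt_pos.2 he
    have hI1 := integrable_far hf hg hβ hγ e
    have hI2 := integrable_swap_real (integrable_far hg hf hγ hβ e)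
    have h2 : pairIntegral f g e ≤ 1 / √e *
        ((∫ p, (farSet e).indicator (fun p : ℝ × ℝ => f p.1 * (g p.2 * √p.2)) p) +
        ∫ p, (farSet e).indicator (fun p : ℝ × ℝ => g p.1 * (f p.2 * √p.2)) p) := by
      rw [← integral_swap_real
        ((farSet e).indicator (fun p : ℝ × ℝ => g p.1 * (f p.2 * √p.2))),
        ← integral_add hI1 hI2, ← integral_const_mul]
      exact integral_mono (integrable_mul_kernelW
        (integrable_left_right (hf.integrable hβ) (hg.integrable hγ)) e)
        ((hI1.add hI2).const_mul _) (pair_kernel_le hf hg he)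
    have h3 := integral_far_pair_le hf hg hβ hγ h1
    have h4 := integral_far_pair_le hg hf hγ hβ h1
    calc _ ≤ _ := h2
      _ ≤ 1 / √e * (√e * (A * decay β e *
            (√e * massMoment g / (β - 1) + (1 + 2 ^ β) * fullMoment g)) +
          √e * (B * decay γ e *
            (√e * massMoment f / (γ - 1) + (1 + 2 ^ γ) * fullMoment f))) := by gcongr
      _ = A * decay β e * (√e * massMoment g / (β - 1) + (1 + 2 ^ β) * fullMoment g) +
          B * decay γ e * (√e * massMoment f / (γ - 1) + (1 + 2 ^ γ) * fullMoment f) := by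
          field_simp
      _ ≤ _ := by
          have p1 : (1 + 2 ^ β) ≤ pairConst β := by
            unfold pairConst; linarith [mul_nonneg (show (0:ℝ) ≤ 2 ^ β by positivity) hJβ]
          have p2 : (1 + 2 ^ γ) ≤ pairConst γ := by
            unfold pairConst; linarith [mul_nonneg (show (0:ℝ) ≤ 2 ^ γ by positivity) hJγ]
          gcongr
  · refine (pairIntegral_le_mul hf hg hβ hγ e).trans ?_
    have h2 : fullMoment f ≤ A * decay β e * pairConst β := by
      have h3 := le_decay_of_le_one (show 0 ≤ β by linarith) he h1
      have h4 : decayMoment β ≤ decay β e * pairConst β := by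
        unfold pairConst
        have h6 : (0:ℝ) < 2 ^ β := by positivity
        have h5 := mul_le_mul_of_nonneg_right h3 hJβ
        nlinarith [mul_nonneg hdβ (show (0:ℝ) ≤ 1 + 2 ^ β by positivity)]
      calc fullMoment f ≤ A * decayMoment β := hf.fullMoment_le hβ
        _ ≤ A * (decay β e * pairConst β) := by gcongr
        _ = _ := by ring
    have hp1 := pairConst_pos β
    have hp2 := pairConst_pos γ
    calc fullMoment f * fullMoment g ≤ A * decay β e * pairConst β * fullMoment g := by gcongr
      _ = A * decay β e * (0 + pairConst β * fullMoment g) + 0 := by ring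
      _ ≤ _ := by gcongr <;> positivity

/-- The trilinear collision integral `∬ f(ε₃) g(ε₄) k(ε₂) W`. -/
noncomputable def tripleIntegral (f g k : ℝ → ℝ) (e : ℝ) : ℝ :=
  ∫ p : ℝ × ℝ, f p.1 * g p.2 * k (p.1 + p.2 - e) * kernelW e p.1 p.2

theorem integrable_triple {C : ℝ} (hf : IsDensity β A f) (hg : IsDensity β B g)
    (hk : IsDensity β C k) (hβ : 3 < β) (e : ℝ) :
    Integrable fun p : ℝ × ℝ => f p.1 * g p.2 * k (p.1 + p.2 - e) * kernelW e p.1 p.2 := by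
  refine integrable_mul_kernelW (((integrable_left_right (hf.integrable hβ)
    (hg.integrable hβ)).mul_const C).mono' (Measurable.aestronglyMeasurable ?_)
    (Eventually.of_forall fun p => ?_)) e
  · have := hf.meas; have := hg.meas; have := hk.meas
    fun_prop
  · have h1 := mul_nonneg (hf.nonneg p.1) (hg.nonneg p.2)
    rw [Real.norm_eq_abs, abs_of_nonneg (mul_nonneg h1 (hk.nonneg _))]
    exact mul_le_mul_of_nonneg_left (hk.le_bound (by linarith) _) h1

/-- The larger of `ε₃`, `ε₄` exceeds `e / 2`, hence its density supplies the decay in `e`, while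
the two remaining densities are integrated. -/
theorem tripleIntegral_le {C : ℝ} (hf : IsDensity β A f) (hg : IsDensity β B g)
    (hk : IsDensity β C k) (hβ : 3 < β) (he : 0 < e) :
    tripleIntegral f g k e ≤ 2 ^ β * decay β e *
      (A * (fullMoment g * fullMoment k) + B * (fullMoment f * fullMoment k)) := by
  have hA := hf.bound_nonneg
  have hB := hg.bound_nonneg
  have hI1 := (integrable_right_second (hg.integrable hβ) (hk.integrable hβ) e).const_mul A
  have hI2 := (integrable_left_second (hf.integrable hβ) (hk.integrable hβ) e).const_mul B
  have hd : 0 ≤ 2 ^ β * decay β e := mul_nonneg (by positivity) (decay_nonneg _ _)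
  calc tripleIntegral f g k e ≤ ∫ p : ℝ × ℝ, 2 ^ β * decay β e *
        (A * (g p.2 * k (p.1 + p.2 - e)) + B * (f p.1 * k (p.1 + p.2 - e))) := by
        refine integral_mono (integrable_triple hf hg hk hβ e) ((hI1.add hI2).const_mul _)
          fun p => ?_
        have hk0 := hk.nonneg (p.1 + p.2 - e)
        have hf0 := hf.nonneg p.1
        have hg0 := hg.nonneg p.2
        have hr : 0 ≤ A * (g p.2 * k (p.1 + p.2 - e)) := by positivity
        have hr' : 0 ≤ B * (f p.1 * k (p.1 + p.2 - e)) := by positivity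
        rcases le_or_gt (p.1 + p.2) e with h | h
        · simp only [kernelW_eq_zero_of_second h, mul_zero]; positivity
        refine (mul_le_of_le_one_right (by positivity) (kernelW_le_one _ _ _)).trans ?_
        rcases le_total p.2 p.1 with h2 | h2
        · have h3 : f p.1 ≤ A * (2 ^ β * decay β e) := (hf.le _).trans
            (mul_le_mul_of_nonneg_left (decay_half_le (by linarith) he (by linarith)) hA)
          calc _ ≤ A * (2 ^ β * decay β e) * g p.2 * k (p.1 + p.2 - e) := by gcongr
            _ = 2 ^ β * decay β e * (A * (g p.2 * k (p.1 + p.2 - e)) + 0) := by ring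
            _ ≤ _ := by gcongr
        · have h3 : g p.2 ≤ B * (2 ^ β * decay β e) := (hg.le _).trans
            (mul_le_mul_of_nonneg_left (decay_half_le (by linarith) he (by linarith)) hB)
          calc _ ≤ f p.1 * (B * (2 ^ β * decay β e)) * k (p.1 + p.2 - e) := by gcongr
            _ = 2 ^ β * decay β e * (0 + B * (f p.1 * k (p.1 + p.2 - e))) := by ring
            _ ≤ _ := by gcongr
    _ = 2 ^ β * decay β e *
          (A * ((∫ x, g x) * ∫ x, k x) + B * ((∫ x, f x) * ∫ x, k x)) := by
        rw [integral_const_mul, integral_add hI1 hI2, integral_const_mul, integral_const_mul,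
          integral_right_second, integral_left_second]
    _ ≤ _ := by
        have h1 := hf.integral_le hβ
        have h2 := hg.integral_le hβ
        have h3 := hk.integral_le hβ
        have h4 := hf.integral_nonneg
        have h5 := hg.integral_nonneg
        have h6 := hk.integral_nonneg
        have h7 := hg.fullMoment_nonneg
        have h8 := hf.fullMoment_nonneg
        gcongr

end Collision

/-- The ratio of gain to loss at high energies; it is below one exactly because `β > 3`. -/
noncomputable def gainRatio (β : ℝ) : ℝ := 2 / (β - 1)

theorem gainRatio_pos {β : ℝ} (hβ : 3 < β) : 0 < gainRatio β := by
  unfold gainRatio; exact div_pos two_pos (by linarith)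

theorem gainRatio_lt_one {β : ℝ} (hβ : 3 < β) : gainRatio β < 1 := by
  unfold gainRatio; rw [div_lt_one (by linarith)]; linarith

/-- The constant of the bound of the gain by the loss. -/
noncomputable def gainConst (β : ℝ) : ℝ := collisionConst * (2 * pairConst β + 2 + 2 * 2 ^ β)

theorem gainConst_pos (β : ℝ) : 0 < gainConst β := by
  have h1 := collisionConst_pos
  have h2 := pairConst_pos β
  unfold gainConst; positivity

theorem integral_gainIntegrand {β H : ℝ} {h : ℝ → ℝ} (hh : IsDensity β H h) (hβ : 3 < β)
    (e : ℝ) : ∫ p, gainIntegrand h e p =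
      (1 + h e) * pairIntegral h h e + tripleIntegral h h h e := by
  have hi := hh.integrable hβ
  unfold pairIntegral tripleIntegral
  rw [← integral_const_mul, ← integral_add ((integrable_mul_kernelW
    (integrable_left_right hi hi) e).const_mul _) (integrable_triple hh hh hh hβ e)]
  congr 1; ext p
  unfold gainIntegrand; ring

/-- The gain of a density is controlled, in its own weight, by a fraction of the loss frequency and
a constant that involves the density through its moments alone. -/
theorem gain_le {β N e : ℝ} {h : ℝ → ℝ} (hh : IsDensity β N h) (hβ : 3 < β) (he : 0 < e) :
    gain h e ≤ N * decay β e * (gainRatio β * lossRate h e +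
      gainConst β * (fullMoment h + fullMoment h ^ 2)) := by
  have hκ := collisionConst_pos
  have hN := hh.bound_nonneg
  have hG := hh.fullMoment_nonneg
  have hm := hh.massMoment_nonneg
  have hd := decay_nonneg β e
  have hP := pairConst_pos β
  have h1 := pairIntegral_le hh hh hβ hβ he
  have h2 := pairIntegral_le_mul hh hh hβ hβ e
  have h3 := tripleIntegral_le hh hh hh hβ he
  have h4 : h e * pairIntegral h h e ≤ N * decay β e * (fullMoment h * fullMoment h) :=
    (mul_le_mul_of_nonneg_left h2 (hh.nonneg e)).trans
      (mul_le_mul_of_nonneg_right (hh.le e) (mul_nonneg hG hG))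
  have h5 := mul_le_mul_of_nonneg_left (lossRate_ge hh hβ he)
    (mul_nonneg (mul_nonneg hN hd) (gainRatio_pos hβ).le)
  have h6 : N * decay β e * gainRatio β * (collisionConst * (√e * massMoment h - fullMoment h)) =
      collisionConst * (2 * (N * decay β e * (√e * massMoment h / (β - 1))) -
      N * decay β e * gainRatio β * fullMoment h) := by
    unfold gainRatio; ring
  have h7 : N * decay β e * gainRatio β * fullMoment h ≤ N * decay β e * 1 * fullMoment h := by
    have := (gainRatio_lt_one hβ).le
    gcongr
  rw [gain_eq hh hβ, integral_gainIntegrand hh hβ]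
  set S := pairIntegral h h e
  set Tr := tripleIntegral h h h e
  set G := fullMoment h
  set D := N * decay β e
  have hD : 0 ≤ D := mul_nonneg hN hd
  have h8 : (1 + h e) * S + Tr ≤ 2 * (D * (√e * massMoment h / (β - 1))) +
      D * ((2 * pairConst β + 1 + 2 * 2 ^ β) * (G + G ^ 2)) := by
    have e1 : (0:ℝ) ≤ D * G := by positivity
    have e2 : (0:ℝ) ≤ D * G ^ 2 := by positivity
    have e3 : (0:ℝ) ≤ 2 ^ β * (D * G) := by positivity
    have e4 : 0 ≤ pairConst β * (D * G ^ 2) := by positivity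
    have e5 : 2 ^ β * decay β e * (N * (G * G) + N * (G * G)) = 2 * 2 ^ β * (D * G ^ 2) := by
      simp only [D]; ring
    rw [e5] at h3
    nlinarith
  have h9 := mul_le_mul_of_nonneg_left h8 hκ.le
  have e6 : 0 ≤ collisionConst * (D * G ^ 2) := by positivity
  unfold gainConst
  nlinarith [mul_le_mul_of_nonneg_left h7 hκ.le]

/-! ### Stability of the rates -/

section Difference

variable {β γ N D e : ℝ} {h k : ℝ → ℝ}

theorem gainIntegrand_le_add (hh : IsDensity γ N h) (hk : IsDensity γ N k) (e : ℝ) (p : ℝ × ℝ) :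
    gainIntegrand h e p ≤ gainIntegrand k e p +
      ((1 + h e) * (|h p.1 - k p.1| * h p.2 * kernelW e p.1 p.2 +
          k p.1 * |h p.2 - k p.2| * kernelW e p.1 p.2) +
        (|h p.1 - k p.1| * h p.2 * h (p.1 + p.2 - e) * kernelW e p.1 p.2 +
          k p.1 * |h p.2 - k p.2| * h (p.1 + p.2 - e) * kernelW e p.1 p.2) +
        (|h e - k e| * (k p.1 * k p.2 * kernelW e p.1 p.2) +
          k p.1 * k p.2 * |h (p.1 + p.2 - e) - k (p.1 + p.2 - e)| * kernelW e p.1 p.2)) := by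
  have hW := kernelW_nonneg e p.1 p.2
  have a1 := hh.nonneg p.2
  have a2 := hk.nonneg p.1
  have a3 := hk.nonneg p.2
  have a4 := hh.nonneg e
  have a5 := hh.nonneg (p.1 + p.2 - e)
  have b1 := le_abs_self (h p.1 - k p.1)
  have b2 := le_abs_self (h p.2 - k p.2)
  have b3 := le_abs_self (h e - k e)
  have b4 := le_abs_self (h (p.1 + p.2 - e) - k (p.1 + p.2 - e))
  have hs : 0 ≤ 1 + h e + h (p.1 + p.2 - e) := by linarith
  have key : h p.1 * h p.2 * (1 + h e + h (p.1 + p.2 - e)) -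
      k p.1 * k p.2 * (1 + k e + k (p.1 + p.2 - e)) ≤
      (|h p.1 - k p.1| * h p.2 + k p.1 * |h p.2 - k p.2|) * (1 + h e + h (p.1 + p.2 - e)) +
      k p.1 * k p.2 * (|h e - k e| + |h (p.1 + p.2 - e) - k (p.1 + p.2 - e)|) := by
    have c1 : (h p.1 - k p.1) * h p.2 + k p.1 * (h p.2 - k p.2) ≤
        |h p.1 - k p.1| * h p.2 + k p.1 * |h p.2 - k p.2| := by gcongr
    have c2 := mul_le_mul_of_nonneg_right c1 hs
    have c3 : k p.1 * k p.2 * ((h e - k e) + (h (p.1 + p.2 - e) - k (p.1 + p.2 - e))) ≤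
        k p.1 * k p.2 * (|h e - k e| + |h (p.1 + p.2 - e) - k (p.1 + p.2 - e)|) := by gcongr
    linarith
  have := mul_le_mul_of_nonneg_right key hW
  unfold gainIntegrand
  linarith

theorem lossIntegrand_le_add (hh : IsDensity γ N h) (hk : IsDensity γ N k) (hγ : 3 < γ)
    (e : ℝ) (p : ℝ × ℝ) :
    lossIntegrand h e p ≤ lossIntegrand k e p +
      ((1 + 2 * N) * (|h (p.1 + p.2 - e) - k (p.1 + p.2 - e)| * kernelW e p.1 p.2) +
        (|h p.1 - k p.1| * k (p.1 + p.2 - e) + |h p.2 - k p.2| * k (p.1 + p.2 - e))) := by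
  have hW := kernelW_nonneg e p.1 p.2
  have hW1 := kernelW_le_one e p.1 p.2
  have a1 := hh.nonneg p.1
  have a2 := hh.nonneg p.2
  have a3 := hk.nonneg (p.1 + p.2 - e)
  have u1 := hh.le_bound (by linarith) p.1
  have u2 := hh.le_bound (by linarith) p.2
  have b1 := le_abs_self (h p.1 - k p.1)
  have b2 := le_abs_self (h p.2 - k p.2)
  have b4 := le_abs_self (h (p.1 + p.2 - e) - k (p.1 + p.2 - e))
  have c0 := abs_nonneg (h (p.1 + p.2 - e) - k (p.1 + p.2 - e))
  have c1 : (h (p.1 + p.2 - e) - k (p.1 + p.2 - e)) * (1 + h p.1 + h p.2) ≤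
      |h (p.1 + p.2 - e) - k (p.1 + p.2 - e)| * (1 + 2 * N) := by
    calc _ ≤ |h (p.1 + p.2 - e) - k (p.1 + p.2 - e)| * (1 + h p.1 + h p.2) := by gcongr
      _ ≤ _ := mul_le_mul_of_nonneg_left (by linarith) c0
  have c2 : k (p.1 + p.2 - e) * ((h p.1 - k p.1) + (h p.2 - k p.2)) * kernelW e p.1 p.2 ≤
      k (p.1 + p.2 - e) * (|h p.1 - k p.1| + |h p.2 - k p.2|) := by
    calc _ ≤ k (p.1 + p.2 - e) * (|h p.1 - k p.1| + |h p.2 - k p.2|) * kernelW e p.1 p.2 := by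
          gcongr
      _ ≤ _ := mul_le_of_le_one_right (by positivity) hW1
  have := mul_le_mul_of_nonneg_right c1 hW
  unfold lossIntegrand
  linarith

theorem gain_le_add (hh : IsDensity γ N h) (hk : IsDensity γ N k)
    (hd : IsDensity β D fun x => |h x - k x|) (hβ : 3 < β) (hβγ : β ≤ γ) (he : 0 < e) :
    gain h e ≤ gain k e + D * decay β e * (collisionConst * (√e *
      ((massMoment h + massMoment k) / (β - 1)) +
      (4 * pairConst β + 4 * pairConst γ + 4 + 6 * 2 ^ β) * ((N * decayMoment β) +
        (N * decayMoment β) ^ 2))) +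
      2 * collisionConst * N * D * decayMoment β * (√e * decay γ e) := by
  have hγ : 3 < γ := by linarith
  have hκ := collisionConst_pos
  have hN := hh.bound_nonneg
  have hD := hd.bound_nonneg
  have hhβ := hh.mono_exponent hβγ
  have hkβ := hk.mono_exponent hβγ
  set J := decayMoment β with hJdef
  have hJ : 0 ≤ J := decayMoment_nonneg β
  set d : ℝ → ℝ := fun x => |h x - k x| with hd_def
  have Gh := hhβ.fullMoment_le hβ
  have Gk := hkβ.fullMoment_le hβ
  have Gd := hd.fullMoment_le hβ
  have Gh0 := hh.fullMoment_nonneg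
  have Gk0 := hk.fullMoment_nonneg
  have Gd0 := hd.fullMoment_nonneg
  have md := (hd.massMoment_le hβ).trans Gd
  have md0 := hd.massMoment_nonneg
  have hdβ := decay_nonneg β e
  have hdγ := decay_nonneg γ e
  have hdγβ := decay_le_decay hβγ e
  have Pβ := pairConst_pos β
  have Pγ := pairConst_pos γ
  set G := N * J with hGdef
  have hG : 0 ≤ G := mul_nonneg hN hJ
  have hpow : (0 : ℝ) < 2 ^ β := by positivity
  have hi := hhβ.integrable hβ
  have ki := hkβ.integrable hβ
  have di := hd.integrable hβ
  -- the error splits into bilinear and trilinear collision integrals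
  have I1 := (integrable_mul_kernelW (integrable_left_right di hi) e).add
    (integrable_mul_kernelW (integrable_left_right ki di) e)
  have I2 := (integrable_triple hd hhβ hhβ hβ e).add (integrable_triple hkβ hd hhβ hβ e)
  have I3 := ((integrable_mul_kernelW (integrable_left_right ki ki) e).const_mul (d e)).add
    (integrable_triple hkβ hkβ hd hβ e)
  have hsplit : ∫ p, gainIntegrand h e p ≤ (∫ p, gainIntegrand k e p) +
      ((1 + h e) * (pairIntegral d h e + pairIntegral k d e) +
        (tripleIntegral d h h e + tripleIntegral k d h e) +
        (d e * pairIntegral k k e + tripleIntegral k k d e)) := by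
    have hmono := integral_mono (integrable_gainIntegrand hh hγ e)
      ((integrable_gainIntegrand hk hγ e).add (((I1.const_mul (1 + h e)).add I2).add I3))
      (gainIntegrand_le_add hh hk e)
    refine hmono.trans_eq ?_
    rw [integral_add' (integrable_gainIntegrand hk hγ e) (((I1.const_mul (1 + h e)).add I2).add I3),
      integral_add' ((I1.const_mul (1 + h e)).add I2) I3, integral_add' (I1.const_mul (1 + h e)) I2,
      integral_const_mul,
      integral_add' (integrable_mul_kernelW (integrable_left_right di hi) e)
        (integrable_mul_kernelW (integrable_left_right ki di) e),
      integral_add' (integrable_triple hd hhβ hhβ hβ e) (integrable_triple hkβ hd hhβ hβ e),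
      integral_add' ((integrable_mul_kernelW (integrable_left_right ki ki) e).const_mul (d e))
        (integrable_triple hkβ hkβ hd hβ e), integral_const_mul]
    rfl
  set X := D * decay β e with hX
  have hX0 : 0 ≤ X := mul_nonneg hD hdβ
  set m := massMoment h + massMoment k with hm
  have hb1 : 1 ≤ β - 1 := by linarith
  have hc1 : 1 ≤ γ - 1 := by linarith
  set R := N * D * J * (√e * decay γ e) with hR
  have hside : ∀ (mm gg P : ℝ), 0 ≤ mm → mm ≤ D * J → gg ≤ D * J → 0 ≤ P →
      N * decay γ e * (√e * mm / (γ - 1) + P * gg) ≤ R + X * (P * G) := by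
    intro mm gg P h0 h1 h2 h3
    have : √e * mm / (γ - 1) ≤ √e * (D * J) / 1 := by gcongr
    calc _ ≤ N * decay γ e * (√e * (D * J) / 1 + P * (D * J)) := by gcongr
      _ = R + N * decay γ e * (P * (D * J)) := by rw [hR]; ring
      _ ≤ R + N * decay β e * (P * (D * J)) := by gcongr
      _ = _ := by rw [hX, hGdef]; ring
  have e1 : pairIntegral d h e ≤ X * (√e * massMoment h / (β - 1) + pairConst β * G) +
      (R + X * (pairConst γ * G)) := by
    refine (pairIntegral_le hd hh hβ hγ he).trans (add_le_add ?_
      (hside _ _ _ md0 md Gd Pγ.le))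
    gcongr
  have e2 : pairIntegral k d e ≤ X * (√e * massMoment k / (β - 1) + pairConst β * G) +
      (R + X * (pairConst γ * G)) := by
    refine (pairIntegral_le hk hd hγ hβ he).trans ?_
    rw [add_comm]
    refine add_le_add ?_ (hside _ _ _ md0 md Gd Pγ.le)
    gcongr
  have hprod : ∀ a b : ℝ, 0 ≤ a → a ≤ D * J → 0 ≤ b → b ≤ G → h e * (a * b) ≤ X * G ^ 2 := by
    intro a b ha0 ha hb0 hb
    calc h e * (a * b) ≤ (N * decay β e) * ((D * J) * G) := by
          have := hhβ.le e; gcongr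
      _ = _ := by rw [hX, hGdef]; ring
  have e3 : h e * pairIntegral d h e ≤ X * G ^ 2 :=
    (mul_le_mul_of_nonneg_left (pairIntegral_le_mul hd hh hβ hγ e) (hh.nonneg e)).trans
      (hprod _ _ Gd0 Gd Gh0 Gh)
  have e4 : h e * pairIntegral k d e ≤ X * G ^ 2 := by
    refine (mul_le_mul_of_nonneg_left (pairIntegral_le_mul hk hd hγ hβ e) (hh.nonneg e)).trans ?_
    rw [mul_comm (fullMoment k)]
    exact hprod _ _ Gd0 Gd Gk0 Gk
  have htri : ∀ a b c a' : ℝ, 0 ≤ a → a ≤ G → 0 ≤ b → b ≤ G → 0 ≤ c → c ≤ D * J → 0 ≤ a' →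
      a' ≤ G → 2 ^ β * decay β e * (D * (a * b) + N * (c * a')) ≤ 2 ^ β * (2 * (X * G ^ 2)) := by
    intro a b c a' _ h1 _ h2 _ h3 _ h4
    calc _ ≤ 2 ^ β * decay β e * (D * (G * G) + N * ((D * J) * G)) := by gcongr
      _ = _ := by rw [hX, hGdef]; ring
  have e5 : tripleIntegral d h h e ≤ 2 ^ β * (2 * (X * G ^ 2)) :=
    (tripleIntegral_le hd hhβ hhβ hβ he).trans (htri _ _ _ _ Gh0 Gh Gh0 Gh Gd0 Gd Gh0 Gh)
  have e6 : tripleIntegral k d h e ≤ 2 ^ β * (2 * (X * G ^ 2)) := by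
    refine (tripleIntegral_le hkβ hd hhβ hβ he).trans ?_
    rw [add_comm]
    exact htri _ _ _ _ Gk0 Gk Gh0 Gh Gd0 Gd Gh0 Gh
  have e7 : d e * pairIntegral k k e ≤ X * G ^ 2 := by
    refine (mul_le_mul_of_nonneg_left (pairIntegral_le_mul hk hk hγ hγ e) (hd.nonneg e)).trans ?_
    calc _ ≤ X * (G * G) := by have := hd.le e; gcongr
      _ = _ := by ring
  have e8 : tripleIntegral k k d e ≤ 2 ^ β * (2 * (X * G ^ 2)) := by
    refine (tripleIntegral_le hkβ hkβ hd hβ he).trans ?_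
    calc _ ≤ 2 ^ β * decay β e * (N * (G * (D * J)) + N * (G * (D * J))) := by gcongr
      _ = _ := by rw [hX, hGdef]; ring
  rw [gain_eq hh hγ, gain_eq hk hγ]
  have hXG : 0 ≤ X * G := mul_nonneg hX0 hG
  have hXG2 : 0 ≤ X * G ^ 2 := by positivity
  have hfin : (1 + h e) * (pairIntegral d h e + pairIntegral k d e) +
        (tripleIntegral d h h e + tripleIntegral k d h e) +
        (d e * pairIntegral k k e + tripleIntegral k k d e) ≤
      X * (√e * (m / (β - 1)) +
        (4 * pairConst β + 4 * pairConst γ + 4 + 6 * 2 ^ β) * (G + G ^ 2)) + 2 * R := by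
    have f1 := mul_nonneg Pβ.le hXG
    have f2 := mul_nonneg Pγ.le hXG
    have f3 := mul_nonneg Pβ.le hXG2
    have f4 := mul_nonneg Pγ.le hXG2
    have f5 := mul_nonneg hpow.le hXG
    have f6 : X * (√e * (m / (β - 1))) = X * (√e * massMoment h / (β - 1)) +
      X * (√e * massMoment k / (β - 1)) := by rw [hm]; ring
    nlinarith
  have := mul_le_mul_of_nonneg_left (hsplit.trans (add_le_add_right hfin _)) hκ.le
  refine this.trans_eq ?_
  rw [hR]; ring

theorem lossRate_le_add (hh : IsDensity γ N h) (hk : IsDensity γ N k)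
    (hd : IsDensity β D fun x => |h x - k x|) (hβ : 3 < β) (hβγ : β ≤ γ) (he : 0 < e) :
    lossRate h e ≤ lossRate k e + D * (collisionConst * decayMoment β *
      (1 + 2 * N + 2 * (N * decayMoment β))) * (1 + √e) := by
  have hγ : 3 < γ := by linarith
  have hκ := collisionConst_pos
  have hN := hh.bound_nonneg
  have hD := hd.bound_nonneg
  have hkβ := hk.mono_exponent hβγ
  have ki := hkβ.integrable hβ
  have di := hd.integrable hβ
  have Gk := (hkβ.integral_le hβ).trans (hkβ.fullMoment_le hβ)
  have Gd := (hd.integral_le hβ).trans (hd.fullMoment_le hβ)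
  have Gm := (hd.massMoment_le hβ).trans (hd.fullMoment_le hβ)
  have Gx := (hd.integral_mul_id_le hβ).trans (hd.fullMoment_le hβ)
  have Gk0 := hk.integral_nonneg
  have Gd0 := hd.integral_nonneg
  have hJ : 0 ≤ decayMoment β := decayMoment_nonneg β
  have hs := Real.sqrt_nonneg e
  have I1 := (integrable_second_kernel hd hβ e).const_mul (1 + 2 * N)
  have I2 := (integrable_left_second di ki e).add (integrable_right_second di ki e)
  have h1 := integral_mono (integrable_lossIntegrand hh hγ e)
    ((integrable_lossIntegrand hk hγ e).add (I1.add I2)) (lossIntegrand_le_add hh hk hγ e)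
  rw [integral_add' (integrable_lossIntegrand hk hγ e) (I1.add I2), integral_add' I1 I2,
    integral_const_mul, integral_add' (integrable_left_second di ki e)
    (integrable_right_second di ki e)] at h1
  have L1 := integral_left_second (fun x => |h x - k x|) k e
  have L2 := integral_right_second (fun x => |h x - k x|) k e
  rw [L1, L2] at h1
  have h2 : (∫ p : ℝ × ℝ, |h (p.1 + p.2 - e) - k (p.1 + p.2 - e)| * kernelW e p.1 p.2) ≤
      (1 + √e) * (D * decayMoment β) := by
    refine (integral_second_kernel_le hd hβ he).trans ?_
    have := mul_le_mul_of_nonneg_left Gm hs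
    linarith
  have h3 : (∫ x, |h x - k x|) * ∫ x, k x ≤
      (1 + √e) * (D * decayMoment β) * (N * decayMoment β) := by
    have h4 : 1 * (D * decayMoment β) ≤ (1 + √e) * (D * decayMoment β) :=
      mul_le_mul_of_nonneg_right (by linarith) (by positivity)
    exact mul_le_mul (Gd.trans (by linarith)) Gk Gk0 (by positivity)
  have h5 := mul_le_mul_of_nonneg_left h2 (show 0 ≤ 1 + 2 * N by linarith)
  rw [lossRate_eq hh hγ, lossRate_eq hk hγ]
  have h6 : ∫ p, lossIntegrand h e p ≤ (∫ p, lossIntegrand k e p) +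
      ((1 + 2 * N) * ((1 + √e) * (D * decayMoment β)) +
        2 * ((1 + √e) * (D * decayMoment β) * (N * decayMoment β))) := by linarith
  refine (mul_le_mul_of_nonneg_left h6 hκ.le).trans_eq ?_
  ring

/-- A strictly better decay beats the growth `√e` up to an arbitrarily small multiple of it. -/
theorem exists_sqrt_mul_decay_le (hβγ : β < γ) {η : ℝ} (hη : 0 < η) :
    ∃ C : ℝ, 0 ≤ C ∧ ∀ e : ℝ, 0 < e → √e * decay γ e ≤ (η * √e + C) * decay β e := by
  have ht : Tendsto (fun x : ℝ => (1 + x) ^ (-(γ - β))) atTop (𝓝 0) :=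
    (tendsto_rpow_neg_atTop (by linarith)).comp (tendsto_atTop_add_const_left _ _ tendsto_id)
  obtain ⟨R, hR⟩ := (ht.eventually (gt_mem_nhds hη)).exists_forall_of_atTop
  refine ⟨√(max R 0), Real.sqrt_nonneg _, fun e he => ?_⟩
  have hsplit : decay γ e = (1 + e) ^ (-(γ - β)) * decay β e := by
    rw [decay_of_pos he, decay_of_pos he, ← Real.rpow_add (by linarith)]; congr 1; ring
  rw [hsplit, ← mul_assoc]
  refine mul_le_mul_of_nonneg_right ?_ (decay_nonneg _ _)
  have hs := Real.sqrt_nonneg e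
  rcases le_total R e with h | h
  · have := mul_le_mul_of_nonneg_left (hR e h).le hs
    nlinarith [Real.sqrt_nonneg (max R 0)]
  · have h1 : (1 + e) ^ (-(γ - β)) ≤ 1 :=
      Real.rpow_le_one_of_one_le_of_nonpos (by linarith) (by linarith)
    have h2 : √e ≤ √(max R 0) := Real.sqrt_le_sqrt (h.trans (le_max_left _ _))
    nlinarith

/-- The damping ratio of the difference of two solutions, strictly between `gainRatio` and one. -/
noncomputable def contractRatio (β : ℝ) : ℝ := (1 + gainRatio β) / 2

theorem contractRatio_lt_one {β : ℝ} (hβ : 3 < β) : contractRatio β < 1 := by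
  have := gainRatio_lt_one hβ
  unfold contractRatio; linarith

theorem contractRatio_pos {β : ℝ} (hβ : 3 < β) : 0 < contractRatio β := by
  have := gainRatio_pos hβ
  unfold contractRatio; linarith

set_option maxHeartbeats 1000000 in
/-- The rates of two densities that decay like `(1 + e)^(-γ)` differ, in a weaker weight, by a
fraction of the averaged loss frequency and a constant. The lower bound on the masses makes the
averaged loss frequency large enough to absorb the loss of weight. -/
theorem exists_rate_difference {μ : ℝ} (hβ : 3 < β) (hβγ : β < γ) (hN : 0 ≤ N) (hμ : 0 < μ) :
    ∃ C : ℝ, 0 ≤ C ∧ ∀ (h k : ℝ → ℝ) (D e : ℝ), IsDensity γ N h → IsDensity γ N k →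
      IsDensity β D (fun x => |h x - k x|) → μ ≤ massMoment h → μ ≤ massMoment k → 0 < e →
      |gain h e - gain k e| + |lossRate h e - lossRate k e| * (N * decay γ e) ≤
        D * decay β e * (contractRatio β * ((lossRate h e + lossRate k e) / 2) + C) := by
  have hκ := collisionConst_pos
  have hJ := decayMoment_nonneg β
  set J := decayMoment β with hJdef
  set K1 := collisionConst * ((4 * pairConst β + 4 * pairConst γ + 4 + 6 * 2 ^ β) *
    ((N * J) + (N * J) ^ 2)) with hK1
  set L1 := collisionConst * J * (1 + 2 * N + 2 * (N * J)) with hL1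
  set K2 := 2 * collisionConst * N * J + L1 * N with hK2
  have hL0 : 0 ≤ L1 := by positivity
  have hK20 : 0 ≤ K2 := by positivity
  have hK10 : 0 ≤ K1 := by
    have := pairConst_pos β; have := pairConst_pos γ; positivity
  have hq : 0 < (1 - gainRatio β) / 2 := by linarith [gainRatio_lt_one hβ]
  have hη : 0 < collisionConst * ((1 - gainRatio β) / 2) * μ / (K2 + 1) := by positivity
  obtain ⟨C0, hC0, hC⟩ := exists_sqrt_mul_decay_le hβγ hη
  refine ⟨K1 + L1 * N + K2 * C0 + collisionConst * (N * J), by positivity,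
    fun h k D e hh hk hd hmh hmk he => ?_⟩
  have hγ : 3 < γ := by linarith
  have hD := hd.bound_nonneg
  have hd' : IsDensity β D fun x => |k x - h x| := by
    have : (fun x => |k x - h x|) = fun x => |h x - k x| := by ext x; exact abs_sub_comm _ _
    rw [this]; exact hd
  have hs := Real.sqrt_nonneg e
  have hdβ := decay_nonneg β e
  have hdγ := decay_nonneg γ e
  set m := massMoment h + massMoment k with hm
  have g1 := gain_le_add hh hk hd hβ hβγ.le he
  have g2 := gain_le_add hk hh hd' hβ hβγ.le he
  rw [add_comm (massMoment k)] at g2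
  have l1 := lossRate_le_add hh hk hd hβ hβγ.le he
  have l2 := lossRate_le_add hk hh hd' hβ hβγ.le he
  rw [← hJdef, ← hm] at g1 g2
  rw [← hJdef, ← hL1] at l1 l2
  have hg : |gain h e - gain k e| ≤ D * decay β e * (collisionConst * (√e * (m / (β - 1)))
      + K1) + D * (2 * collisionConst * N * J) * (√e * decay γ e) := by
    rw [abs_le]
    constructor
    · rw [hK1]; linarith
    · rw [hK1]; linarith
  have hl : |lossRate h e - lossRate k e| ≤ D * L1 * (1 + √e) := by
    rw [abs_le]; constructor <;> linarith
  have hl2 : |lossRate h e - lossRate k e| * (N * decay γ e) ≤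
      D * decay β e * (L1 * N) + D * (L1 * N) * (√e * decay γ e) := by
    have h1 := mul_le_mul_of_nonneg_right hl (mul_nonneg hN hdγ)
    have h2 := mul_le_mul_of_nonneg_left (decay_le_decay hβγ.le e)
      (mul_nonneg hD (mul_nonneg hL0 hN))
    nlinarith
  have hlow1 := lossRate_ge hh hγ he
  have hlow2 := lossRate_ge hk hγ he
  have hG1 := (hh.mono_exponent hβγ.le).fullMoment_le hβ
  have hG2 := (hk.mono_exponent hβγ.le).fullMoment_le hβ
  rw [← hJdef] at hG1 hG2
  have hlow : collisionConst * (√e * (m / 2)) - collisionConst * (N * J) ≤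
      (lossRate h e + lossRate k e) / 2 := by
    have := mul_le_mul_of_nonneg_left hG1 hκ.le
    have := mul_le_mul_of_nonneg_left hG2 hκ.le
    rw [hm]; linarith
  have hsm := hC e he
  have hsm2 : D * K2 * (√e * decay γ e) ≤ D * decay β e *
      (collisionConst * ((1 - gainRatio β) / 2) * (√e * (m / 2)) + K2 * C0) := by
    have h1 := mul_le_mul_of_nonneg_left hsm (mul_nonneg hD hK20)
    have h2 : K2 * (collisionConst * ((1 - gainRatio β) / 2) * μ / (K2 + 1)) ≤
        collisionConst * ((1 - gainRatio β) / 2) * (m / 2) := by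
      rw [← mul_div_assoc, div_le_iff₀ (by linarith)]
      have h3 : collisionConst * ((1 - gainRatio β) / 2) * μ ≤
        collisionConst * ((1 - gainRatio β) / 2) * (m / 2) :=
        mul_le_mul_of_nonneg_left (by rw [hm]; linarith) (by positivity)
      have h4 : 0 ≤ collisionConst * ((1 - gainRatio β) / 2) * μ := by positivity
      nlinarith
    have h5 := mul_le_mul_of_nonneg_left h2 (mul_nonneg (mul_nonneg hD hdβ) hs)
    linarith
  have hrat : contractRatio β * (m / 2) =
      m / (β - 1) / 2 + m / 4 := by
    unfold contractRatio gainRatio; ring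
  have hq0 := contractRatio_pos hβ
  have hq1 := contractRatio_lt_one hβ
  have h6 := mul_le_mul_of_nonneg_left hlow hq0.le
  have h7 : contractRatio β * (collisionConst * (N * J)) ≤ collisionConst * (N * J) :=
    mul_le_of_le_one_left (by positivity) hq1.le
  have h8 := mul_le_mul_of_nonneg_left (h6.trans' (by linarith : contractRatio β *
    (collisionConst * (√e * (m / 2))) - collisionConst * (N * J) ≤ _)) (mul_nonneg hD hdβ)
  have h9 : contractRatio β * (collisionConst * (√e * (m / 2))) =
      collisionConst * (√e * (m / (β - 1))) +
      collisionConst * ((1 - gainRatio β) / 2) * (√e * (m / 2)) := by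
    unfold contractRatio gainRatio; ring
  -- `contractRatio` exceeds `gainRatio` by just enough for the term `√e` times `decay γ e`
  rw [h9] at h8
  rw [hK2] at hsm2
  linarith

end Difference

/-! ### Scalar comparison lemmas -/

/-- Duhamel's formula solves the scalar linear equation `v' = g - a v`. -/
theorem hasDerivAt_duhamel {a g : ℝ → ℝ} (ha : Continuous a) (hg : Continuous g) (c t : ℝ) :
    HasDerivAt (fun t => c * Real.exp (-∫ s in (0 : ℝ)..t, a s) +
      ∫ s in (0 : ℝ)..t, Real.exp (-∫ r in (0 : ℝ)..t, a r) /
        Real.exp (-∫ r in (0 : ℝ)..s, a r) * g s)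
      (g t - a t * (c * Real.exp (-∫ s in (0 : ℝ)..t, a s) +
      ∫ s in (0 : ℝ)..t, Real.exp (-∫ r in (0 : ℝ)..t, a r) /
        Real.exp (-∫ r in (0 : ℝ)..s, a r) * g s)) t := by
  set A : ℝ → ℝ := fun t => ∫ s in (0 : ℝ)..t, a s with hA
  have hAd : ∀ t, HasDerivAt A (a t) t := fun t => (ha.integral_hasStrictDerivAt 0 t).hasDerivAt
  have hAc : Continuous A := continuous_iff_continuousAt.2 fun t => (hAd t).continuousAt
  have hEc : Continuous fun s => (Real.exp (-A s))⁻¹ * g s :=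
    ((Real.continuous_exp.comp hAc.neg).inv₀ fun s => (Real.exp_pos _).ne').mul hg
  have hform : (fun t => c * Real.exp (-A t) +
      ∫ s in (0 : ℝ)..t, Real.exp (-A t) / Real.exp (-A s) * g s) =
      fun t => Real.exp (-A t) * (c + ∫ s in (0 : ℝ)..t, (Real.exp (-A s))⁻¹ * g s) := by
    ext t
    rw [mul_add, ← intervalIntegral.integral_const_mul, mul_comm c]
    congr 2; ext s; ring
  have h1 : HasDerivAt (fun t => Real.exp (-A t)) (Real.exp (-A t) * -a t) t :=
    (hAd t).neg.exp
  have h2 : HasDerivAt (fun t => c + ∫ s in (0 : ℝ)..t, (Real.exp (-A s))⁻¹ * g s)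
      ((Real.exp (-A t))⁻¹ * g t) t :=
    ((hEc.integral_hasStrictDerivAt 0 t).hasDerivAt).const_add c
  have h3 := h1.mul h2
  have hpt := congrFun hform t
  change HasDerivAt (fun t => c * Real.exp (-A t) +
      ∫ s in (0 : ℝ)..t, Real.exp (-A t) / Real.exp (-A s) * g s)
      (g t - a t * (c * Real.exp (-A t) +
      ∫ s in (0 : ℝ)..t, Real.exp (-A t) / Real.exp (-A s) * g s)) t
  rw [hform, hpt]
  refine h3.congr_deriv ?_
  have := (Real.exp_pos (-A t)).ne'
  field_simp
  ring

theorem HasDerivWithinAt.Ici_of_Icc {v : ℝ → ℝ} {v' T t : ℝ} (ht : t ∈ Ico 0 T)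
    (hv : HasDerivWithinAt v v' (Icc 0 T) t) : HasDerivWithinAt v v' (Ici t) t :=
  hv.mono_of_mem_nhdsWithin (mem_of_superset (Icc_mem_nhdsGE ht.2) (Icc_subset_Icc_left ht.1))

/-- A solution of `v' = g - a v` on `[0, T]` is given by Duhamel's formula. -/
theorem eq_duhamel {a g v : ℝ → ℝ} {T : ℝ} (ha : Continuous a) (hg : Continuous g)
    (hv : ∀ t ∈ Icc 0 T, HasDerivWithinAt v (g t - a t * v t) (Icc 0 T) t) {t : ℝ}
    (ht : t ∈ Icc 0 T) :
    v t = v 0 * Real.exp (-∫ s in (0 : ℝ)..t, a s) +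
      ∫ s in (0 : ℝ)..t, Real.exp (-∫ r in (0 : ℝ)..t, a r) /
        Real.exp (-∫ r in (0 : ℝ)..s, a r) * g s := by
  set y : ℝ → ℝ := fun t => v 0 * Real.exp (-∫ s in (0 : ℝ)..t, a s) +
      ∫ s in (0 : ℝ)..t, Real.exp (-∫ r in (0 : ℝ)..t, a r) /
        Real.exp (-∫ r in (0 : ℝ)..s, a r) * g s with hy
  have hyd : ∀ t, HasDerivAt y (g t - a t * y t) t := hasDerivAt_duhamel ha hg (v 0)
  have hAd : ∀ t, HasDerivAt (fun t => ∫ s in (0 : ℝ)..t, a s) (a t) t := fun t =>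
    (ha.integral_hasStrictDerivAt 0 t).hasDerivAt
  have hz : ∀ s ∈ Icc 0 T, HasDerivWithinAt
      (fun t => (v t - y t) * Real.exp (∫ s in (0 : ℝ)..t, a s)) 0 (Icc 0 T) s := fun s hs => by
    refine (((hv s hs).sub (hyd s).hasDerivWithinAt).mul
      (hAd s).exp.hasDerivWithinAt).congr_deriv ?_
    simp only [Pi.sub_apply]; ring
  have hconst := constant_of_has_deriv_right_zero (fun s hs => (hz s hs).continuousWithinAt)
    (fun s hs => HasDerivWithinAt.Ici_of_Icc hs (hz s ⟨hs.1, hs.2.le⟩)) t ht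
  have hexp := (Real.exp_pos (∫ s in (0 : ℝ)..t, a s)).ne'
  have hy0 : y 0 = v 0 := by simp [hy]
  simp only [hy0, sub_self, zero_mul] at hconst
  have := (mul_eq_zero.1 hconst).resolve_right hexp
  linarith

/-- Comparison with the exponential barrier `e^{λ t} (c + W (q + (C + 1) / λ))`. A source
proportional to the damping `α` costs only its factor `q`, however large `α` is; the bounded part
`C` of the source is made small by a large `λ`. -/
theorem le_exp_barrier {v r α : ℝ → ℝ} {T c W q C lam : ℝ} (hlam : 0 < lam) (hW : 0 < W)
    (hq : 0 ≤ q) (hc : 0 ≤ c) (hC : 0 ≤ C) (hα : ∀ t ∈ Icc 0 T, 0 ≤ α t)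
    (hv : ∀ t ∈ Icc 0 T, HasDerivWithinAt v (r t - α t * v t) (Icc 0 T) t) (h0 : v 0 ≤ c)
    (hr : ∀ t ∈ Icc 0 T, r t ≤ W * Real.exp (lam * t) * (q * α t + C)) {t : ℝ}
    (ht : t ∈ Icc 0 T) : v t ≤ Real.exp (lam * t) * (c + W * (q + (C + 1) / lam)) := by
  set K := c + W * (q + (C + 1) / lam) with hK
  have hBd : ∀ s, HasDerivAt (fun s => Real.exp (lam * s) * K)
      (Real.exp (lam * s) * lam * K) s := fun s => by
    have := (((hasDerivAt_id s).const_mul lam).exp).mul_const K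
    simpa using this
  refine image_le_of_deriv_right_lt_deriv_boundary' (a := 0) (b := T)
    (fun s hs => (hv s hs).continuousWithinAt)
    (fun s hs => HasDerivWithinAt.Ici_of_Icc hs (hv s ⟨hs.1, hs.2.le⟩)) ?_
    (fun s _ => (hBd s).continuousAt.continuousWithinAt)
    (fun s _ => (hBd s).hasDerivWithinAt) ?_ ht
  · have : 0 ≤ W * (q + (C + 1) / lam) := by positivity
    simp only [mul_zero, Real.exp_zero, one_mul]
    linarith
  · intro s hs hvs
    have hs' : s ∈ Icc 0 T := ⟨hs.1, hs.2.le⟩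
    have hE := Real.exp_pos (lam * s)
    have hr' := hr s hs'
    rw [hvs]
    have h1 : lam * K = lam * c + W * (lam * q) + W * (C + 1) := by
      rw [hK]; field_simp; ring
    have h2 : W * q ≤ K := by
      have : 0 ≤ W * ((C + 1) / lam) := by positivity
      rw [hK]; linarith
    have h3 := mul_le_mul_of_nonneg_left h2 (mul_nonneg (hα s hs') hE.le)
    have h4 : 0 ≤ lam * c + W * (lam * q) := by positivity
    have h5 : Real.exp (lam * s) * lam * K =
      Real.exp (lam * s) * (lam * c + W * (lam * q)) + Real.exp (lam * s) * W * (C + 1) := by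
      rw [mul_assoc, h1]; ring
    have h6 := mul_nonneg hE.le h4
    have h7 := mul_pos hE hW
    rw [h5]
    linarith

theorem abs_le_exp_barrier {v r α : ℝ → ℝ} {T c W q C lam : ℝ} (hlam : 0 < lam) (hW : 0 < W)
    (hq : 0 ≤ q) (hC : 0 ≤ C) (hα : ∀ t ∈ Icc 0 T, 0 ≤ α t)
    (hv : ∀ t ∈ Icc 0 T, HasDerivWithinAt v (r t - α t * v t) (Icc 0 T) t) (h0 : |v 0| ≤ c)
    (hr : ∀ t ∈ Icc 0 T, |r t| ≤ W * Real.exp (lam * t) * (q * α t + C)) {t : ℝ}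
    (ht : t ∈ Icc 0 T) : |v t| ≤ Real.exp (lam * t) * (c + W * (q + (C + 1) / lam)) := by
  have hc := (abs_nonneg _).trans h0
  refine abs_le'.2 ⟨le_exp_barrier hlam hW hq hc hC hα hv ((le_abs_self _).trans h0)
    (fun t ht => (le_abs_self _).trans (hr t ht)) ht, ?_⟩
  refine le_exp_barrier (v := fun t => -v t) (r := fun t => -r t) hlam hW hq hc hC hα
    (fun t ht => ?_) ((neg_le_abs _).trans h0) (fun t ht => (neg_le_abs _).trans (hr t ht)) ht
  exact (hv t ht).neg.congr_deriv (by ring)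

/-- Comparison with the linear barrier `W (c + (C + 1) t)`, where the damping absorbs the part of
the source that is proportional to it. -/
theorem le_linear_barrier {v r α : ℝ → ℝ} {T c W q C : ℝ} (hW : 0 < W)
    (hqc : q ≤ c) (hC : 0 ≤ C) (hα : ∀ t ∈ Icc 0 T, 0 ≤ α t)
    (hv : ∀ t ∈ Icc 0 T, HasDerivWithinAt v (r t - α t * v t) (Icc 0 T) t) (h0 : v 0 ≤ W * c)
    (hr : ∀ t ∈ Icc 0 T, r t ≤ W * (q * α t + C)) {t : ℝ}
    (ht : t ∈ Icc 0 T) : v t ≤ W * (c + (C + 1) * t) := by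
  have hBd : ∀ s, HasDerivAt (fun s => W * (c + (C + 1) * s)) (W * (C + 1)) s := fun s => by
    have := (((hasDerivAt_id s).const_mul (C + 1)).const_add c).const_mul W
    simpa using this
  refine image_le_of_deriv_right_lt_deriv_boundary' (a := 0) (b := T)
    (fun s hs => (hv s hs).continuousWithinAt)
    (fun s hs => HasDerivWithinAt.Ici_of_Icc hs (hv s ⟨hs.1, hs.2.le⟩)) ?_
    (fun s _ => (hBd s).continuousAt.continuousWithinAt)
    (fun s _ => (hBd s).hasDerivWithinAt) ?_ ht
  · simpa using h0
  · intro s hs hvs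
    have hs' : s ∈ Icc 0 T := ⟨hs.1, hs.2.le⟩
    have hr' := hr s hs'
    rw [hvs]
    have h1 : q ≤ c + (C + 1) * s := by
      have := mul_nonneg (show 0 ≤ C + 1 by linarith) hs.1
      linarith
    have h2 := mul_le_mul_of_nonneg_left h1 (mul_nonneg (hα s hs') hW.le)
    linarith

/-! ### Paths of densities and the Duhamel map -/

/-- A path of densities, defined for all times, with a common bound and continuous in time at every
energy. -/
structure IsPath (γ N : ℝ) (f : ℝ → ℝ → ℝ) : Prop where
  dens : ∀ t, IsDensity γ N (f t)
  cont : ∀ e, Continuous fun t => f t e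

/-- A path of densities with a common bound, jointly measurable in time and energy. -/
structure IsMeasurablePath (γ N : ℝ) (f : ℝ → ℝ → ℝ) : Prop where
  dens : ∀ t, IsDensity γ N (f t)
  meas : Measurable fun p : ℝ × ℝ => f p.1 p.2

theorem measurable_uncurry_of_continuous {u : ℝ → ℝ → ℝ} (hc : ∀ e, Continuous fun t => u t e)
    (hm : ∀ t, Measurable (u t)) : Measurable fun p : ℝ × ℝ => u p.1 p.2 :=
  measurable_uncurry_of_continuous_of_measurable (u := u) hc hm

theorem isDensity_decay (γ : ℝ) : IsDensity γ 1 (decay γ) :=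
  ⟨measurable_decay γ, decay_nonneg γ, fun x => by rw [one_mul]⟩

section Measurability

variable {γ N : ℝ} {h : ℝ → ℝ}

theorem measurable_gain (hh : IsDensity γ N h) (hγ : 3 < γ) : Measurable (gain h) := by
  have h1 : gain h = fun e => collisionConst * ∫ p, gainIntegrand h e p :=
    funext fun e => gain_eq hh hγ e
  rw [h1]
  exact ((measurable_gainIntegrand hh.meas).stronglyMeasurable.integral_prod_right
    (f := fun e p => gainIntegrand h e p)).measurable.const_mul _

theorem measurable_lossRate (hh : IsDensity γ N h) (hγ : 3 < γ) : Measurable (lossRate h) := by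
  have h1 : lossRate h = fun e => collisionConst * ∫ p, lossIntegrand h e p :=
    funext fun e => lossRate_eq hh hγ e
  rw [h1]
  exact ((measurable_lossIntegrand hh.meas).stronglyMeasurable.integral_prod_right
    (f := fun e p => lossIntegrand h e p)).measurable.const_mul _

end Measurability

theorem gain_of_nonpos (h : ℝ → ℝ) {e : ℝ} (he : e ≤ 0) : gain h e = 0 := by
  simp [gain, kernelW_eq_zero_of_first he]

theorem lossRate_of_nonpos (h : ℝ → ℝ) {e : ℝ} (he : e ≤ 0) : lossRate h e = 0 := by
  simp [lossRate, kernelW_eq_zero_of_first he]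

namespace IsPath

variable {γ N : ℝ} {f : ℝ → ℝ → ℝ}

theorem isMeasurablePath (hf : IsPath γ N f) : IsMeasurablePath γ N f :=
  ⟨hf.dens, measurable_uncurry_of_continuous hf.cont fun t => (hf.dens t).meas⟩

theorem continuous_gain (hf : IsPath γ N f) (hγ : 3 < γ) (e : ℝ) :
    Continuous fun t => gain (f t) e := by
  simp only [fun t => gain_eq (hf.dens t) hγ e]
  refine continuous_const.mul ?_
  have hd := (isDensity_decay γ).integrable hγ
  have hN := (hf.dens 0).bound_nonneg
  refine continuous_of_dominated (fun t => (integrable_gainIntegrand (hf.dens t) hγ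
    e).aestronglyMeasurable) (fun t => Eventually.of_forall fun p => ?_)
    ((integrable_left_right hd hd).const_mul ((1 + 2 * N) * (N * N)))
    (Eventually.of_forall fun p => ?_)
  · rw [Real.norm_eq_abs, abs_of_nonneg (gainIntegrand_nonneg (hf.dens t) e p)]
    refine (gainIntegrand_le (hf.dens t) (by linarith) e p).trans ?_
    rw [mul_assoc]
    refine mul_le_mul_of_nonneg_left ?_ (by linarith)
    calc f t p.1 * f t p.2 ≤ (N * decay γ p.1) * (N * decay γ p.2) :=
          mul_le_mul ((hf.dens t).le _) ((hf.dens t).le _) ((hf.dens t).nonneg _)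
            (mul_nonneg hN (decay_nonneg _ _))
      _ = _ := by ring
  · have h1 := hf.cont p.1
    have h2 := hf.cont p.2
    have h3 := hf.cont e
    have h4 := hf.cont (p.1 + p.2 - e)
    unfold gainIntegrand
    fun_prop

theorem continuous_lossRate (hf : IsPath γ N f) (hγ : 3 < γ) (e : ℝ) :
    Continuous fun t => lossRate (f t) e := by
  simp only [fun t => lossRate_eq (hf.dens t) hγ e]
  refine continuous_const.mul ?_
  have hN := (hf.dens 0).bound_nonneg
  refine continuous_of_dominated (fun t => (integrable_lossIntegrand (hf.dens t) hγ
    e).aestronglyMeasurable) (fun t => Eventually.of_forall fun p => ?_)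
    ((integrable_second_kernel (isDensity_decay γ) hγ e).const_mul ((1 + 2 * N) * N))
    (Eventually.of_forall fun p => ?_)
  · rw [Real.norm_eq_abs, abs_of_nonneg (lossIntegrand_nonneg (hf.dens t) e p)]
    refine (lossIntegrand_le (hf.dens t) (by linarith) e p).trans ?_
    rw [mul_assoc]
    refine mul_le_mul_of_nonneg_left ?_ (by linarith)
    rw [← mul_assoc]
    exact mul_le_mul_of_nonneg_right ((hf.dens t).le _) (kernelW_nonneg _ _ _)
  · have h1 := hf.cont p.1
    have h2 := hf.cont p.2
    have h4 := hf.cont (p.1 + p.2 - e)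
    unfold lossIntegrand
    fun_prop

end IsPath

/-- The right-hand side of the mild equation: Duhamel's formula along the path `f`. -/
noncomputable def mildMap (f₀ : ℝ → ℝ) (f : ℝ → ℝ → ℝ) (t e : ℝ) : ℝ :=
  f₀ e * Psi 0 f t e + ∫ s in (0 : ℝ)..t, Psi 0 f t e / Psi 0 f s e * gain (f s) e

theorem mildMap_zero (f₀ : ℝ → ℝ) (f : ℝ → ℝ → ℝ) (e : ℝ) : mildMap f₀ f 0 e = f₀ e := by
  simp [mildMap, Psi]

theorem Psi_pos (f : ℝ → ℝ → ℝ) (t e : ℝ) : 0 < Psi 0 f t e := Real.exp_pos _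

section MildMap

variable {γ N : ℝ} {f₀ : ℝ → ℝ} {f : ℝ → ℝ → ℝ}

theorem hasDerivAt_mildMap (hf : IsPath γ N f) (hγ : 3 < γ) (t e : ℝ) :
    HasDerivAt (fun t => mildMap f₀ f t e)
      (gain (f t) e - lossRate (f t) e * mildMap f₀ f t e) t :=
  hasDerivAt_duhamel (hf.continuous_lossRate hγ e) (hf.continuous_gain hγ e) (f₀ e) t

theorem measurable_intervalIntegral {G : ℝ → ℝ → ℝ} (hG : Measurable fun p : ℝ × ℝ => G p.1 p.2)
    (t : ℝ) : Measurable fun e => ∫ s in (0 : ℝ)..t, G s e := by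
  have h : ∀ μ : Measure ℝ, [SFinite μ] → Measurable fun e => ∫ s, G s e ∂μ := fun μ _ =>
    ((hG.comp measurable_swap).stronglyMeasurable.integral_prod_right
      (f := fun e s => G s e)).measurable
  exact (h _).sub (h _)

theorem measurable_lossRate_uncurry (hf : IsMeasurablePath γ N f) (hγ : 3 < γ) :
    Measurable fun p : ℝ × ℝ => lossRate (f p.1) p.2 := by
  have h1 : (fun p : ℝ × ℝ => lossRate (f p.1) p.2) = fun p =>
      collisionConst * ∫ q, lossIntegrand (f p.1) p.2 q :=
    funext fun p => lossRate_eq (hf.dens p.1) hγ p.2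
  have hm : ∀ {y : (ℝ × ℝ) × (ℝ × ℝ) → ℝ}, Measurable y → Measurable fun z => f z.1.1 (y z) :=
    fun hy => hf.meas.comp ((measurable_fst.comp measurable_fst).prodMk hy)
  have h2 : Measurable fun z : (ℝ × ℝ) × (ℝ × ℝ) => lossIntegrand (f z.1.1) z.1.2 z.2 := by
    have a1 := hm (y := fun z => z.2.1 + z.2.2 - z.1.2) (by fun_prop)
    have a2 := hm (y := fun z => z.2.1) (by fun_prop)
    have a3 := hm (y := fun z => z.2.2) (by fun_prop)
    have a4 : Measurable fun z : (ℝ × ℝ) × (ℝ × ℝ) => kernelW z.1.2 z.2.1 z.2.2 := by fun_prop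
    exact (a1.mul ((measurable_const.add a2).add a3)).mul a4
  rw [h1]
  exact (h2.stronglyMeasurable.integral_prod_right
    (f := fun (p : ℝ × ℝ) q => lossIntegrand (f p.1) p.2 q)).measurable.const_mul _

theorem measurable_gain_uncurry (hf : IsMeasurablePath γ N f) (hγ : 3 < γ) :
    Measurable fun p : ℝ × ℝ => gain (f p.1) p.2 := by
  have h1 : (fun p : ℝ × ℝ => gain (f p.1) p.2) = fun p =>
      collisionConst * ∫ q, gainIntegrand (f p.1) p.2 q :=
    funext fun p => gain_eq (hf.dens p.1) hγ p.2
  have hm : ∀ {y : (ℝ × ℝ) × (ℝ × ℝ) → ℝ}, Measurable y → Measurable fun z => f z.1.1 (y z) :=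
    fun hy => hf.meas.comp ((measurable_fst.comp measurable_fst).prodMk hy)
  have h2 : Measurable fun z : (ℝ × ℝ) × (ℝ × ℝ) => gainIntegrand (f z.1.1) z.1.2 z.2 := by
    have a0 := hm (y := fun z => z.1.2) (by fun_prop)
    have a1 := hm (y := fun z => z.2.1 + z.2.2 - z.1.2) (by fun_prop)
    have a2 := hm (y := fun z => z.2.1) (by fun_prop)
    have a3 := hm (y := fun z => z.2.2) (by fun_prop)
    have a4 : Measurable fun z : (ℝ × ℝ) × (ℝ × ℝ) => kernelW z.1.2 z.2.1 z.2.2 := by fun_prop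
    exact ((a2.mul a3).mul ((measurable_const.add a0).add a1)).mul a4
  rw [h1]
  exact (h2.stronglyMeasurable.integral_prod_right
    (f := fun (p : ℝ × ℝ) q => gainIntegrand (f p.1) p.2 q)).measurable.const_mul _

theorem intervalIntegrable_lossRate (hf : IsMeasurablePath γ N f) (hγ : 3 < γ) (e a b : ℝ) :
    IntervalIntegrable (fun t => lossRate (f t) e) volume a b := by
  rcases le_or_gt e 0 with he | he
  · simp [lossRate_of_nonpos _ he]
  refine (intervalIntegrable_const (c := collisionConst * (1 + 2 * N) * (N * decayMoment γ) *
    (1 + √e))).mono_fun' ((measurable_lossRate_uncurry hf hγ).comp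
    measurable_prodMk_right).aestronglyMeasurable (Eventually.of_forall fun t => ?_)
  have hκ := collisionConst_pos
  have hN := (hf.dens 0).bound_nonneg
  beta_reduce
  rw [Real.norm_of_nonneg (lossRate_nonneg (hf.dens t) hγ e)]
  refine (lossRate_le (hf.dens t) hγ he).trans ?_
  have := (hf.dens t).fullMoment_le hγ
  gcongr

theorem intervalIntegrable_gain (hf : IsMeasurablePath γ N f) (hγ : 3 < γ) (e a b : ℝ) :
    IntervalIntegrable (fun t => gain (f t) e) volume a b := by
  rcases le_or_gt e 0 with he | he
  · simp [gain_of_nonpos _ he]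
  have hN := (hf.dens 0).bound_nonneg
  have hg := gainConst_pos γ
  have h1 := (intervalIntegrable_lossRate hf hγ e a b).const_mul (gainRatio γ)
  refine ((h1.add (intervalIntegrable_const (c := gainConst γ * (N * decayMoment γ +
    (N * decayMoment γ) ^ 2)))).const_mul (N * decay γ e)).mono_fun'
    ((measurable_gain_uncurry hf hγ).comp measurable_prodMk_right).aestronglyMeasurable
    (Eventually.of_forall fun t => ?_)
  beta_reduce
  rw [Real.norm_of_nonneg (gain_nonneg (hf.dens t) hγ e)]
  refine (gain_le (hf.dens t) hγ he).trans ?_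
  have h2 := (hf.dens t).fullMoment_le hγ
  have h3 := (hf.dens t).fullMoment_nonneg
  have h4 := decay_nonneg γ e
  gcongr

theorem continuous_Psi (hf : IsMeasurablePath γ N f) (hγ : 3 < γ) (e : ℝ) :
    Continuous fun t => Psi 0 f t e :=
  Real.continuous_exp.comp (intervalIntegral.continuous_primitive
    (fun a b => intervalIntegrable_lossRate hf hγ e a b) 0).neg

theorem continuous_mildMap (hf : IsMeasurablePath γ N f) (hγ : 3 < γ) (e : ℝ) :
    Continuous fun t => mildMap f₀ f t e := by
  have hP := continuous_Psi hf hγ e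
  have h1 : (fun t => mildMap f₀ f t e) = fun t =>
      Psi 0 f t e * (f₀ e + ∫ s in (0 : ℝ)..t, (Psi 0 f s e)⁻¹ * gain (f s) e) := by
    funext t
    rw [mildMap, mul_add, ← intervalIntegral.integral_const_mul, mul_comm (f₀ e)]
    simp only [div_eq_mul_inv, mul_assoc]
  rw [h1]
  exact hP.mul (continuous_const.add (intervalIntegral.continuous_primitive (fun a b =>
    (intervalIntegrable_gain hf hγ e a b).continuousOn_mul
      (hP.inv₀ fun s => (Psi_pos f s e).ne').continuousOn) 0))

theorem measurable_mildMap (hf : IsMeasurablePath γ N f) (hγ : 3 < γ) (h0 : Measurable f₀)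
    (t : ℝ) : Measurable (mildMap f₀ f t) := by
  have hP : ∀ t, Measurable (Psi 0 f t) := fun t => Real.measurable_exp.comp
    (measurable_intervalIntegral (measurable_lossRate_uncurry hf hγ) t).neg
  have hP2 : Measurable fun p : ℝ × ℝ => Psi 0 f p.1 p.2 :=
    measurable_uncurry_of_continuous (fun e => continuous_Psi hf hγ e) hP
  exact (h0.mul (hP t)).add (measurable_intervalIntegral
    (G := fun s e => Psi 0 f t e / Psi 0 f s e * gain (f s) e)
    ((((hP t).comp measurable_snd).div hP2).mul (measurable_gain_uncurry hf hγ)) t)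

theorem le_mildMap (hf : IsPath γ N f) (hγ : 3 < γ) {t e : ℝ} (ht : 0 ≤ t) :
    f₀ e * Psi 0 f t e ≤ mildMap f₀ f t e := by
  refine le_add_of_nonneg_right (intervalIntegral.integral_nonneg ht fun s _ => ?_)
  exact mul_nonneg (div_nonneg (Psi_pos f t e).le (Psi_pos f s e).le)
    (gain_nonneg (hf.dens s) hγ e)

theorem mildMap_nonneg (hf : IsPath γ N f) (hγ : 3 < γ) (h0 : ∀ e, 0 ≤ f₀ e) {t e : ℝ}
    (ht : 0 ≤ t) : 0 ≤ mildMap f₀ f t e :=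
  (mul_nonneg (h0 e) (Psi_pos f t e).le).trans (le_mildMap hf hγ ht)

theorem mildMap_of_nonpos (h0 : ∀ e ≤ 0, f₀ e = 0) {t e : ℝ} (he : e ≤ 0) :
    mildMap f₀ f t e = 0 := by
  simp [mildMap, h0 e he, gain_of_nonpos _ he]

end MildMap

/-- Restriction of a time to `[0, T]`. -/
noncomputable def clampTime (T t : ℝ) : ℝ := max 0 (min t T)

theorem clampTime_mem {T : ℝ} (hT : 0 ≤ T) (t : ℝ) : clampTime T t ∈ Icc 0 T :=
  ⟨le_max_left _ _, max_le hT (min_le_right _ _)⟩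

theorem clampTime_of_mem {T t : ℝ} (ht : t ∈ Icc 0 T) : clampTime T t = t := by
  rw [clampTime, min_eq_left ht.2, max_eq_right ht.1]

theorem continuous_clampTime (T : ℝ) : Continuous (clampTime T) := by
  unfold clampTime; fun_prop

/-- Classical solutions on `[0, T]` up to a null set of energies: `f` is a path of densities that
vanishes on the null set `Z` and, off `Z`, starts at `f₀` and solves the equation pointwise on the
closed interval `[0, T]`. -/
structure IsSolution (γ N T : ℝ) (Z : Set ℝ) (f₀ : ℝ → ℝ) (f : ℝ → ℝ → ℝ) : Prop where
  path : IsPath γ N f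
  measZ : MeasurableSet Z
  nullZ : volume Z = 0
  zero : ∀ e ∈ Z, ∀ t, f t e = 0
  init : ∀ e ∉ Z, f 0 e = f₀ e
  deriv : ∀ e ∉ Z, ∀ t ∈ Icc 0 T, HasDerivWithinAt (fun t => f t e)
    (gain (f t) e - lossRate (f t) e * f t e) (Icc 0 T) t

/-- Two curves with densities `D e^{λ t}`-close have Duhamel images that are closer by a factor
`contractRatio β + (C + 1) / λ`. The equation of the difference is damped by the average of the two
loss frequencies. -/
theorem duhamel_contraction {β γ N μ C lam T D e : ℝ} {f u : ℝ → ℝ → ℝ} {y z : ℝ → ℝ}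
    (hβ : 3 < β) (hβγ : β < γ) (hlam : 0 < lam) (hD : 0 < D) (hC : 0 ≤ C)
    (hrate : ∀ (h k : ℝ → ℝ) (D e : ℝ), IsDensity γ N h → IsDensity γ N k →
      IsDensity β D (fun x => |h x - k x|) → μ ≤ massMoment h → μ ≤ massMoment k → 0 < e →
      |gain h e - gain k e| + |lossRate h e - lossRate k e| * (N * decay γ e) ≤
        D * decay β e * (contractRatio β * ((lossRate h e + lossRate k e) / 2) + C))
    (hf : IsPath γ N f) (hu : IsPath γ N u) (hmf : ∀ t ∈ Icc 0 T, μ ≤ massMoment (f t))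
    (hmu : ∀ t ∈ Icc 0 T, μ ≤ massMoment (u t))
    (hclose : ∀ t ∈ Icc 0 T, ∀ e, |f t e - u t e| ≤ D * Real.exp (lam * t) * decay β e)
    (he : 0 < e)
    (hy : ∀ t ∈ Icc 0 T, HasDerivWithinAt y (gain (f t) e - lossRate (f t) e * y t) (Icc 0 T) t)
    (hz : ∀ t ∈ Icc 0 T, HasDerivWithinAt z (gain (u t) e - lossRate (u t) e * z t) (Icc 0 T) t)
    (hyb : ∀ t ∈ Icc 0 T, 0 ≤ y t ∧ y t ≤ N * decay γ e)
    (hzb : ∀ t ∈ Icc 0 T, 0 ≤ z t ∧ z t ≤ N * decay γ e) (h0 : y 0 = z 0)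
    {t : ℝ} (ht : t ∈ Icc 0 T) :
    |y t - z t| ≤ (contractRatio β + (C + 1) / lam) * D * Real.exp (lam * t) * decay β e := by
  have hγ : 3 < γ := by linarith
  have hW : 0 < D * decay β e := mul_pos hD (decay_pos he)
  have key := abs_le_exp_barrier (v := fun t => y t - z t)
    (r := fun t => (gain (f t) e - gain (u t) e) -
      (lossRate (f t) e - lossRate (u t) e) * ((y t + z t) / 2))
    (α := fun t => (lossRate (f t) e + lossRate (u t) e) / 2) (c := 0) (W := D * decay β e)
    (q := contractRatio β) (C := C) (lam := lam) (T := T) hlam hW (contractRatio_pos hβ).le hC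
    (fun t _ => by
      have := lossRate_nonneg (hf.dens t) hγ e
      have := lossRate_nonneg (hu.dens t) hγ e
      positivity)
    (fun t ht => ((hy t ht).sub (hz t ht)).congr_deriv (by ring)) (by simp [h0]) ?_ ht
  · calc _ ≤ _ := key
      _ = _ := by ring
  · intro t ht
    have hd : IsDensity β (D * Real.exp (lam * t)) fun x => |f t x - u t x| :=
      ⟨((hf.dens t).meas.sub (hu.dens t).meas).abs, fun x => abs_nonneg _, hclose t ht⟩
    have h1 := hrate (f t) (u t) _ e (hf.dens t) (hu.dens t) hd (hmf t ht) (hmu t ht) he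
    have h2 : |(lossRate (f t) e - lossRate (u t) e) * ((y t + z t) / 2)| ≤
        |lossRate (f t) e - lossRate (u t) e| * (N * decay γ e) := by
      rw [abs_mul]
      refine mul_le_mul_of_nonneg_left ?_ (abs_nonneg _)
      have h3 := hyb t ht
      have h4 := hzb t ht
      rw [abs_of_nonneg (by linarith)]
      linarith
    calc _ ≤ |gain (f t) e - gain (u t) e| +
          |(lossRate (f t) e - lossRate (u t) e) * ((y t + z t) / 2)| := abs_sub _ _
      _ ≤ _ := (add_le_add_right h2 _).trans h1
      _ = _ := by ring

/-! ### Local existence -/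

/-- The Picard map on `[0, δ]`, frozen outside this interval. -/
noncomputable def picardMap (f₀ : ℝ → ℝ) (δ : ℝ) (f : ℝ → ℝ → ℝ) (t e : ℝ) : ℝ :=
  mildMap f₀ f (clampTime δ t) e

section Picard

variable {γ N δ : ℝ} {f₀ : ℝ → ℝ} {f : ℝ → ℝ → ℝ}

theorem picardMap_clampTime (hδ : 0 ≤ δ) (t e : ℝ) :
    picardMap f₀ δ f (clampTime δ t) e = picardMap f₀ δ f t e := by
  unfold picardMap
  rw [clampTime_of_mem (clampTime_mem hδ t)]

theorem picardMap_zero (hδ : 0 ≤ δ) (e : ℝ) : picardMap f₀ δ f 0 e = f₀ e := by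
  unfold picardMap
  rw [clampTime_of_mem ⟨le_rfl, hδ⟩, mildMap_zero]

theorem hasDerivWithinAt_picardMap (hf : IsPath γ N f) (hγ : 3 < γ) (e : ℝ) {t : ℝ}
    (ht : t ∈ Icc 0 δ) :
    HasDerivWithinAt (fun t => picardMap f₀ δ f t e)
      (gain (f t) e - lossRate (f t) e * picardMap f₀ δ f t e) (Icc 0 δ) t := by
  have h := (hasDerivAt_mildMap (f₀ := f₀) hf hγ t e).hasDerivWithinAt (s := Icc 0 δ)
  have heq : ∀ s ∈ Icc 0 δ, picardMap f₀ δ f s e = mildMap f₀ f s e := fun s hs => by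
    unfold picardMap; rw [clampTime_of_mem hs]
  rw [heq t ht]
  exact h.congr heq (heq t ht)

/-- Over a short time the Picard map preserves the bound `2 N₀ (1 + e)^(-γ)`. -/
theorem isPath_picardMap {N₀ : ℝ} (hγ : 3 < γ) (hN₀ : 0 < N₀) (hδ : 0 ≤ δ)
    (hsmall : max (1 / 2) (gainRatio γ) + (gainConst γ * (2 * N₀ * decayMoment γ +
      (2 * N₀ * decayMoment γ) ^ 2) + 1) * δ ≤ 1)
    (h0 : IsDensity γ N₀ f₀) (hf : IsPath γ (2 * N₀) f) :
    IsPath γ (2 * N₀) (picardMap f₀ δ f) := by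
  have hG : 0 ≤ 2 * N₀ * decayMoment γ := mul_nonneg (by linarith) (decayMoment_nonneg γ)
  have hgc := gainConst_pos γ
  refine ⟨fun t => ⟨measurable_mildMap hf.isMeasurablePath hγ h0.meas _, fun e =>
    mildMap_nonneg hf hγ h0.nonneg (clampTime_mem hδ t).1, fun e => ?_⟩, fun e =>
    (continuous_mildMap hf.isMeasurablePath hγ e).comp (continuous_clampTime δ)⟩
  have hmem := clampTime_mem hδ t
  rcases le_or_gt e 0 with he | he
  · rw [decay_of_nonpos he, mul_zero]
    exact (mildMap_of_nonpos (fun _ h => h0.eq_zero h) he).le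
  have hd := decay_pos (β := γ) he
  have hW : 0 < 2 * N₀ * decay γ e := by positivity
  have key := le_linear_barrier (v := fun t => mildMap f₀ f t e) (r := fun t => gain (f t) e)
    (α := fun t => lossRate (f t) e) (T := δ) (q := gainRatio γ)
    (c := max (1 / 2) (gainRatio γ)) (C := gainConst γ * (2 * N₀ * decayMoment γ +
      (2 * N₀ * decayMoment γ) ^ 2)) hW (le_max_right _ _) (by positivity)
    (fun t _ => lossRate_nonneg (hf.dens t) hγ e)
    (fun t _ => (hasDerivAt_mildMap hf hγ t e).hasDerivWithinAt) ?_ ?_ hmem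
  · refine key.trans (mul_le_of_le_one_right hW.le (le_trans ?_ hsmall))
    exact add_le_add_right (mul_le_mul_of_nonneg_left hmem.2 (by positivity)) _
  · simp only [mildMap_zero]
    have h1 := h0.le e
    have h2 := mul_le_mul_of_nonneg_left (le_max_left (1 / 2) (gainRatio γ)) hW.le
    linarith
  · intro s _
    refine (gain_le (hf.dens s) hγ he).trans ?_
    have h1 := (hf.dens s).fullMoment_le hγ
    have h2 := (hf.dens s).fullMoment_nonneg
    gcongr

/-- Over a short time the Picard map loses at most half of the mass. -/
theorem massMoment_picardMap {N₀ μ : ℝ} (hγ : 3 < γ) (hδ : 0 ≤ δ)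
    (hsmall : δ * (collisionConst * (1 + 2 * N) * (N * decayMoment γ)) *
      (2 * (N₀ * decayMoment γ)) ≤ μ / 2)
    (h0 : IsDensity γ N₀ f₀) (hμ : μ ≤ massMoment f₀) (hf : IsPath γ N f)
    (hp : IsPath γ N (picardMap f₀ δ f)) (t : ℝ) :
    μ / 2 ≤ massMoment (picardMap f₀ δ f t) := by
  set L := collisionConst * (1 + 2 * N) * (N * decayMoment γ) with hL
  have hκ := collisionConst_pos
  have hN := (hf.dens 0).bound_nonneg
  have hJ := decayMoment_nonneg γ
  have hL0 : 0 ≤ L := by positivity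
  have hmem := clampTime_mem hδ t
  have hI := h0.integrable_mul_sqrt hγ
  have hI2 := h0.integrable_mul_id hγ
  have hlow : ∀ e, f₀ e * √e - δ * L * (f₀ e * √e + f₀ e * e) ≤
      picardMap f₀ δ f t e * √e := fun e => by
    rcases le_or_gt e 0 with he | he
    · simp [h0.eq_zero he, Real.sqrt_eq_zero_of_nonpos he]
    have h1 : f₀ e * Psi 0 f (clampTime δ t) e ≤ picardMap f₀ δ f t e :=
      le_mildMap hf hγ hmem.1
    have h2 : ∫ s in (0 : ℝ)..clampTime δ t, lossRate (f s) e ≤ δ * (L * (1 + √e)) := by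
      have h3 := intervalIntegral.integral_mono_on (μ := volume) hmem.1
        ((hf.continuous_lossRate hγ e).intervalIntegrable _ _)
        (continuous_const.intervalIntegrable 0 _ :
          IntervalIntegrable (fun _ => L * (1 + √e)) volume 0 (clampTime δ t)) fun s _ => by
        refine (lossRate_le (hf.dens s) hγ he).trans ?_
        have := (hf.dens s).fullMoment_le hγ
        rw [hL]; gcongr
      refine h3.trans ?_
      rw [intervalIntegral.integral_const, smul_eq_mul, sub_zero]
      exact mul_le_mul_of_nonneg_right hmem.2 (by positivity)
    have h4 : 1 - δ * (L * (1 + √e)) ≤ Psi 0 f (clampTime δ t) e := by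
      unfold Psi
      linarith [Real.add_one_le_exp (-∫ s in (0 : ℝ)..clampTime δ t, lossRate (f s) e)]
    have h5 := mul_le_mul_of_nonneg_left h4 (h0.nonneg e)
    have h6 := mul_le_mul_of_nonneg_right (h5.trans h1) (Real.sqrt_nonneg e)
    have hee := Real.mul_self_sqrt he.le
    have : f₀ e * (1 - δ * (L * (1 + √e))) * √e =
        f₀ e * √e - δ * L * (f₀ e * √e + f₀ e * (√e * √e)) := by ring
    rw [this, hee] at h6
    exact h6
  have h7 := integral_mono (hI.sub ((hI.add hI2).const_mul (δ * L)))
    ((hp.dens t).integrable_mul_sqrt hγ) hlow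
  rw [integral_sub' hI ((hI.add hI2).const_mul (δ * L)), integral_const_mul,
    integral_add' hI hI2] at h7
  have h8 := (h0.massMoment_le hγ).trans (h0.fullMoment_le hγ)
  have h9 := (h0.integral_mul_id_le hγ).trans (h0.fullMoment_le hγ)
  have h10 : δ * L * ((∫ a, f₀ a * √a) + ∫ a, f₀ a * a) ≤ μ / 2 := by
    refine le_trans (mul_le_mul_of_nonneg_left ?_ (mul_nonneg hδ hL0)) hsmall
    unfold massMoment at h8
    linarith
  unfold massMoment at hμ ⊢
  linarith

end Picard

/-- Local existence. The time of existence and the bound depend only on the size of the datum in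
the weighted space and on a lower bound of its mass. -/
theorem exists_local_solution {γ N₀ μ : ℝ} (hγ : 3 < γ) (hN₀ : 0 < N₀) (hμ : 0 < μ) :
    ∃ δ > 0, ∀ f₀ : ℝ → ℝ, IsDensity γ N₀ f₀ → μ ≤ massMoment f₀ →
      ∃ f, IsSolution γ (2 * N₀) δ ∅ f₀ f := by
  -- the Picard map preserves the weight `γ` and is a contraction in a weaker weight `β`
  obtain ⟨β, hβ, hβγ⟩ := exists_between hγ
  set N := 2 * N₀ with hN
  have hN0 : 0 < N := by linarith
  obtain ⟨C, hC, hrate⟩ := exists_rate_difference hβ hβγ hN0.le (half_pos hμ)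
  set c := contractRatio β with hc
  have hc1 := contractRatio_lt_one hβ
  have hc0 := contractRatio_pos hβ
  -- with this `λ` the contraction factor is `(1 + c) / 2`
  set lam := 2 * (C + 1) / (1 - c) with hlam
  have h1c : 0 < 1 - c := by linarith
  have hlam0 : 0 < lam := by positivity
  have hCl : (C + 1) / lam = (1 - c) / 2 := by rw [hlam]; field_simp
  set q := c + (C + 1) / lam with hq
  have hq0 : 0 < q := by positivity
  have hq1 : q < 1 := by rw [hq, hCl]; linarith
  -- smallness of the time interval
  set K1 := gainConst γ * (N * decayMoment γ + (N * decayMoment γ) ^ 2) + 1 with hK1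
  set K2 := (collisionConst * (1 + 2 * N) * (N * decayMoment γ)) *
      (2 * (N₀ * decayMoment γ)) with hK2
  have hJ := decayMoment_nonneg γ
  have hK1p : 0 < K1 := by have := gainConst_pos γ; positivity
  have hK2p : 0 ≤ K2 := by have := collisionConst_pos; positivity
  set c1 := max (1 / 2) (gainRatio γ) with hc1'
  have hc11 : c1 < 1 := max_lt (by norm_num) (gainRatio_lt_one hγ)
  set δ := min ((1 - c1) / K1) (μ / 2 / (K2 + 1)) with hδ
  have hδ0 : 0 < δ := lt_min (div_pos (by linarith) hK1p) (by positivity)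
  refine ⟨δ, hδ0, fun f₀ h0 hμ0 => ?_⟩
  have hs1 : c1 + K1 * δ ≤ 1 := by
    have : K1 * δ ≤ K1 * ((1 - c1) / K1) := mul_le_mul_of_nonneg_left (min_le_left _ _) hK1p.le
    rw [mul_div_cancel₀ _ hK1p.ne'] at this
    linarith
  have hs2 : δ * (collisionConst * (1 + 2 * N) * (N * decayMoment γ)) *
      (2 * (N₀ * decayMoment γ)) ≤ μ / 2 := by
    rw [mul_assoc, ← hK2]
    have h1 : δ * K2 ≤ μ / 2 / (K2 + 1) * K2 := mul_le_mul_of_nonneg_right (min_le_right _ _) hK2p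
    refine h1.trans ?_
    rw [div_mul_eq_mul_div, div_le_iff₀ (by linarith)]
    exact mul_le_mul_of_nonneg_left (by linarith) (by linarith)
  -- the class of paths preserved by the Picard map
  set F : ℕ → ℝ → ℝ → ℝ := fun n => (picardMap f₀ δ)^[n] (fun _ => f₀) with hF
  have hFsucc : ∀ n, F (n + 1) = picardMap f₀ δ (F n) := fun n =>
    Function.iterate_succ_apply' _ _ _
  have hP : ∀ n, IsPath γ N (F n) ∧ ∀ t, μ / 2 ≤ massMoment (F n t) := fun n => by
    induction n with
    | zero =>
      exact ⟨⟨fun _ => h0.mono_bound (by linarith), fun e => continuous_const⟩,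
        fun _ => (show μ / 2 ≤ μ by linarith).trans hμ0⟩
    | succ n ih =>
      rw [hFsucc]
      have := isPath_picardMap hγ hN₀ hδ0.le hs1 h0 ih.1
      exact ⟨this, massMoment_picardMap hγ hδ0.le hs2 h0 hμ0 ih.1 this⟩
  -- contraction
  have hstep : ∀ (f u : ℝ → ℝ → ℝ) (D : ℝ), 0 < D → IsPath γ N f → IsPath γ N u →
      (∀ t, μ / 2 ≤ massMoment (f t)) → (∀ t, μ / 2 ≤ massMoment (u t)) →
      (∀ t ∈ Icc 0 δ, ∀ e, |f t e - u t e| ≤ D * Real.exp (lam * t) * decay β e) →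
      ∀ t ∈ Icc 0 δ, ∀ e, |picardMap f₀ δ f t e - picardMap f₀ δ u t e| ≤
        q * D * Real.exp (lam * t) * decay β e := by
    intro f u D hD hf hu hmf hmu hcl t ht e
    rcases le_or_gt e 0 with he | he
    · have h1 : ∀ f : ℝ → ℝ → ℝ, picardMap f₀ δ f t e = 0 := fun f =>
        mildMap_of_nonpos (fun _ h => h0.eq_zero h) he
      rw [h1, h1, sub_self, abs_zero, decay_of_nonpos he, mul_zero]
    have hpf := isPath_picardMap hγ hN₀ hδ0.le hs1 h0 hf
    have hpu := isPath_picardMap hγ hN₀ hδ0.le hs1 h0 hu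
    exact duhamel_contraction (y := fun t => picardMap f₀ δ f t e)
      (z := fun t => picardMap f₀ δ u t e) hβ hβγ hlam0 hD hC hrate hf hu (fun t _ => hmf t)
      (fun t _ => hmu t) hcl he (fun t ht => hasDerivWithinAt_picardMap hf hγ e ht)
      (fun t ht => hasDerivWithinAt_picardMap hu hγ e ht)
      (fun t _ => ⟨(hpf.dens t).nonneg e, (hpf.dens t).le e⟩)
      (fun t _ => ⟨(hpu.dens t).nonneg e, (hpu.dens t).le e⟩)
      (by simp only [picardMap_zero hδ0.le]) ht
  have hdist : ∀ n, ∀ t ∈ Icc 0 δ, ∀ e, |F (n + 1) t e - F n t e| ≤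
      q ^ n * N * Real.exp (lam * t) * decay β e := fun n => by
    induction n with
    | zero =>
      intro t ht e
      have h1 := ((hP 1).1.dens t).le e
      have h2 := ((hP 1).1.dens t).nonneg e
      have h3 := ((hP 0).1.dens t).le e
      have h4 := ((hP 0).1.dens t).nonneg e
      have h5 : |F (0 + 1) t e - F 0 t e| ≤ N * decay γ e := abs_sub_le_iff.2
        ⟨by simp only [zero_add]; linarith, by simp only [zero_add]; linarith⟩
      refine h5.trans ?_
      have h6 : 1 ≤ Real.exp (lam * t) := Real.one_le_exp (mul_nonneg hlam0.le ht.1)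
      have h7 := decay_le_decay hβγ.le e
      have h8 := decay_nonneg β e
      calc N * decay γ e ≤ N * 1 * decay β e := by rw [mul_one]; gcongr
        _ ≤ N * Real.exp (lam * t) * decay β e := by gcongr
        _ = _ := by simp
    | succ n ih =>
      intro t ht e
      rw [hFsucc (n + 1)]
      nth_rewrite 2 [hFsucc n]
      refine (hstep _ _ (q ^ n * N) (by positivity) (hP _).1 (hP _).1 (hP _).2 (hP _).2 ih t ht
        e).trans_eq ?_
      ring
  set K := N * Real.exp (lam * δ) with hK
  have hclampF : ∀ n t e, F n (clampTime δ t) e = F n t e := fun n t e => by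
    cases n with
    | zero => rfl
    | succ n => rw [hFsucc]; exact picardMap_clampTime hδ0.le t e
  have hdist' : ∀ t e n, dist (F n t e) (F (n + 1) t e) ≤ K * decay β e * q ^ n := by
    intro t e n
    rw [dist_comm, Real.dist_eq, ← hclampF (n + 1), ← hclampF n]
    have hm := clampTime_mem hδ0.le t
    refine (hdist n _ hm e).trans ?_
    have h8 := decay_nonneg β e
    calc _ ≤ q ^ n * N * Real.exp (lam * δ) * decay β e := by
          have := hm.2
          gcongr
      _ = _ := by rw [hK]; ring
  have hlim : ∀ t e, ∃ l, Tendsto (fun n => F n t e) atTop (𝓝 l) := fun t e =>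
    cauchySeq_tendsto_of_complete (cauchySeq_of_le_geometric q _ hq1 (hdist' t e))
  choose f hf using hlim
  have hclose : ∀ n t e, |F n t e - f t e| ≤ K / (1 - q) * q ^ n * decay β e := fun n t e => by
    have := dist_le_of_le_geometric_of_tendsto q _ hq1 (hdist' t e) (hf t e) n
    rw [Real.dist_eq] at this
    refine this.trans_eq ?_
    ring
  have hKp : 0 < K := by positivity
  have hqn : Tendsto (fun n : ℕ => K / (1 - q) * q ^ n) atTop (𝓝 0) := by
    simpa using (tendsto_pow_atTop_nhds_zero_of_lt_one hq0.le hq1).const_mul (K / (1 - q))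
  have hfpath : IsPath γ N f := by
    refine ⟨fun t => ⟨measurable_of_tendsto_metrizable (fun n => ((hP n).1.dens t).meas)
      (tendsto_pi_nhds.2 fun e => hf t e), fun e => ge_of_tendsto' (hf t e) fun n =>
      ((hP n).1.dens t).nonneg e, fun e => le_of_tendsto' (hf t e) fun n =>
      ((hP n).1.dens t).le e⟩, fun e => ?_⟩
    refine TendstoUniformly.continuous (F := fun n t => F n t e) (p := atTop) ?_
      (Eventually.of_forall fun n => (hP n).1.cont e).frequently
    rw [Metric.tendstoUniformly_iff]
    intro ε hε
    filter_upwards [hqn.eventually (gt_mem_nhds hε)] with n hn t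
    rw [dist_comm, Real.dist_eq]
    refine (hclose n t e).trans_lt (lt_of_le_of_lt ?_ hn)
    exact mul_le_of_le_one_right (by have : 0 < 1 - q := by linarith
                                     positivity) (decay_le_one (by linarith) e)
  have hfmass : ∀ t, μ / 2 ≤ massMoment (f t) := fun t => by
    have : Tendsto (fun n => massMoment (F n t)) atTop (𝓝 (massMoment (f t))) := by
      refine tendsto_integral_of_dominated_convergence (fun e => N * decay γ e * √e)
        (fun n => (((hP n).1.dens t).meas.mul (by fun_prop)).aestronglyMeasurable) ?_
        (fun n => Eventually.of_forall fun e => ?_)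
        (Eventually.of_forall fun e => (hf t e).mul_const _)
      · simpa only [mul_assoc] using ((isDensity_decay γ).integrable_mul_sqrt hγ).const_mul N
      · rw [Real.norm_eq_abs, abs_of_nonneg (mul_nonneg (((hP n).1.dens t).nonneg e)
          (Real.sqrt_nonneg e))]
        exact mul_le_mul_of_nonneg_right (((hP n).1.dens t).le e) (Real.sqrt_nonneg e)
    exact ge_of_tendsto' this fun n => (hP n).2 t
  -- the limit is a fixed point
  have hfix : ∀ t ∈ Icc 0 δ, ∀ e, picardMap f₀ δ f t e = f t e := by
    intro t ht e
    have h1q : 0 < 1 - q := by linarith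
    have h1 : Tendsto (fun n => F (n + 1) t e) atTop (𝓝 (picardMap f₀ δ f t e)) := by
      rw [tendsto_iff_dist_tendsto_zero]
      refine squeeze_zero (fun _ => dist_nonneg) (fun n => ?_)
        (by simpa using hqn.mul_const (q * Real.exp (lam * t) * decay β e))
      rw [hFsucc, Real.dist_eq]
      refine (hstep (F n) f (K / (1 - q) * q ^ n) (by positivity) (hP n).1 hfpath (hP n).2 hfmass
        (fun s hs e => (hclose n s e).trans ?_) t ht e).trans_eq (by ring)
      have h6 : 1 ≤ Real.exp (lam * s) := Real.one_le_exp (mul_nonneg hlam0.le hs.1)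
      have h8 := decay_nonneg β e
      calc _ = K / (1 - q) * q ^ n * 1 * decay β e := by ring
        _ ≤ _ := by gcongr
    exact tendsto_nhds_unique h1 ((tendsto_add_atTop_iff_nat 1).2 (hf t e))
  refine ⟨f, hfpath, MeasurableSet.empty, measure_empty, fun e he => he.elim, fun e _ => ?_,
    fun e _ t ht => ?_⟩
  · rw [← hfix 0 ⟨le_rfl, hδ0.le⟩, picardMap_zero hδ0.le]
  · have h1 := hasDerivWithinAt_picardMap (f₀ := f₀) hfpath hγ e ht
    rw [hfix t ht] at h1
    exact h1.congr (fun s hs => (hfix s hs e).symm) (hfix t ht e).symm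

/-! ### Symmetries of the collision measure -/

/-- The exchange `(ε₁, ε₂) ↔ (ε₃, ε₄)` in the coordinates `(ε₁, (ε₃, ε₄))`. -/
def exchangePairs : ℝ × ℝ × ℝ ≃ᵐ ℝ × ℝ × ℝ where
  toFun q := (q.2.1, (q.1, q.2.1 + q.2.2 - q.1))
  invFun q := (q.2.1, (q.1, q.2.1 + q.2.2 - q.1))
  left_inv q := by ext <;> simp
  right_inv q := by ext <;> simp
  measurable_toFun := by simp only [Equiv.coe_fn_mk]; fun_prop
  measurable_invFun := by simp only [Equiv.coe_fn_symm_mk]; fun_prop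

/-- The exchange `ε₃ ↔ ε₄`. -/
def exchangeOut : ℝ × ℝ × ℝ ≃ᵐ ℝ × ℝ × ℝ where
  toFun q := (q.1, (q.2.2, q.2.1))
  invFun q := (q.1, (q.2.2, q.2.1))
  left_inv q := rfl
  right_inv q := rfl
  measurable_toFun := by simp only [Equiv.coe_fn_mk]; fun_prop
  measurable_invFun := by simp only [Equiv.coe_fn_symm_mk]; fun_prop

/-- The exchange of the first two coordinates. -/
def exchangeFirst : ℝ × ℝ × ℝ ≃ᵐ ℝ × ℝ × ℝ where
  toFun q := (q.2.1, (q.1, q.2.2))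
  invFun q := (q.2.1, (q.1, q.2.2))
  left_inv q := rfl
  right_inv q := rfl
  measurable_toFun := by simp only [Equiv.coe_fn_mk]; fun_prop
  measurable_invFun := by simp only [Equiv.coe_fn_symm_mk]; fun_prop

theorem measurePreserving_exchangeOut : MeasurePreserving exchangeOut :=
  (MeasurePreserving.id (volume : Measure ℝ)).prod
    (Measure.measurePreserving_swap (μ := (volume : Measure ℝ)) (ν := (volume : Measure ℝ)))

theorem measurePreserving_exchangeFirst : MeasurePreserving exchangeFirst := by
  have h1 : MeasurePreserving (MeasurableEquiv.prodAssoc : (ℝ × ℝ) × ℝ ≃ᵐ ℝ × ℝ × ℝ) :=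
    volume_preserving_prodAssoc
  have h2 : MeasurePreserving (fun q : (ℝ × ℝ) × ℝ => (q.1.swap, q.2)) :=
    (Measure.measurePreserving_swap (μ := (volume : Measure ℝ)) (ν := (volume : Measure ℝ))).prod
      (MeasurePreserving.id (volume : Measure ℝ))
  exact h1.comp (h2.comp (h1.symm _))

theorem measurePreserving_exchangePairs : MeasurePreserving exchangePairs := by
  have h1 : MeasurePreserving (fun q : ℝ × ℝ × ℝ => (q.1, (q.2.1, q.2.1 + q.2.2 - q.1))) := by
    refine (MeasurePreserving.id (volume : Measure ℝ)).skew_product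
      (μc := (volume : Measure (ℝ × ℝ))) (g := fun x p => (p.1, p.1 + p.2 - x)) (by
        show Measurable fun q : ℝ × ℝ × ℝ => (q.2.1, q.2.1 + q.2.2 - q.1)
        fun_prop) (Eventually.of_forall fun x => (measurePreserving_shear x).map_eq)
  exact measurePreserving_exchangeFirst.comp h1

theorem integral_comp_equiv {e : ℝ × ℝ × ℝ ≃ᵐ ℝ × ℝ × ℝ} (he : MeasurePreserving e)
    (F : ℝ × ℝ × ℝ → ℝ) : ∫ q, F (e q) = ∫ q, F q :=
  he.integral_comp' (g := F)

theorem integrable_comp_equiv {e : ℝ × ℝ × ℝ ≃ᵐ ℝ × ℝ × ℝ} (he : MeasurePreserving e)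
    {F : ℝ × ℝ × ℝ → ℝ} (hF : Integrable F) : Integrable fun q => F (e q) :=
  (he.integrable_comp_emb e.measurableEmbedding).2 hF

/-- The exchange `ε₁ ↔ ε₂`. -/
def exchangeIn : ℝ × ℝ × ℝ ≃ᵐ ℝ × ℝ × ℝ :=
  (exchangePairs.trans exchangeOut).trans exchangePairs

theorem exchangeIn_apply (q : ℝ × ℝ × ℝ) :
    exchangeIn q = (q.2.1 + q.2.2 - q.1, (q.2.1, q.2.2)) := by
  show (q.2.1 + q.2.2 - q.1, (q.2.1, q.2.1 + q.2.2 - q.1 + q.1 - q.2.1)) = _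
  ext <;> simp

theorem measurePreserving_exchangeIn : MeasurePreserving exchangeIn :=
  (measurePreserving_exchangePairs.comp measurePreserving_exchangeOut).comp
    measurePreserving_exchangePairs

/-- The exchange of the first and the third coordinate. -/
def exchangeLast : ℝ × ℝ × ℝ ≃ᵐ ℝ × ℝ × ℝ :=
  (exchangeOut.trans exchangeFirst).trans exchangeOut

theorem measurePreserving_exchangeLast : MeasurePreserving exchangeLast :=
  (measurePreserving_exchangeOut.comp measurePreserving_exchangeFirst).comp
    measurePreserving_exchangeOut

/-- The symmetric collision weight `min {√ε₁, √ε₂, √ε₃, √ε₄}`. -/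
noncomputable def collisionWeight (q : ℝ × ℝ × ℝ) : ℝ :=
  min (min (√q.1) (√(q.2.1 + q.2.2 - q.1))) (min (√q.2.1) (√q.2.2))

theorem sqrt_mul_kernelW (x y z : ℝ) : √x * kernelW x y z = collisionWeight (x, (y, z)) := by
  unfold kernelW collisionWeight
  rcases le_or_gt x 0 with hx | hx
  · simp [Real.sqrt_eq_zero_of_nonpos hx]
  · have := (Real.sqrt_pos.2 hx).ne'
    field_simp

theorem collisionWeight_nonneg (q : ℝ × ℝ × ℝ) : 0 ≤ collisionWeight q := by
  unfold collisionWeight; positivity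

theorem measurable_collisionWeight : Measurable collisionWeight := by
  unfold collisionWeight; fun_prop

theorem collisionWeight_exchangePairs (q : ℝ × ℝ × ℝ) :
    collisionWeight (exchangePairs q) = collisionWeight q := by
  show min (min (√q.2.1) (√(q.1 + (q.2.1 + q.2.2 - q.1) - q.2.1)))
    (min (√q.1) (√(q.2.1 + q.2.2 - q.1))) = _
  rw [show q.1 + (q.2.1 + q.2.2 - q.1) - q.2.1 = q.2.2 by ring, min_comm]; rfl

theorem collisionWeight_exchangeOut (q : ℝ × ℝ × ℝ) :
    collisionWeight (exchangeOut q) = collisionWeight q := by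
  show min (min (√q.1) (√(q.2.2 + q.2.1 - q.1))) (min (√q.2.2) (√q.2.1)) = _
  rw [add_comm q.2.2, min_comm (√q.2.2)]; rfl

theorem collisionWeight_exchangeIn (q : ℝ × ℝ × ℝ) :
    collisionWeight (exchangeIn q) = collisionWeight q := by
  show collisionWeight (exchangePairs (exchangeOut (exchangePairs q))) = _
  rw [collisionWeight_exchangePairs, collisionWeight_exchangeOut, collisionWeight_exchangePairs]

/-- The density of gain collisions in `(ε₁, (ε₃, ε₄))`. -/
noncomputable def collisionDensity (h : ℝ → ℝ) (q : ℝ × ℝ × ℝ) : ℝ :=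
  h q.2.1 * h q.2.2 * (1 + h q.1 + h (q.2.1 + q.2.2 - q.1)) * collisionWeight q

/-- The balance `φ(ε₁) + φ(ε₂) - φ(ε₃) - φ(ε₄)` of a test function. -/
def balance (φ : ℝ → ℝ) (q : ℝ × ℝ × ℝ) : ℝ :=
  φ q.1 + φ (q.2.1 + q.2.2 - q.1) - φ q.2.1 - φ q.2.2

theorem balance_exchangeIn (φ : ℝ → ℝ) (q : ℝ × ℝ × ℝ) :
    balance φ (exchangeIn q) = balance φ q := by
  rw [exchangeIn_apply]
  unfold balance
  simp only [show q.2.1 + q.2.2 - (q.2.1 + q.2.2 - q.1) = q.1 by ring]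
  ring

/-- Measurable test functions that grow at most linearly. -/
structure IsTest (φ : ℝ → ℝ) : Prop where
  meas : Measurable φ
  le : ∀ x, 0 < x → |φ x| ≤ 1 + x

section Rates

variable {γ N : ℝ}

/-- Gain and loss decay like `(1 + x)^(1/2 - γ)`, with a constant uniform over bounded sets. -/
theorem exists_rate_bound (hγ : 3 < γ) (hN : 0 ≤ N) : ∃ R : ℝ, 0 ≤ R ∧ ∀ h : ℝ → ℝ,
    IsDensity γ N h → ∀ x, gain h x ≤ R * (decay γ x * (1 + √x)) ∧
      h x * lossRate h x ≤ R * (decay γ x * (1 + √x)) := by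
  have hκ := collisionConst_pos
  have hJ := decayMoment_nonneg γ
  have hg := gainConst_pos γ
  set L := collisionConst * (1 + 2 * N) * (N * decayMoment γ) with hL
  set C := gainConst γ * (N * decayMoment γ + (N * decayMoment γ) ^ 2) with hC
  have hL0 : 0 ≤ L := by positivity
  have hC0 : 0 ≤ C := by positivity
  refine ⟨N * (L + C), by positivity, fun h hh x => ?_⟩
  rcases le_or_gt x 0 with hx | hx
  · simp [gain_of_nonpos h hx, lossRate_of_nonpos h hx, decay_of_nonpos hx]
  have hd := decay_nonneg γ x
  have hs := Real.sqrt_nonneg x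
  have hG := hh.fullMoment_le hγ
  have hG0 := hh.fullMoment_nonneg
  have hl : lossRate h x ≤ L * (1 + √x) := by
    refine (lossRate_le hh hγ hx).trans ?_
    rw [hL]; gcongr
  have hl0 := lossRate_nonneg hh hγ x
  constructor
  · refine (gain_le hh hγ hx).trans ?_
    have h1 : gainRatio γ * lossRate h x ≤ 1 * (L * (1 + √x)) :=
      mul_le_mul (gainRatio_lt_one hγ).le hl hl0 zero_le_one
    have h2 : gainConst γ * (fullMoment h + fullMoment h ^ 2) ≤ C * (1 + √x) := by
      have : gainConst γ * (fullMoment h + fullMoment h ^ 2) ≤ C := by rw [hC]; gcongr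
      nlinarith
    calc _ ≤ N * decay γ x * (1 * (L * (1 + √x)) + C * (1 + √x)) := by gcongr
      _ = _ := by ring
  · calc h x * lossRate h x ≤ (N * decay γ x) * (L * (1 + √x)) :=
          mul_le_mul (hh.le x) hl hl0 (mul_nonneg hN hd)
      _ = N * L * (decay γ x * (1 + √x)) := by ring
      _ ≤ N * (L + C) * (decay γ x * (1 + √x)) := by gcongr; linarith

theorem sqrt_mul_decay_le (x : ℝ) (hx : 0 < x) :
    √x * (1 + x) * (decay γ x * (1 + √x)) ≤ 2 * decay (γ - 2) x := by
  rw [← decay_mul_sq]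
  have hd := decay_nonneg γ x
  have h1 : √x * (1 + √x) ≤ 2 * (1 + x) := by
    have := sqrt_le_one_add hx.le
    nlinarith [Real.mul_self_sqrt hx.le]
  calc _ = decay γ x * (1 + x) * (√x * (1 + √x)) := by ring
    _ ≤ decay γ x * (1 + x) * (2 * (1 + x)) := by gcongr
    _ = _ := by ring

/-- A rate bounded by `R (1 + x)^(1/2 - γ)` can be integrated against `√x φ`. -/
theorem integrable_sqrt_test_mul (hγ : 3 < γ) {R : ℝ} {φ g : ℝ → ℝ} (hφ : IsTest φ)
    (hgm : Measurable g) (hg0 : ∀ x, 0 ≤ g x) (hg : ∀ x, g x ≤ R * (decay γ x * (1 + √x))) :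
    Integrable fun x => √x * φ x * g x := by
  refine ((integrable_decay (show 1 < γ - 2 by linarith)).const_mul (R * 2)).mono'
    ((by have := hφ.meas; fun_prop : Measurable _)).aestronglyMeasurable
    (Eventually.of_forall fun x => ?_)
  rcases le_or_gt x 0 with hx | hx
  · simp [Real.sqrt_eq_zero_of_nonpos hx, decay_of_nonpos hx]
  have hR : 0 ≤ R := by
    have h1 := (hg0 x).trans (hg x)
    exact nonneg_of_mul_nonneg_left h1 (mul_pos (decay_pos hx) (by positivity))
  rw [Real.norm_eq_abs, abs_mul, abs_mul, abs_of_nonneg (Real.sqrt_nonneg x),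
    abs_of_nonneg (hg0 x)]
  calc √x * |φ x| * g x ≤ √x * (1 + x) * (R * (decay γ x * (1 + √x))) := by
        have := hφ.le x hx
        have := hg x
        have := hg0 x
        gcongr
    _ = R * (√x * (1 + x) * (decay γ x * (1 + √x))) := by ring
    _ ≤ R * (2 * decay (γ - 2) x) := mul_le_mul_of_nonneg_left (sqrt_mul_decay_le x hx) hR
    _ = _ := by ring

variable {h φ : ℝ → ℝ}

theorem measurable_collisionDensity (hh : Measurable h) : Measurable (collisionDensity h) := by
  have := measurable_collisionWeight
  unfold collisionDensity
  fun_prop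

theorem collisionDensity_nonneg (hh : IsDensity γ N h) (q : ℝ × ℝ × ℝ) :
    0 ≤ collisionDensity h q := by
  have h1 := hh.nonneg q.2.1
  have h2 := hh.nonneg q.2.2
  have h3 := hh.nonneg q.1
  have h4 := hh.nonneg (q.2.1 + q.2.2 - q.1)
  have h5 := collisionWeight_nonneg q
  unfold collisionDensity; positivity

theorem collisionDensity_first (h φ : ℝ → ℝ) (x : ℝ) (p : ℝ × ℝ) :
    collisionDensity h (x, p) * φ x = √x * φ x * gainIntegrand h x p := by
  unfold collisionDensity gainIntegrand
  rw [show collisionWeight (x, p) = √x * kernelW x p.1 p.2 from (sqrt_mul_kernelW _ _ _).symm]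
  ring

theorem collisionDensity_exchange (h φ : ℝ → ℝ) (x : ℝ) (p : ℝ × ℝ) :
    collisionDensity h (exchangePairs (x, p)) * φ (exchangePairs (x, p)).2.1 =
      √x * φ x * (h x * lossIntegrand h x p) := by
  unfold collisionDensity
  rw [collisionWeight_exchangePairs,
    show collisionWeight (x, p) = √x * kernelW x p.1 p.2 from (sqrt_mul_kernelW _ _ _).symm]
  show h x * h (p.1 + p.2 - x) * (1 + h p.1 + h (x + (p.1 + p.2 - x) - p.1)) * _ * φ x = _
  rw [show x + (p.1 + p.2 - x) - p.1 = p.2 by ring]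
  unfold lossIntegrand
  ring

theorem integrable_collisionDensity_first (hh : IsDensity γ N h) (hγ : 3 < γ) (hφ : IsTest φ) :
    Integrable fun q : ℝ × ℝ × ℝ => collisionDensity h q * φ q.1 := by
  obtain ⟨R, hR, hRb⟩ := exists_rate_bound hγ hh.bound_nonneg
  have hm : Measurable fun q : ℝ × ℝ × ℝ => collisionDensity h q * φ q.1 :=
    (measurable_collisionDensity hh.meas).mul (hφ.meas.comp measurable_fst)
  refine (integrable_prod_iff (μ := (volume : Measure ℝ)) (ν := (volume : Measure (ℝ × ℝ)))
    hm.aestronglyMeasurable).2 ⟨Eventually.of_forall fun x => ?_, ?_⟩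
  · simp only [collisionDensity_first]
    exact (integrable_gainIntegrand hh hγ x).const_mul _
  · have := (integrable_sqrt_test_mul hγ hφ (measurable_gain hh hγ) (gain_nonneg hh hγ)
      fun x => (hRb h hh x).1).norm.const_mul collisionConst⁻¹
    refine this.congr (Eventually.of_forall fun x => ?_)
    simp only [collisionDensity_first, norm_mul, integral_const_mul]
    have hpos : 0 ≤ ∫ p, gainIntegrand h x p := integral_nonneg (gainIntegrand_nonneg hh x)
    rw [gain_eq hh hγ, norm_mul]
    simp only [Real.norm_eq_abs, abs_of_nonneg (gainIntegrand_nonneg hh x _),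
      abs_of_nonneg hpos, abs_of_pos collisionConst_pos]
    have := collisionConst_pos.ne'
    field_simp

theorem integrable_collisionDensity_third (hh : IsDensity γ N h) (hγ : 3 < γ) (hφ : IsTest φ) :
    Integrable fun q : ℝ × ℝ × ℝ => collisionDensity h q * φ q.2.1 := by
  obtain ⟨R, hR, hRb⟩ := exists_rate_bound hγ hh.bound_nonneg
  have hm : Measurable fun q : ℝ × ℝ × ℝ => collisionDensity h q * φ q.2.1 :=
    (measurable_collisionDensity hh.meas).mul (hφ.meas.comp (by fun_prop))
  rw [← measurePreserving_exchangePairs.integrable_comp_emb exchangePairs.measurableEmbedding]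
  refine (integrable_prod_iff (μ := (volume : Measure ℝ)) (ν := (volume : Measure (ℝ × ℝ)))
    (hm.comp exchangePairs.measurable).aestronglyMeasurable).2
    ⟨Eventually.of_forall fun x => ?_, ?_⟩
  · simp only [Function.comp, collisionDensity_exchange]
    exact ((integrable_lossIntegrand hh hγ x).const_mul _).const_mul _
  · have := (integrable_sqrt_test_mul hγ hφ (hh.meas.mul (measurable_lossRate hh hγ))
      (fun x => mul_nonneg (hh.nonneg x) (lossRate_nonneg hh hγ x))
      fun x => (hRb h hh x).2).norm.const_mul collisionConst⁻¹
    refine this.congr (Eventually.of_forall fun x => ?_)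
    simp only [Function.comp, collisionDensity_exchange, norm_mul, integral_const_mul,
      Pi.mul_apply]
    have hpos : 0 ≤ ∫ p, lossIntegrand h x p := integral_nonneg (lossIntegrand_nonneg hh x)
    rw [lossRate_eq hh hγ, norm_mul]
    simp only [Real.norm_eq_abs, abs_of_nonneg (lossIntegrand_nonneg hh x _),
      abs_of_nonneg hpos, abs_of_pos collisionConst_pos]
    have := collisionConst_pos.ne'
    field_simp

theorem collisionDensity_exchangeIn (h : ℝ → ℝ) (q : ℝ × ℝ × ℝ) :
    collisionDensity h (exchangeIn q) = collisionDensity h q := by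
  unfold collisionDensity
  rw [collisionWeight_exchangeIn, exchangeIn_apply]
  simp only [show q.2.1 + q.2.2 - (q.2.1 + q.2.2 - q.1) = q.1 by ring]
  ring

theorem collisionDensity_exchangeOut (h : ℝ → ℝ) (q : ℝ × ℝ × ℝ) :
    collisionDensity h (exchangeOut q) = collisionDensity h q := by
  unfold collisionDensity
  rw [collisionWeight_exchangeOut]
  show h q.2.2 * h q.2.1 * (1 + h q.1 + h (q.2.2 + q.2.1 - q.1)) * _ = _
  rw [add_comm q.2.2]; ring

theorem integrable_collisionDensity_second (hh : IsDensity γ N h) (hγ : 3 < γ) (hφ : IsTest φ) :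
    Integrable fun q : ℝ × ℝ × ℝ => collisionDensity h q * φ (q.2.1 + q.2.2 - q.1) := by
  have := integrable_comp_equiv measurePreserving_exchangeIn
    (integrable_collisionDensity_first hh hγ hφ)
  simp only [collisionDensity_exchangeIn] at this
  simpa only [exchangeIn_apply] using this

theorem integral_collisionDensity_second (h φ : ℝ → ℝ) :
    ∫ q : ℝ × ℝ × ℝ, collisionDensity h q * φ (q.2.1 + q.2.2 - q.1) =
      ∫ q : ℝ × ℝ × ℝ, collisionDensity h q * φ q.1 := by
  have := integral_comp_equiv measurePreserving_exchangeIn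
    (fun q : ℝ × ℝ × ℝ => collisionDensity h q * φ q.1)
  simp only [collisionDensity_exchangeIn] at this
  simpa only [exchangeIn_apply] using this

theorem integrable_collisionDensity_fourth (hh : IsDensity γ N h) (hγ : 3 < γ) (hφ : IsTest φ) :
    Integrable fun q : ℝ × ℝ × ℝ => collisionDensity h q * φ q.2.2 := by
  have := integrable_comp_equiv measurePreserving_exchangeOut
    (integrable_collisionDensity_third hh hγ hφ)
  simp only [collisionDensity_exchangeOut] at this
  exact this

theorem integral_collisionDensity_fourth (h φ : ℝ → ℝ) :
    ∫ q : ℝ × ℝ × ℝ, collisionDensity h q * φ q.2.2 =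
      ∫ q : ℝ × ℝ × ℝ, collisionDensity h q * φ q.2.1 := by
  have := integral_comp_equiv measurePreserving_exchangeOut
    (fun q : ℝ × ℝ × ℝ => collisionDensity h q * φ q.2.1)
  simp only [collisionDensity_exchangeOut] at this
  exact this

theorem collisionDensity_mul_balance (h φ : ℝ → ℝ) (q : ℝ × ℝ × ℝ) :
    collisionDensity h q * balance φ q = (collisionDensity h q * φ q.1 +
      collisionDensity h q * φ (q.2.1 + q.2.2 - q.1)) -
      (collisionDensity h q * φ q.2.1 + collisionDensity h q * φ q.2.2) := by
  unfold balance; ring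

theorem integrable_balance (hh : IsDensity γ N h) (hγ : 3 < γ) (hφ : IsTest φ) :
    Integrable fun q => collisionDensity h q * balance φ q := by
  simp only [collisionDensity_mul_balance]
  exact ((integrable_collisionDensity_first hh hγ hφ).add
    (integrable_collisionDensity_second hh hγ hφ)).sub
    ((integrable_collisionDensity_third hh hγ hφ).add
    (integrable_collisionDensity_fourth hh hγ hφ))

/-- The rate of change of the moment `∫ h √x φ`. -/
noncomputable def momentRate (h φ : ℝ → ℝ) : ℝ :=
  ∫ x, √x * φ x * (gain h x - lossRate h x * h x)

/-- The symmetrized weak form of the collision operator: gain minus loss, tested with `√x φ`, is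
symmetric in the two members of each pair and antisymmetric under `exchangePairs`. -/
theorem two_mul_momentRate (hh : IsDensity γ N h) (hγ : 3 < γ) (hφ : IsTest φ) :
    2 * momentRate h φ = collisionConst * ∫ q, collisionDensity h q * balance φ q := by
  obtain ⟨R, hR, hRb⟩ := exists_rate_bound hγ hh.bound_nonneg
  have i1 := integrable_sqrt_test_mul hγ hφ (measurable_gain hh hγ) (gain_nonneg hh hγ)
      fun x => (hRb h hh x).1
  have i2 := integrable_sqrt_test_mul hγ hφ (hh.meas.mul (measurable_lossRate hh hγ))
      (fun x => mul_nonneg (hh.nonneg x) (lossRate_nonneg hh hγ x)) fun x => (hRb h hh x).2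
  have e1 : ∫ x, √x * φ x * gain h x =
      collisionConst * ∫ q : ℝ × ℝ × ℝ, collisionDensity h q * φ q.1 := by
    rw [show (∫ q : ℝ × ℝ × ℝ, collisionDensity h q * φ q.1) = _ from
      integral_prod (μ := (volume : Measure ℝ)) (ν := (volume : Measure (ℝ × ℝ))) _
      (integrable_collisionDensity_first hh hγ hφ), ← integral_const_mul]
    congr 1; ext x
    simp only [collisionDensity_first, integral_const_mul]
    rw [gain_eq hh hγ]; ring
  have e2 : ∫ x, √x * φ x * (h x * lossRate h x) =
      collisionConst * ∫ q : ℝ × ℝ × ℝ, collisionDensity h q * φ q.2.1 := by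
    have i3 := integrable_comp_equiv measurePreserving_exchangePairs
      (integrable_collisionDensity_third hh hγ hφ)
    rw [← integral_comp_equiv measurePreserving_exchangePairs, show (∫ q : ℝ × ℝ × ℝ,
      collisionDensity h (exchangePairs q) * φ (exchangePairs q).2.1) = _ from
      integral_prod (μ := (volume : Measure ℝ)) (ν := (volume : Measure (ℝ × ℝ))) _
      i3, ← integral_const_mul]
    congr 1; ext x
    simp only [collisionDensity_exchange, integral_const_mul]
    rw [lossRate_eq hh hγ]; ring
  have e3 : momentRate h φ = (∫ x, √x * φ x * gain h x) -
      ∫ x, √x * φ x * (h x * lossRate h x) := by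
    unfold momentRate
    refine Eq.trans ?_ (integral_sub' i1 i2)
    congr 1; ext x; simp only [Pi.sub_apply]; ring
  have e4 : ∫ q, collisionDensity h q * balance φ q =
      2 * (∫ q : ℝ × ℝ × ℝ, collisionDensity h q * φ q.1) -
      2 * ∫ q : ℝ × ℝ × ℝ, collisionDensity h q * φ q.2.1 := by
    simp only [collisionDensity_mul_balance]
    refine (integral_sub' ((integrable_collisionDensity_first hh hγ hφ).add
      (integrable_collisionDensity_second hh hγ hφ)) ((integrable_collisionDensity_third hh hγ
      hφ).add (integrable_collisionDensity_fourth hh hγ hφ))).trans ?_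
    rw [integral_add' (integrable_collisionDensity_first hh hγ hφ)
      (integrable_collisionDensity_second hh hγ hφ),
      integral_add' (integrable_collisionDensity_third hh hγ hφ)
      (integrable_collisionDensity_fourth hh hγ hφ), integral_collisionDensity_second,
      integral_collisionDensity_fourth]
    ring
  rw [e4, e3, e1, e2]
  ring

/-- Collision invariants have constant moments. -/
theorem momentRate_eq_zero (hh : IsDensity γ N h) (hγ : 3 < γ) (hφ : IsTest φ)
    (hb : ∀ q, balance φ q = 0) : momentRate h φ = 0 := by
  have := two_mul_momentRate hh hγ hφ
  simp only [hb, mul_zero, integral_zero] at this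
  linarith

end Rates

/-! ### Quadratic and cubic collisions -/

/-- The quadratic part of the collision density. -/
noncomputable def quadDensity (h : ℝ → ℝ) (q : ℝ × ℝ × ℝ) : ℝ :=
  h q.2.1 * h q.2.2 * collisionWeight q

/-- The cubic part of the collision density; the other cubic part is its image under
`ε₁ ↔ ε₂`. -/
noncomputable def cubicDensity (h : ℝ → ℝ) (q : ℝ × ℝ × ℝ) : ℝ :=
  h q.1 * h q.2.1 * h q.2.2 * collisionWeight q

theorem collisionDensity_eq (h : ℝ → ℝ) (q : ℝ × ℝ × ℝ) :
    collisionDensity h q = quadDensity h q + cubicDensity h q +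
      cubicDensity h (exchangeIn q) := by
  unfold collisionDensity quadDensity cubicDensity
  rw [collisionWeight_exchangeIn, exchangeIn_apply]
  ring

section Parts

variable {γ N : ℝ} {h φ : ℝ → ℝ}

theorem quadDensity_nonneg (hh : IsDensity γ N h) (q : ℝ × ℝ × ℝ) : 0 ≤ quadDensity h q :=
  mul_nonneg (mul_nonneg (hh.nonneg _) (hh.nonneg _)) (collisionWeight_nonneg q)

theorem cubicDensity_nonneg (hh : IsDensity γ N h) (q : ℝ × ℝ × ℝ) : 0 ≤ cubicDensity h q :=
  mul_nonneg (mul_nonneg (mul_nonneg (hh.nonneg _) (hh.nonneg _)) (hh.nonneg _))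
    (collisionWeight_nonneg q)

theorem measurable_quadDensity (hh : Measurable h) : Measurable (quadDensity h) := by
  have := measurable_collisionWeight
  unfold quadDensity; fun_prop

theorem measurable_cubicDensity (hh : Measurable h) : Measurable (cubicDensity h) := by
  have := measurable_collisionWeight
  unfold cubicDensity; fun_prop

theorem integrable_part (hh : IsDensity γ N h) {F ψ : ℝ × ℝ × ℝ → ℝ} (hF : Measurable F)
    (hψ : Measurable ψ) (h0 : ∀ q, 0 ≤ F q) (hle : ∀ q, F q ≤ collisionDensity h q)
    (hI : Integrable fun q => collisionDensity h q * ψ q) : Integrable fun q => F q * ψ q := by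
  refine hI.norm.mono' (hF.mul hψ).aestronglyMeasurable (Eventually.of_forall fun q => ?_)
  rw [norm_mul, norm_mul, Real.norm_of_nonneg (h0 q),
    Real.norm_of_nonneg (collisionDensity_nonneg hh q)]
  exact mul_le_mul_of_nonneg_right (hle q) (norm_nonneg _)

theorem quadDensity_le (hh : IsDensity γ N h) (q : ℝ × ℝ × ℝ) :
    quadDensity h q ≤ collisionDensity h q := by
  rw [collisionDensity_eq]
  linarith [cubicDensity_nonneg hh q, cubicDensity_nonneg hh (exchangeIn q)]

theorem cubicDensity_le (hh : IsDensity γ N h) (q : ℝ × ℝ × ℝ) :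
    cubicDensity h q ≤ collisionDensity h q := by
  rw [collisionDensity_eq]
  linarith [quadDensity_nonneg hh q, cubicDensity_nonneg hh (exchangeIn q)]

theorem IsTest.measurable_balance (hφ : IsTest φ) : Measurable (balance φ) := by
  have := hφ.meas
  unfold balance; fun_prop

theorem integral_collisionDensity_balance (hh : IsDensity γ N h) (hγ : 3 < γ) (hφ : IsTest φ) :
    ∫ q, collisionDensity h q * balance φ q = (∫ q, quadDensity h q * balance φ q) +
      2 * ∫ q, cubicDensity h q * balance φ q := by
  have iq := integrable_part hh (measurable_quadDensity hh.meas) hφ.measurable_balance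
    (quadDensity_nonneg hh) (quadDensity_le hh) (integrable_balance hh hγ hφ)
  have ic := integrable_part hh (measurable_cubicDensity hh.meas) hφ.measurable_balance
    (cubicDensity_nonneg hh) (cubicDensity_le hh) (integrable_balance hh hγ hφ)
  have ic' := integrable_comp_equiv measurePreserving_exchangeIn ic
  have e1 := integral_comp_equiv measurePreserving_exchangeIn
    (fun q => cubicDensity h q * balance φ q)
  calc ∫ q, collisionDensity h q * balance φ q
      = ∫ q, ((quadDensity h q * balance φ q + cubicDensity h q * balance φ q) +
          cubicDensity h (exchangeIn q) * balance φ (exchangeIn q)) := by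
        congr 1; ext q
        rw [collisionDensity_eq, balance_exchangeIn]; ring
    _ = _ := by
        refine (integral_add' (iq.add ic) ic').trans ?_
        rw [integral_add' iq ic, e1]; ring

section WeightSlice

variable {y z : ℝ}

theorem collisionWeight_slice_le (x : ℝ) :
    collisionWeight (x, (y, z)) ≤ (Ioo 0 (y + z)).indicator (fun _ => min (√y) (√z)) x := by
  by_cases hx : x ∈ Ioo 0 (y + z)
  · rw [indicator_of_mem hx]; exact min_le_right _ _
  · rw [indicator_of_notMem hx]
    rcases not_and_or.1 hx with h | h
    · refine ((min_le_left _ _).trans (min_le_left _ _)).trans ?_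
      simp [Real.sqrt_eq_zero_of_nonpos (not_lt.1 h)]
    · refine ((min_le_left _ _).trans (min_le_right _ _)).trans ?_
      simp [Real.sqrt_eq_zero_of_nonpos (show y + z - x ≤ 0 by linarith [not_lt.1 h])]

theorem integrable_collisionWeight_slice :
    Integrable fun x => collisionWeight (x, (y, z)) :=
  (integrable_slice_bound (y + z) (min (√y) (√z))).mono'
    ((measurable_collisionWeight.comp measurable_prodMk_right).aestronglyMeasurable)
    (Eventually.of_forall fun x => by
      rw [Real.norm_eq_abs, abs_of_nonneg (collisionWeight_nonneg _)]
      exact collisionWeight_slice_le x)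

theorem integral_collisionWeight_slice_le (hy : 0 < y) (hz : 0 < z) :
    ∫ x, collisionWeight (x, (y, z)) ≤ y * √z + z * √y := by
  refine (integral_mono integrable_collisionWeight_slice
    (integrable_slice_bound (y + z) (min (√y) (√z))) collisionWeight_slice_le).trans ?_
  have h2 : ∫ x, (Ioo 0 (y + z)).indicator (fun _ : ℝ => min (√y) (√z)) x
      = (y + z) * min (√y) (√z) := by
    rw [integral_indicator measurableSet_Ioo]
    simp [Measure.real, ENNReal.toReal_ofReal (by linarith : 0 ≤ y + z)]
  rw [h2, add_mul]
  exact add_le_add (mul_le_mul_of_nonneg_left (min_le_right _ _) hy.le)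
    (mul_le_mul_of_nonneg_left (min_le_left _ _) hz.le)

end WeightSlice

/-- The quadratic loss from the test function `φ`. For given `ε₃`, `ε₄`, the integral of
the collision weight over `ε₁` is bounded by `integral_collisionWeight_slice_le`. -/
theorem integral_quadDensity_le (hh : IsDensity γ N h) (hγ : 3 < γ) (hφ : IsTest φ)
    (hφ0 : ∀ x, 0 ≤ φ x) (hφ1 : ∀ x, 0 < x → φ x ≤ 1) :
    ∫ q : ℝ × ℝ × ℝ, quadDensity h q * φ q.2.1 ≤
      (∫ x, h x * x * φ x) * massMoment h + (∫ x, h x * √x * φ x) * ∫ x, h x * x := by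
  have hφm := hφ.meas
  have iq := integrable_part hh (measurable_quadDensity hh.meas)
    (ψ := fun q => φ q.2.1) (by fun_prop) (quadDensity_nonneg hh) (quadDensity_le hh)
    (integrable_collisionDensity_third hh hγ hφ)
  have hφa : ∀ x, 0 < x → |φ x| ≤ 1 := fun x hx => by rw [abs_of_nonneg (hφ0 x)]; exact hφ1 x hx
  have j1 : Integrable fun x => h x * x * φ x := by
    simp only [mul_assoc]
    refine hh.integrable_mul_of_le hγ (by fun_prop) fun x hx => ?_
    rw [abs_mul, abs_of_pos hx]
    exact (mul_le_of_le_one_right hx.le (hφa x hx)).trans (le_momentWeight x)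
  have j2 : Integrable fun x => h x * √x * φ x := by
    simp only [mul_assoc]
    refine hh.integrable_mul_of_le hγ (by fun_prop) fun x hx => ?_
    rw [abs_mul, abs_of_nonneg (Real.sqrt_nonneg x)]
    exact (mul_le_of_le_one_right (Real.sqrt_nonneg x) (hφa x hx)).trans (sqrt_le_momentWeight x)
  have j3 := hh.integrable_mul_sqrt hγ
  have j4 := hh.integrable_mul_id hγ
  unfold massMoment
  rw [← integral_left_right, ← integral_left_right]
  have k1 := integrable_left_right j1 j3
  have k2 := integrable_left_right j2 j4
  rw [← integral_add k1 k2, show (∫ q : ℝ × ℝ × ℝ, quadDensity h q * φ q.2.1) = _ from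
    integral_prod_symm (μ := (volume : Measure ℝ)) (ν := (volume : Measure (ℝ × ℝ))) _ iq]
  refine integral_mono (iq.integral_prod_right (μ := (volume : Measure ℝ))
    (ν := (volume : Measure (ℝ × ℝ)))) (k1.add k2) fun p => ?_
  have e1 : ∫ x, quadDensity h (x, p) * φ p.1 =
      h p.1 * h p.2 * φ p.1 * ∫ x, collisionWeight (x, (p.1, p.2)) := by
    rw [← integral_const_mul]
    congr 1; ext x
    unfold quadDensity; ring
  refine (show _ = _ from e1).trans_le ?_
  rcases le_or_gt p.1 0 with hy | hy
  · simp [hh.eq_zero hy]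
  rcases le_or_gt p.2 0 with hz | hz
  · simp [hh.eq_zero hz]
  have := mul_le_mul_of_nonneg_left (integral_collisionWeight_slice_le hy hz)
    (mul_nonneg (mul_nonneg (hh.nonneg p.1) (hh.nonneg p.2)) (hφ0 p.1))
  linarith

theorem quadDensity_exchangeOut (h : ℝ → ℝ) (q : ℝ × ℝ × ℝ) :
    quadDensity h (exchangeOut q) = quadDensity h q := by
  unfold quadDensity
  rw [collisionWeight_exchangeOut]
  show h q.2.2 * h q.2.1 * _ = _
  ring

/-- Quadratic collisions lower the moment of a nonnegative test function at most by what the pair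
`(ε₃, ε₄)` takes out. -/
theorem le_integral_quadDensity_balance (hh : IsDensity γ N h) (hγ : 3 < γ) (hφ : IsTest φ)
    (hφ0 : ∀ x, 0 ≤ φ x) (hφ1 : ∀ x, 0 < x → φ x ≤ 1) :
    -(2 * ((∫ x, h x * x * φ x) * massMoment h + (∫ x, h x * √x * φ x) * ∫ x, h x * x)) ≤
      ∫ q, quadDensity h q * balance φ q := by
  have hφm := hφ.meas
  have iq := integrable_part hh (measurable_quadDensity hh.meas)
    (ψ := fun q => φ q.2.1) (by fun_prop) (quadDensity_nonneg hh) (quadDensity_le hh)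
    (integrable_collisionDensity_third hh hγ hφ)
  have iq' := integrable_comp_equiv measurePreserving_exchangeOut iq
  have e1 := integral_comp_equiv measurePreserving_exchangeOut
    (fun q => quadDensity h q * φ q.2.1)
  have ib := integrable_part hh (measurable_quadDensity hh.meas) hφ.measurable_balance
    (quadDensity_nonneg hh) (quadDensity_le hh) (integrable_balance hh hγ hφ)
  have h1 := integral_mono (iq.add iq').neg ib (fun q => by
    have h0 := quadDensity_nonneg hh q
    have h2 := mul_nonneg h0 (hφ0 q.1)
    have h3 := mul_nonneg h0 (hφ0 (q.2.1 + q.2.2 - q.1))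
    simp only [Pi.neg_apply, Pi.add_apply, quadDensity_exchangeOut]
    show -(quadDensity h q * φ q.2.1 + quadDensity h q * φ q.2.2) ≤ _
    unfold balance
    linarith)
  rw [integral_neg', integral_add' iq iq', e1] at h1
  linarith [integral_quadDensity_le hh hγ hφ hφ0 hφ1]

/-! ### Convexity of the cubic part -/

/-- The exponential test function, which turns moments into Laplace transforms. -/
noncomputable def expTest (p x : ℝ) : ℝ := Real.exp (-(p * x))

theorem expTest_pos (p x : ℝ) : 0 < expTest p x := Real.exp_pos _

theorem expTest_le_one {p x : ℝ} (hp : 0 ≤ p) (hx : 0 ≤ x) : expTest p x ≤ 1 :=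
  Real.exp_le_one_iff.2 (by linarith [mul_nonneg hp hx])

theorem measurable_expTest (p : ℝ) : Measurable (expTest p) := by
  unfold expTest; fun_prop

theorem isTest_expTest {p : ℝ} (hp : 0 ≤ p) : IsTest (expTest p) :=
  ⟨measurable_expTest p, fun x hx => by
    rw [abs_of_pos (expTest_pos p x)]; linarith [expTest_le_one hp hx.le]⟩

/-- The weighted balance of one cubic collision. -/
noncomputable def cubicBalance (p : ℝ) (x y z : ℝ) : ℝ :=
  collisionWeight (x, (y, z)) * balance (expTest p) (x, (y, z))

theorem cubicBalance_symm (p x y z : ℝ) : cubicBalance p x y z = cubicBalance p x z y := by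
  unfold cubicBalance
  rw [← collisionWeight_exchangeOut]
  show collisionWeight (x, (z, y)) * _ = _
  congr 1
  unfold balance
  simp only [add_comm y z]; ring

/-- The sum of the balances of the three collisions in which one particle of a given triple of
energies takes part as a catalyst. -/
noncomputable def cubicSum (p x y z : ℝ) : ℝ :=
  cubicBalance p x y z + cubicBalance p y x z + cubicBalance p z y x

theorem cubicSum_swap (p x y z : ℝ) : cubicSum p x y z = cubicSum p y x z := by
  unfold cubicSum
  rw [cubicBalance_symm p z x y]; ring

theorem cubicSum_swap' (p x y z : ℝ) : cubicSum p x y z = cubicSum p x z y := by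
  unfold cubicSum
  rw [cubicBalance_symm p x y z, cubicBalance_symm p y x z, cubicBalance_symm p z y x]; ring

/-- For ordered energies `a ≤ b ≤ c` the collisions gain at least
`√a e^{-pc} (e^{p(b - a)} + e^{-p(b - a)} - 2)`. -/
theorem le_cubicSum_of_ordered {p a b c : ℝ} (hp : 0 ≤ p) (hab : a ≤ b)
    (hbc : b ≤ c) :
    √a * (expTest p c * (Real.exp (p * (b - a)) + Real.exp (-(p * (b - a))) - 2)) ≤
      cubicSum p a b c := by
  have hsab := Real.sqrt_le_sqrt hab
  have hsbc := Real.sqrt_le_sqrt hbc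
  have w1 : collisionWeight (a, (b, c)) = √a := by
    have : √a ≤ √(b + c - a) := Real.sqrt_le_sqrt (by linarith)
    unfold collisionWeight
    rw [min_eq_left this, min_eq_left hsbc, min_eq_left hsab]
  have w2 : collisionWeight (b, (a, c)) = √a := by
    have : √a ≤ √(a + c - b) := Real.sqrt_le_sqrt (by linarith)
    unfold collisionWeight
    simp only
    rw [min_eq_left (hsab.trans hsbc), min_eq_right (le_min hsab this)]
  -- for `ε₁ = c` and `{ε₃, ε₄} = {a, b}` the balance is
  -- `e^{-p(a+b-c)} (1 - e^{-p(c-b)}) (1 - e^{-p(c-a)})`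
  have h3 : 0 ≤ cubicBalance p c b a := by
    unfold cubicBalance
    rcases le_or_gt (a + b) c with h | h
    · have : collisionWeight (c, (b, a)) = 0 := by
        refine le_antisymm (((min_le_left _ _).trans (min_le_right _ _)).trans ?_)
          (collisionWeight_nonneg _)
        simp [Real.sqrt_eq_zero_of_nonpos (show b + a - c ≤ 0 by linarith)]
      rw [this, zero_mul]
    · refine mul_nonneg (collisionWeight_nonneg _) ?_
      unfold balance expTest
      simp only
      have k1 : Real.exp (-(p * a)) =
          Real.exp (-(p * (b + a - c))) * Real.exp (-(p * (c - b))) := by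
        rw [← Real.exp_add]; congr 1; ring
      have k2 : Real.exp (-(p * b)) =
          Real.exp (-(p * (b + a - c))) * Real.exp (-(p * (c - a))) := by
        rw [← Real.exp_add]; congr 1; ring
      have k3 : Real.exp (-(p * c)) = Real.exp (-(p * (b + a - c))) *
          (Real.exp (-(p * (c - b))) * Real.exp (-(p * (c - a)))) := by
        rw [← Real.exp_add, ← Real.exp_add]; congr 1; ring
      have l1 : Real.exp (-(p * (c - b))) ≤ 1 :=
        Real.exp_le_one_iff.2 (by have := mul_nonneg hp (show 0 ≤ c - b by linarith); linarith)
      have l2 : Real.exp (-(p * (c - a))) ≤ 1 :=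
        Real.exp_le_one_iff.2 (by have := mul_nonneg hp (show 0 ≤ c - a by linarith); linarith)
      rw [k1, k2, k3]
      have := mul_nonneg (Real.exp_pos (-(p * (b + a - c)))).le
        (mul_nonneg (sub_nonneg.2 l1) (sub_nonneg.2 l2))
      linarith
  have h1 : cubicBalance p a b c + cubicBalance p b a c =
      √a * (expTest p c * (Real.exp (p * (b - a)) + Real.exp (-(p * (b - a))) - 2)) := by
    unfold cubicBalance
    rw [w1, w2]
    unfold balance expTest
    simp only
    have k1 : Real.exp (-(p * (b + c - a))) =
        Real.exp (-(p * c)) * Real.exp (-(p * (b - a))) := by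
      rw [← Real.exp_add]; congr 1; ring
    have k2 : Real.exp (-(p * (a + c - b))) = Real.exp (-(p * c)) * Real.exp (p * (b - a)) := by
      rw [← Real.exp_add]; congr 1; ring
    rw [k1, k2]; ring
  unfold cubicSum
  linarith

theorem cubicSum_nonneg_of_ordered {p a b c : ℝ} (hp : 0 ≤ p) (hab : a ≤ b)
    (hbc : b ≤ c) : 0 ≤ cubicSum p a b c := by
  refine le_trans ?_ (le_cubicSum_of_ordered hp hab hbc)
  refine mul_nonneg (Real.sqrt_nonneg a) (mul_nonneg (expTest_pos p c).le ?_)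
  have h1 := Real.add_one_le_exp (p * (b - a))
  have h2 := Real.add_one_le_exp (-(p * (b - a)))
  linarith

/-- Cubic collisions never decrease the Laplace transform. -/
theorem cubicSum_nonneg {p : ℝ} (hp : 0 ≤ p) (x y z : ℝ) :
    0 ≤ cubicSum p x y z := by
  rcases le_total x y with h1 | h1 <;> rcases le_total y z with h2 | h2 <;>
    rcases le_total x z with h3 | h3
  · exact cubicSum_nonneg_of_ordered hp h1 h2
  · exact cubicSum_nonneg_of_ordered hp h1 h2
  · rw [cubicSum_swap']; exact cubicSum_nonneg_of_ordered hp h3 h2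
  · rw [cubicSum_swap', cubicSum_swap]; exact cubicSum_nonneg_of_ordered hp h3 h1
  · rw [cubicSum_swap]; exact cubicSum_nonneg_of_ordered hp h1 h3
  · rw [cubicSum_swap, cubicSum_swap']; exact cubicSum_nonneg_of_ordered hp h2 h3
  · rw [cubicSum_swap, cubicSum_swap', cubicSum_swap]
    exact cubicSum_nonneg_of_ordered hp h2 h1
  · rw [cubicSum_swap, cubicSum_swap', cubicSum_swap]
    exact cubicSum_nonneg_of_ordered hp h2 h1

/-- Two particles of nearly equal energies, with a third one far below, produce particles of low
energy at a rate proportional to the number of those already there. -/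
theorem le_cubicSum {p x y z : ℝ} (hp : 0 < p) (hxy : 2 ≤ p * (y - x))
    (hxz : 2 ≤ p * (z - x)) (hyz : |p * (y - z)| ≤ 1) :
    1 / 6 * (√x * expTest p x) ≤ cubicSum p x y z := by
  wlog h : y ≤ z generalizing y z
  · rw [cubicSum_swap']
    refine this hxz hxy ?_ (le_of_not_ge h)
    rw [← abs_neg]; convert hyz using 2; ring
  have hxy' : x ≤ y := by
    by_contra hc
    have := mul_neg_of_pos_of_neg hp (show y - x < 0 by linarith)
    linarith
  refine le_trans ?_ (le_cubicSum_of_ordered hp.le hxy' h)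
  rw [← mul_assoc, mul_comm (1 / 6), mul_assoc]
  refine mul_le_mul_of_nonneg_left ?_ (Real.sqrt_nonneg x)
  have e1 : expTest p z * Real.exp (p * (y - x)) =
      expTest p x * Real.exp (-(p * (z - y))) := by
    unfold expTest; rw [← Real.exp_add, ← Real.exp_add]; congr 1; ring
  have e2 : (1 : ℝ) / 3 ≤ Real.exp (-(p * (z - y))) := by
    have h1 : -(p * (z - y)) ≥ -1 := by
      have := (abs_le.1 hyz).1; linarith
    have h2 := Real.exp_le_exp.2 h1
    have h3 : (1 : ℝ) / 3 ≤ Real.exp (-1) := by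
      rw [Real.exp_neg, one_div]
      exact inv_anti₀ (Real.exp_pos 1) (by linarith [Real.exp_one_lt_d9])
    exact h3.trans h2
  have e3 : (4 : ℝ) ≤ Real.exp (p * (y - x)) := by
    have h1 := Real.exp_le_exp.2 hxy
    have h2 : Real.exp 2 = Real.exp 1 * Real.exp 1 := by rw [← Real.exp_add]; norm_num
    nlinarith [Real.exp_one_gt_d9]
  have e4 := Real.exp_pos (-(p * (y - x)))
  have hz := expTest_pos p z
  have hx' := expTest_pos p x
  have e5 : expTest p z * (Real.exp (p * (y - x)) / 2) ≤
      expTest p z * (Real.exp (p * (y - x)) + Real.exp (-(p * (y - x))) - 2) :=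
    mul_le_mul_of_nonneg_left (by linarith) hz.le
  have e6 := mul_le_mul_of_nonneg_left e2 hx'.le
  linarith

/-- Symmetrization over the roles of the particles of a triple: each of the three may be the one
with energy `ε₁`, the energy `ε₂` of its partner being fixed by conservation. -/
theorem three_mul_integral_cubic (hh : IsDensity γ N h) (hγ : 3 < γ) {p : ℝ} (hp : 0 ≤ p) :
    (Integrable fun q : ℝ × ℝ × ℝ => h q.1 * h q.2.1 * h q.2.2 * cubicSum p q.1 q.2.1 q.2.2) ∧
    3 * ∫ q, cubicDensity h q * balance (expTest p) q =
      ∫ q : ℝ × ℝ × ℝ, h q.1 * h q.2.1 * h q.2.2 * cubicSum p q.1 q.2.1 q.2.2 := by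
  have hφ := isTest_expTest hp
  set F : ℝ × ℝ × ℝ → ℝ := fun q => cubicDensity h q * balance (expTest p) q with hF
  have i1 : Integrable F := integrable_part hh (measurable_cubicDensity hh.meas)
    hφ.measurable_balance (cubicDensity_nonneg hh) (cubicDensity_le hh) (integrable_balance hh hγ hφ)
  have i2 := integrable_comp_equiv measurePreserving_exchangeFirst i1
  have i3 := integrable_comp_equiv measurePreserving_exchangeLast i1
  have hF' : ∀ x y z, F (x, (y, z)) = h x * h y * h z * cubicBalance p x y z := fun x y z => by
    simp only [hF, cubicDensity, cubicBalance]; ring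
  have hsum : (fun q : ℝ × ℝ × ℝ => h q.1 * h q.2.1 * h q.2.2 * cubicSum p q.1 q.2.1 q.2.2) =
      (F + fun q => F (exchangeFirst q)) + fun q => F (exchangeLast q) := by
    ext ⟨x, y, z⟩
    show _ = F (x, (y, z)) + F (y, (x, z)) + F (z, (y, x))
    rw [hF', hF', hF']
    unfold cubicSum; ring
  rw [hsum]
  refine ⟨(i1.add i2).add i3, ?_⟩
  rw [integral_add' (i1.add i2) i3, integral_add' i1 i2,
    integral_comp_equiv measurePreserving_exchangeFirst F,
    integral_comp_equiv measurePreserving_exchangeLast F]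
  ring

/-- The Laplace transform of the mass distribution. -/
noncomputable def laplace (h : ℝ → ℝ) (p : ℝ) : ℝ := ∫ x, h x * √x * expTest p x

theorem integrable_mul_expTest {g : ℝ → ℝ} (hg : Integrable g) (hg0 : ∀ x ≤ 0, g x = 0)
    {p : ℝ} (hp : 0 ≤ p) : Integrable fun x => g x * expTest p x := by
  refine hg.norm.mono' (hg.aestronglyMeasurable.mul (measurable_expTest p).aestronglyMeasurable)
    (Eventually.of_forall fun x => ?_)
  rcases le_or_gt x 0 with hx | hx
  · simp [hg0 x hx]
  · rw [norm_mul, Real.norm_eq_abs (expTest p x), abs_of_pos (expTest_pos p x)]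
    exact mul_le_of_le_one_right (norm_nonneg _) (expTest_le_one hp hx.le)

/-- The part of the mass in a short interval drives the growth of the Laplace transform. -/
theorem le_integral_cubic (hh : IsDensity γ N h) (hγ : 3 < γ) {p σ a b : ℝ} (hp : 0 < p)
    (hpσ : 4 ≤ p * σ) (hσa : σ ≤ a) (hab : p * (b - a) ≤ 1) :
    1 / 6 * ((∫ x in Iio (σ / 2), h x * √x * expTest p x) * (∫ x in Ico a b, h x) ^ 2) ≤
      3 * ∫ q, cubicDensity h q * balance (expTest p) q := by
  obtain ⟨hi, he⟩ := three_mul_integral_cubic hh hγ hp.le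
  rw [he]
  set A : ℝ → ℝ := (Iio (σ / 2)).indicator fun x => h x * √x * expTest p x with hA
  set B : ℝ → ℝ := (Ico a b).indicator h with hB
  have iA : Integrable A := (integrable_mul_expTest (hh.integrable_mul_sqrt hγ)
    (fun x hx => by simp [hh.eq_zero hx]) hp.le).indicator measurableSet_Iio
  have iB : Integrable B := (hh.integrable hγ).indicator measurableSet_Ico
  have iABB : Integrable fun q : ℝ × ℝ × ℝ => A q.1 * (B q.2.1 * B q.2.2) :=
    Integrable.mul_prod (μ := (volume : Measure ℝ)) (ν := (volume : Measure (ℝ × ℝ)))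
      (g := fun p : ℝ × ℝ => B p.1 * B p.2) iA (integrable_left_right iB iB)
  have e1 : ∫ q : ℝ × ℝ × ℝ, A q.1 * (B q.2.1 * B q.2.2) = (∫ x, A x) * (∫ x, B x) ^ 2 := by
    have := integral_prod_mul (μ := (volume : Measure ℝ)) (ν := (volume : Measure (ℝ × ℝ))) A
      (fun p : ℝ × ℝ => B p.1 * B p.2)
    rw [integral_left_right, ← sq] at this
    exact this
  have e2 : ∫ x, A x = ∫ x in Iio (σ / 2), h x * √x * expTest p x :=
    integral_indicator measurableSet_Iio
  have e3 : ∫ x, B x = ∫ x in Ico a b, h x := integral_indicator measurableSet_Ico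
  rw [← e2, ← e3, ← e1, ← integral_const_mul]
  refine integral_mono (iABB.const_mul _) hi fun q => ?_
  have hx0 := hh.nonneg q.1
  have hy0 := hh.nonneg q.2.1
  have hz0 := hh.nonneg q.2.2
  rcases le_or_gt q.1 0 with hx | hx
  · simp [hA, indicator, hh.eq_zero hx]
  rcases le_or_gt q.2.1 0 with hy | hy
  · simp [hB, indicator, hh.eq_zero hy]
  rcases le_or_gt q.2.2 0 with hz | hz
  · simp [hB, indicator, hh.eq_zero hz]
  have hnn : 0 ≤ h q.1 * h q.2.1 * h q.2.2 * cubicSum p q.1 q.2.1 q.2.2 :=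
    mul_nonneg (by positivity) (cubicSum_nonneg hp.le _ _ _)
  by_cases h1 : q.1 ∈ Iio (σ / 2)
  swap
  · simpa [hA, indicator_of_notMem h1] using hnn
  by_cases h2 : q.2.1 ∈ Ico a b
  swap
  · simpa [hB, indicator_of_notMem h2] using hnn
  by_cases h3 : q.2.2 ∈ Ico a b
  swap
  · simpa [hB, indicator_of_notMem h3] using hnn
  simp only [hA, hB, indicator_of_mem h1, indicator_of_mem h2, indicator_of_mem h3]
  have hfar : ∀ y ∈ Ico a b, 2 ≤ p * (y - q.1) := fun y hy => by
    have : σ / 2 ≤ y - q.1 := by linarith [hy.1, show q.1 < σ / 2 from h1]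
    have := mul_le_mul_of_nonneg_left this hp.le
    linarith
  have hnear : |p * (q.2.1 - q.2.2)| ≤ 1 := by
    rw [abs_mul, abs_of_pos hp]
    refine le_trans (mul_le_mul_of_nonneg_left ?_ hp.le) hab
    rw [abs_le]
    constructor <;> linarith [h2.1, h2.2, h3.1, h3.2]
  have := mul_le_mul_of_nonneg_left (le_cubicSum hp (hfar _ h2) (hfar _ h3) hnear)
    (show 0 ≤ h q.1 * h q.2.1 * h q.2.2 by positivity)
  linarith

end Parts

/-! ### Growth of the Laplace transform -/

/-- The energy moment `∫ h x^(3/2)`. -/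
noncomputable def energyMoment (h : ℝ → ℝ) : ℝ := ∫ x, h x * (x * √x)

section FixedTime

variable {γ N : ℝ} {h : ℝ → ℝ}

theorem IsDensity.energyMoment_nonneg (hh : IsDensity γ N h) : 0 ≤ energyMoment h :=
  MeasureTheory.integral_nonneg fun x => mul_nonneg (hh.nonneg x) (mul_sqrt_nonneg x)

theorem le_sqrt_add_mul_sqrt {x : ℝ} (hx : 0 ≤ x) : x ≤ √x + x * √x := by
  have h1 := Real.mul_self_sqrt hx
  have h2 := Real.sqrt_nonneg x
  nlinarith [sq_nonneg (√x - 1), mul_nonneg h2 (sq_nonneg (√x - 1))]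

theorem integral_mul_id_le_add (hh : IsDensity γ N h) (hγ : 3 < γ) :
    ∫ x, h x * x ≤ massMoment h + energyMoment h := by
  have h1 := hh.integrable_mul_sqrt hγ
  have h2 := hh.integrable_mul_mul_sqrt hγ
  unfold massMoment energyMoment
  rw [← integral_add h1 h2]
  refine integral_mono (hh.integrable_mul_id hγ) (h1.add h2) fun x => ?_
  rcases le_or_gt x 0 with hx | hx
  · simp [hh.eq_zero hx]
  · have := mul_le_mul_of_nonneg_left (le_sqrt_add_mul_sqrt hx.le) (hh.nonneg x)
    linarith

theorem integral_mul_id_expTest_le (hh : IsDensity γ N h) (hγ : 3 < γ) {p : ℝ} (hp : 0 ≤ p) :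
    ∫ x, h x * x * expTest p x ≤ laplace h p + Real.exp (-p) * energyMoment h := by
  have h1 := integrable_mul_expTest (hh.integrable_mul_sqrt hγ)
    (fun x hx => by simp [hh.eq_zero hx]) hp
  have h2 := (hh.integrable_mul_mul_sqrt hγ).const_mul (Real.exp (-p))
  have h3 := integrable_mul_expTest (hh.integrable_mul_id hγ)
    (fun x hx => by simp [hh.eq_zero hx]) hp
  unfold laplace energyMoment
  rw [← integral_const_mul, ← integral_add h1 h2]
  refine integral_mono h3 (h1.add h2) fun x => ?_
  have hx0 := hh.nonneg x
  rcases le_or_gt x 0 with hx | hx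
  · simp [hh.eq_zero hx]
  have hE := expTest_pos p x
  have hs := Real.sqrt_nonneg x
  have hxx := Real.mul_self_sqrt hx.le
  show _ ≤ h x * √x * expTest p x + Real.exp (-p) * (h x * (x * √x))
  have e0 := Real.exp_pos (-p)
  rcases le_total x 1 with h4 | h4
  · have h5 : x ≤ √x := by have := Real.sqrt_le_one.2 h4; nlinarith
    have h6 : 0 ≤ Real.exp (-p) * (h x * (x * √x)) := by positivity
    have h7 := mul_le_mul_of_nonneg_right (mul_le_mul_of_nonneg_left h5 hx0) hE.le
    linarith
  · have h5 : x ≤ x * √x := le_mul_of_one_le_right hx.le (Real.one_le_sqrt.2 h4)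
    have h6 : expTest p x ≤ Real.exp (-p) := Real.exp_le_exp.2 (by nlinarith)
    have h7 : h x * x * expTest p x ≤ h x * (x * √x) * Real.exp (-p) := by gcongr
    have h8 : 0 ≤ h x * √x * expTest p x := by positivity
    linarith

theorem laplace_nonneg (hh : IsDensity γ N h) (p : ℝ) : 0 ≤ laplace h p :=
  integral_nonneg fun x => mul_nonneg (mul_nonneg (hh.nonneg x) (Real.sqrt_nonneg x))
    (expTest_pos p x).le

theorem laplace_le_massMoment (hh : IsDensity γ N h) (hγ : 3 < γ) {p : ℝ} (hp : 0 ≤ p) :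
    laplace h p ≤ massMoment h := by
  refine integral_mono (integrable_mul_expTest (hh.integrable_mul_sqrt hγ)
    (fun x hx => by simp [hh.eq_zero hx]) hp) (hh.integrable_mul_sqrt hγ) fun x => ?_
  rcases le_or_gt x 0 with hx | hx
  · simp [hh.eq_zero hx]
  · exact mul_le_of_le_one_right (mul_nonneg (hh.nonneg x) (Real.sqrt_nonneg x))
      (expTest_le_one hp hx.le)

/-- The Laplace transform is carried by energies below `c`, up to `m e^{-pc}`. -/
theorem laplace_le_below (hh : IsDensity γ N h) (hγ : 3 < γ) {p : ℝ} (hp : 0 ≤ p) (c : ℝ) :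
    laplace h p ≤ (∫ x in Iio c, h x * √x * expTest p x) +
      Real.exp (-(p * c)) * massMoment h := by
  have h1 := integrable_mul_expTest (hh.integrable_mul_sqrt hγ)
    (fun x hx => by simp [hh.eq_zero hx]) hp
  unfold laplace massMoment
  rw [← integral_add_compl measurableSet_Iio h1, ← integral_const_mul (Real.exp (-(p * c)))]
  refine add_le_add_right ?_ _
  refine le_trans ?_ (setIntegral_le_integral (s := (Iio c)ᶜ)
    ((hh.integrable_mul_sqrt hγ).const_mul (Real.exp (-(p * c))))
    (Eventually.of_forall fun x => mul_nonneg (Real.exp_pos _).le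
      (mul_nonneg (hh.nonneg x) (Real.sqrt_nonneg x))))
  refine setIntegral_mono_on h1.integrableOn
    ((hh.integrable_mul_sqrt hγ).const_mul _).integrableOn measurableSet_Iio.compl fun x hx => ?_
  rw [mul_comm (Real.exp _)]
  refine mul_le_mul_of_nonneg_left (Real.exp_le_exp.2 ?_)
    (mul_nonneg (hh.nonneg x) (Real.sqrt_nonneg x))
  have := mul_le_mul_of_nonneg_left (not_lt.1 (show ¬ x < c from hx)) hp
  linarith

/-- The Laplace transform loses at most a bounded fraction per unit of time by quadratic
collisions, and gains by cubic collisions at the rate given by the particles in `[a, b)`. -/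
theorem le_momentRate_expTest (hh : IsDensity γ N h) (hγ : 3 < γ) {p σ a b : ℝ} (hp : 0 < p)
    (hpσ : 4 ≤ p * σ) (hσa : σ ≤ a) (hab : p * (b - a) ≤ 1) :
    -(collisionConst * ((2 * massMoment h + energyMoment h) * laplace h p +
      massMoment h * energyMoment h * Real.exp (-p))) +
    collisionConst / 18 * ((laplace h p - Real.exp (-(p * (σ / 2))) * massMoment h) *
      (∫ x in Ico a b, h x) ^ 2) ≤ momentRate h (expTest p) := by
  have hκ := collisionConst_pos
  have h1 := two_mul_momentRate hh hγ (isTest_expTest hp.le)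
  rw [integral_collisionDensity_balance hh hγ (isTest_expTest hp.le)] at h1
  have h2 := le_integral_quadDensity_balance hh hγ (isTest_expTest hp.le)
    (fun x => (expTest_pos p x).le) fun x hx => expTest_le_one hp.le hx.le
  have h3 := le_integral_cubic hh hγ hp hpσ hσa hab
  have h4 := integral_mul_id_expTest_le hh hγ hp.le
  have h5 := integral_mul_id_le_add hh hγ
  have h6 := laplace_le_below hh hγ hp.le (σ / 2)
  have h7 := laplace_nonneg hh p
  have hm := hh.massMoment_nonneg
  have h8 : (∫ x, h x * x * expTest p x) * massMoment h ≤
      (laplace h p + Real.exp (-p) * energyMoment h) * massMoment h :=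
    mul_le_mul_of_nonneg_right h4 hm
  have h9 : (∫ x, h x * √x * expTest p x) * ∫ x, h x * x ≤
      laplace h p * (massMoment h + energyMoment h) := mul_le_mul_of_nonneg_left h5 h7
  have h10 : (laplace h p - Real.exp (-(p * (σ / 2))) * massMoment h) *
      (∫ x in Ico a b, h x) ^ 2 ≤
      (∫ x in Iio (σ / 2), h x * √x * expTest p x) * (∫ x in Ico a b, h x) ^ 2 :=
    mul_le_mul_of_nonneg_right (by linarith) (sq_nonneg _)
  have h11 := mul_le_mul_of_nonneg_left h2 hκ.le
  have h12 := mul_le_mul_of_nonneg_left h3 hκ.le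
  have h13 := mul_le_mul_of_nonneg_left h10 hκ.le
  have h14 := mul_le_mul_of_nonneg_left (add_le_add h8 h9) hκ.le
  linarith

end FixedTime

/-! ### Moments along a solution -/

section Moments

variable {γ N T : ℝ} {Z : Set ℝ} {f₀ φ : ℝ → ℝ} {f : ℝ → ℝ → ℝ}

theorem integrable_moment {h : ℝ → ℝ} (hh : IsDensity γ N h) (hγ : 3 < γ) (hφ : IsTest φ) :
    Integrable fun x => h x * √x * φ x := by
  have := hφ.meas
  simp only [mul_assoc]
  refine hh.integrable_mul hγ (c := 1) (by fun_prop) fun x hx => ?_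
  rw [abs_mul, abs_of_nonneg (Real.sqrt_nonneg x), one_mul, sq]
  exact mul_le_mul (sqrt_le_one_add hx.le) (hφ.le x hx) (abs_nonneg _) (by linarith)

theorem continuous_moment (hf : IsPath γ N f) (hγ : 3 < γ) (hφ : IsTest φ) :
    Continuous fun t => ∫ x, f t x * √x * φ x := by
  refine continuous_of_dominated
    (fun t => (integrable_moment (hf.dens t) hγ hφ).aestronglyMeasurable)
    (fun t => Eventually.of_forall fun x => ?_)
    ((integrable_moment (isDensity_decay γ) hγ hφ).norm.const_mul N)
    (Eventually.of_forall fun x => ((hf.cont x).mul_const _).mul_const _)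
  rw [norm_mul, norm_mul, norm_mul, norm_mul, Real.norm_of_nonneg ((hf.dens t).nonneg x),
    Real.norm_of_nonneg (decay_nonneg γ x), ← mul_assoc, ← mul_assoc]
  have := (hf.dens t).le x
  gcongr

theorem IsSolution.ae_notMem (hf : IsSolution γ N T Z f₀ f) : ∀ᵐ e : ℝ, e ∉ Z :=
  measure_eq_zero_iff_ae_notMem.1 hf.nullZ

/-- The equation holds at almost every energy, and the rates are bounded by an integrable function
uniformly in time. -/
theorem hasDerivAt_moment (hf : IsSolution γ N T Z f₀ f) (hγ : 3 < γ) (hφ : IsTest φ) {t : ℝ}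
    (ht : t ∈ Ioo 0 T) :
    HasDerivAt (fun t => ∫ x, f t x * √x * φ x) (momentRate (f t) φ) t := by
  obtain ⟨R, hR, hRb⟩ := exists_rate_bound hγ (hf.path.dens 0).bound_nonneg
  have hφm := hφ.meas
  have key := hasDerivAt_integral_of_dominated_loc_of_deriv_le (μ := (volume : Measure ℝ))
    (F := fun t x => f t x * √x * φ x)
    (F' := fun t x => (gain (f t) x - lossRate (f t) x * f t x) * √x * φ x)
    (bound := fun x => R * (2 * decay (γ - 2) x)) (s := Ioo 0 T) (x₀ := t)
    (isOpen_Ioo.mem_nhds ht)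
    (Eventually.of_forall fun s =>
      (integrable_moment (hf.path.dens s) hγ hφ).aestronglyMeasurable)
    (integrable_moment (hf.path.dens t) hγ hφ)
    (by
      have h1 := measurable_gain (hf.path.dens t) hγ
      have h2 := measurable_lossRate (hf.path.dens t) hγ
      have h3 := (hf.path.dens t).meas
      exact Measurable.aestronglyMeasurable (by fun_prop))
    (Eventually.of_forall fun x s hs => ?_)
    (((integrable_decay (show 1 < γ - 2 by linarith)).const_mul 2).const_mul R) ?_
  · refine key.2.congr_deriv ?_
    unfold momentRate
    congr 1; ext x; ring
  · rcases le_or_gt x 0 with hx | hx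
    · simp [Real.sqrt_eq_zero_of_nonpos hx, decay_of_nonpos hx]
    have hd := hf.path.dens s
    have h1 := hRb (f s) hd x
    have h2 := gain_nonneg hd hγ x
    have h3 := mul_nonneg (lossRate_nonneg hd hγ x) (hd.nonneg x)
    have h4 : |gain (f s) x - lossRate (f s) x * f s x| ≤ R * (decay γ x * (1 + √x)) := by
      rw [abs_le]; constructor <;> linarith [h1.1, h1.2]
    rw [norm_mul, norm_mul, Real.norm_eq_abs, Real.norm_eq_abs, Real.norm_eq_abs,
      abs_of_nonneg (Real.sqrt_nonneg x)]
    calc _ ≤ R * (decay γ x * (1 + √x)) * √x * (1 + x) := by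
          have := hφ.le x hx
          have h5 : 0 ≤ R * (decay γ x * (1 + √x)) := (abs_nonneg _).trans h4
          gcongr
      _ = R * (√x * (1 + x) * (decay γ x * (1 + √x))) := by ring
      _ ≤ _ := mul_le_mul_of_nonneg_left (sqrt_mul_decay_le x hx) hR
  · filter_upwards [hf.ae_notMem] with x hx s hs
    have := (hf.deriv x hx s ⟨hs.1.le, hs.2.le⟩).hasDerivAt (Icc_mem_nhds hs.1 hs.2)
    exact (this.mul_const _).mul_const _

/-- A linear lower bound of the derivative gives an exponential lower bound. -/
theorem mul_exp_le_of_le_deriv {Y Y' : ℝ → ℝ} {a b c : ℝ} (hY : ContinuousOn Y (Icc a b))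
    (hd : ∀ t ∈ Ioo a b, HasDerivAt Y (Y' t) t) (hc : ∀ t ∈ Ioo a b, c * Y t ≤ Y' t) {t : ℝ}
    (ht : t ∈ Icc a b) : Y a * Real.exp (c * (t - a)) ≤ Y t := by
  have hE : ∀ s, HasDerivAt (fun s => Real.exp (-(c * (s - a))))
      (Real.exp (-(c * (s - a))) * -c) s := fun s => by
    have := ((((hasDerivAt_id s).sub_const a).const_mul c).neg).exp
    simpa using this
  have hG : ∀ s ∈ Ioo a b, HasDerivAt (fun s => Y s * Real.exp (-(c * (s - a))))
      (Y' s * Real.exp (-(c * (s - a))) + Y s * (Real.exp (-(c * (s - a))) * -c)) s :=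
    fun s hs => (hd s hs).mul (hE s)
  have hmono := monotoneOn_of_deriv_nonneg (convex_Icc a b)
    (hY.mul (continuous_iff_continuousAt.2 fun s => (hE s).continuousAt).continuousOn)
    (fun s hs => by
      rw [interior_Icc] at hs
      exact (hG s hs).differentiableAt.differentiableWithinAt)
    (fun s hs => by
      rw [interior_Icc] at hs
      refine le_of_le_of_eq ?_ (hG s hs).deriv.symm
      have := mul_nonneg (sub_nonneg.2 (hc s hs)) (Real.exp_pos (-(c * (s - a)))).le
      linarith)
  have h1 := hmono ⟨le_rfl, ht.1.trans ht.2⟩ ht ht.1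
  simp only [sub_self, mul_zero, neg_zero, Real.exp_zero, mul_one, Pi.mul_apply] at h1
  have h2 := mul_le_mul_of_nonneg_right h1 (Real.exp_pos (c * (t - a))).le
  rwa [mul_assoc, ← Real.exp_add, neg_add_cancel, Real.exp_zero, mul_one] at h2

theorem moment_eq_of_balance (hf : IsSolution γ N T Z f₀ f) (hγ : 3 < γ) (hφ : IsTest φ)
    (hb : ∀ q, balance φ q = 0) {t : ℝ} (ht : t ∈ Icc 0 T) :
    ∫ x, f t x * √x * φ x = ∫ x, f₀ x * √x * φ x := by
  have hc := (continuous_moment hf.path hγ hφ).continuousOn (s := Icc 0 T)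
  have hd : ∀ s ∈ Ioo 0 T, HasDerivAt (fun t => ∫ x, f t x * √x * φ x) 0 s := fun s hs => by
    have := hasDerivAt_moment hf hγ hφ hs
    rwa [momentRate_eq_zero (hf.path.dens s) hγ hφ hb] at this
  have h1 := mul_exp_le_of_le_deriv (c := 0) hc hd (fun s _ => by simp) ht
  have h2 := mul_exp_le_of_le_deriv (c := 0) hc.neg (fun s hs => (hd s hs).neg)
    (fun s _ => by simp) ht
  simp only [zero_mul, Real.exp_zero, mul_one] at h1 h2
  have h3 : ∫ x, f 0 x * √x * φ x = ∫ x, f₀ x * √x * φ x := by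
    refine integral_congr_ae ?_
    filter_upwards [hf.ae_notMem] with x hx
    rw [hf.init x hx]
  rw [← h3]
  simp only [Pi.neg_apply] at h2
  linarith

/-- Conservation of mass. -/
theorem IsSolution.massMoment_eq (hf : IsSolution γ N T Z f₀ f) (hγ : 3 < γ) {t : ℝ}
    (ht : t ∈ Icc 0 T) : massMoment (f t) = massMoment f₀ := by
  have := moment_eq_of_balance hf hγ (φ := fun _ => 1)
    ⟨measurable_const, fun x hx => by simp; linarith⟩ (fun q => by simp [balance]) ht
  simpa [massMoment] using this

/-- Conservation of energy. -/
theorem IsSolution.energyMoment_eq (hf : IsSolution γ N T Z f₀ f) (hγ : 3 < γ) {t : ℝ}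
    (ht : t ∈ Icc 0 T) : energyMoment (f t) = energyMoment f₀ := by
  have := moment_eq_of_balance hf hγ (φ := fun x => x)
    ⟨measurable_id, fun x hx => by rw [abs_of_pos hx]; linarith⟩
    (fun q => by unfold balance; ring) ht
  unfold energyMoment
  simpa only [mul_assoc, mul_comm (√_)] using this

end Moments

/-! ### Concentration of mass at low energies -/

section Below

variable {γ N : ℝ} {h : ℝ → ℝ}

theorem IsDensity.massBelow_eq_Iic (hh : IsDensity γ N h) (R : ℝ) :
    massBelow h R = ∫ x in Iic R, h x * √x := by
  unfold massBelow
  refine (setIntegral_eq_of_subset_of_forall_sdiff_eq_zero measurableSet_Iic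
    Ioc_subset_Iic_self fun x hx => ?_).symm
  have : x ≤ 0 := by
    by_contra hx0
    exact hx.2 ⟨not_le.1 hx0, hx.1⟩
  simp [hh.eq_zero this]

theorem IsDensity.exp_mul_massBelow_le (hh : IsDensity γ N h) (hγ : 3 < γ) {p R : ℝ}
    (hp : 0 ≤ p) : Real.exp (-(p * R)) * massBelow h R ≤ laplace h p := by
  have hi := integrable_mul_expTest (hh.integrable_mul_sqrt hγ)
    (fun x hx => by simp [hh.eq_zero hx]) hp
  have h0 : ∀ x, 0 ≤ h x * √x := fun x => mul_nonneg (hh.nonneg x) (Real.sqrt_nonneg x)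
  refine le_trans ?_ (setIntegral_le_integral (s := Ioc 0 R) hi
    (Eventually.of_forall fun x => mul_nonneg (h0 x) (expTest_pos p x).le))
  unfold massBelow
  rw [← integral_const_mul]
  refine setIntegral_mono_on ((hh.integrable_mul_sqrt hγ).const_mul _).integrableOn
    hi.integrableOn measurableSet_Ioc fun x hx => ?_
  rw [mul_comm]
  refine mul_le_mul_of_nonneg_left (Real.exp_le_exp.2 ?_) (h0 x)
  have := mul_le_mul_of_nonneg_left hx.2 hp
  linarith

theorem IsDensity.laplace_le_massBelow (hh : IsDensity γ N h) (hγ : 3 < γ) {p R : ℝ}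
    (hp : 0 ≤ p) : laplace h p ≤ massBelow h R + Real.exp (-(p * R)) * massMoment h := by
  have hi := integrable_mul_expTest (hh.integrable_mul_sqrt hγ)
    (fun x hx => by simp [hh.eq_zero hx]) hp
  refine (laplace_le_below hh hγ hp R).trans (add_le_add_left ?_ _)
  rw [hh.massBelow_eq_Iic, integral_Iic_eq_integral_Iio]
  refine integral_mono hi.integrableOn (hh.integrable_mul_sqrt hγ).integrableOn fun x => ?_
  rcases le_or_gt x 0 with hx | hx
  · simp [hh.eq_zero hx]
  · exact mul_le_of_le_one_right (mul_nonneg (hh.nonneg x) (Real.sqrt_nonneg x))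
      (expTest_le_one hp hx.le)

/-- Among `n` adjacent intervals of length `r`, one carries at least the average. -/
theorem exists_interval_ge {h : ℝ → ℝ} (hi : Integrable h) (a r : ℝ) (hr : 0 ≤ r) {n : ℕ}
    (hn : 0 < n) : ∃ k : ℕ, (∫ x in a..a + n * r, h x) / n ≤
      ∫ x in Ico (a + k * r) (a + k * r + r), h x := by
  have h1 := intervalIntegral.sum_integral_adjacent_intervals (μ := volume) (f := h)
    (a := fun k : ℕ => a + k * r) (n := n) fun k _ => hi.intervalIntegrable
  simp only [CharP.cast_eq_zero, zero_mul, add_zero] at h1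
  obtain ⟨k, _, hk⟩ := Finset.exists_le_of_sum_le (s := Finset.range n)
    (f := fun _ => (∫ x in a..a + n * r, h x) / n)
    (g := fun k : ℕ => ∫ x in (a + k * r)..(a + (k + 1 : ℕ) * r), h x)
    ⟨0, Finset.mem_range.2 hn⟩ (by
      rw [h1, Finset.sum_const, Finset.card_range, nsmul_eq_mul,
        mul_div_cancel₀ _ (by positivity)])
  refine ⟨k, hk.trans_eq ?_⟩
  have e : a + ((k + 1 : ℕ) : ℝ) * r = a + k * r + r := by push_cast; ring
  rw [e, intervalIntegral.integral_of_le (by linarith), integral_Ico_eq_integral_Ioc]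

/-- A lower bound for the number of particles in some short interval, from the mass in a
layer `(a, Λ]`. -/
theorem IsDensity.exists_interval_sq_ge (hh : IsDensity γ N h) (hγ : 3 < γ) {a Λ r μ : ℝ}
    (ha : 0 < a) (haΛ : a < Λ) (hr : 0 < r) (hrΛ : r ≤ Λ) (hμ : 0 ≤ μ)
    (hm : μ ≤ massBelow h Λ - massBelow h a) :
    ∃ b, a ≤ b ∧ μ ^ 2 * r ^ 2 / (4 * Λ ^ 3) ≤ (∫ x in Ico b (b + r), h x) ^ 2 := by
  have hΛ : 0 < Λ := ha.trans haΛ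
  have hi := hh.integrable (by linarith)
  set n := ⌈Λ / r⌉₊ with hndef
  have hn : 0 < n := Nat.ceil_pos.2 (by positivity)
  have hn1 : Λ ≤ n * r := (div_le_iff₀ hr).1 (Nat.le_ceil _)
  have hn2 : (n : ℝ) * r ≤ 2 * Λ := by
    have h1 : (n : ℝ) < Λ / r + 1 := Nat.ceil_lt_add_one (by positivity)
    have h2 := mul_lt_mul_of_pos_right h1 hr
    rw [add_mul, div_mul_cancel₀ _ hr.ne'] at h2
    linarith
  have hn0 : (0 : ℝ) < n := by exact_mod_cast hn
  obtain ⟨k, hk⟩ := exists_interval_ge hi a r hr.le hn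
  refine ⟨a + k * r, by have : 0 ≤ (k : ℝ) * r := by positivity
                        linarith, ?_⟩
  have h1 : μ ≤ √Λ * ∫ x in a..a + n * r, h x := by
    refine hm.trans ?_
    have h2 : massBelow h Λ - massBelow h a = ∫ x in Ioc a Λ, h x * √x := by
      have hj := hh.integrable_mul_sqrt hγ
      have := intervalIntegral.integral_add_adjacent_intervals (μ := volume)
        (f := fun x => h x * √x) (a := 0) (b := a) (c := Λ) hj.intervalIntegrable
        hj.intervalIntegrable
      rw [intervalIntegral.integral_of_le ha.le, intervalIntegral.integral_of_le haΛ.le,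
        intervalIntegral.integral_of_le hΛ.le] at this
      unfold massBelow
      linarith
    rw [h2, intervalIntegral.integral_of_le (by linarith), ← integral_const_mul]
    refine (setIntegral_mono_on (g := fun x => √Λ * h x)
      (hh.integrable_mul_sqrt hγ).integrableOn (hi.const_mul _).integrableOn
      measurableSet_Ioc fun x hx => ?_).trans ?_
    · rw [mul_comm]
      exact mul_le_mul_of_nonneg_right (Real.sqrt_le_sqrt hx.2) (hh.nonneg x)
    · refine setIntegral_mono_set (hi.const_mul _).integrableOn
        (Eventually.of_forall fun x => mul_nonneg (Real.sqrt_nonneg _) (hh.nonneg x))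
        (LE.le.eventuallyLE (Ioc_subset_Ioc_right (by linarith)))
  set I := ∫ x in a..a + n * r, h x
  set J := ∫ x in Ico (a + k * r) (a + k * r + r), h x
  have hsΛ := Real.mul_self_sqrt hΛ.le
  have hs0 := Real.sqrt_pos.2 hΛ
  have h3 : I ≤ J * n := (div_le_iff₀ hn0).1 hk
  have hJ : 0 ≤ J := setIntegral_nonneg measurableSet_Ico fun x _ => hh.nonneg x
  -- `n r ≤ 2 Λ` turns the average over the intervals into a bound without `n`
  have h4 : μ * r ≤ √Λ * J * (2 * Λ) := by
    calc μ * r ≤ √Λ * (J * n) * r :=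
          mul_le_mul_of_nonneg_right (h1.trans (mul_le_mul_of_nonneg_left h3 hs0.le)) hr.le
      _ = √Λ * J * (n * r) := by ring
      _ ≤ _ := mul_le_mul_of_nonneg_left hn2 (by positivity)
  rw [div_le_iff₀ (by positivity)]
  calc μ ^ 2 * r ^ 2 = (μ * r) ^ 2 := by ring
    _ ≤ (√Λ * J * (2 * Λ)) ^ 2 := pow_le_pow_left₀ (by positivity) h4 2
    _ = (√Λ * √Λ) * J ^ 2 * (4 * Λ ^ 2) := by ring
    _ = _ := by rw [hsΛ]; ring

end Below

/-! ### Persistence and growth of the Laplace transform along a solution -/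

section Along

variable {γ N T : ℝ} {Z : Set ℝ} {f₀ : ℝ → ℝ} {f : ℝ → ℝ → ℝ}

/-- The rate at which quadratic collisions can deplete the low energies. -/
noncomputable def depletionRate (m e : ℝ) : ℝ := collisionConst * (2 * m + e)

theorem continuous_laplace (hf : IsPath γ N f) (hγ : 3 < γ) {p : ℝ} (hp : 0 ≤ p) :
    Continuous fun t => laplace (f t) p :=
  continuous_moment hf hγ (isTest_expTest hp)

/-- Persistence: within a unit of time quadratic collisions remove at most a fixed fraction of the
Laplace transform, up to an error `e^{-p}`, and cubic collisions never lower it. -/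
theorem IsSolution.exp_mul_laplace_le (hf : IsSolution γ N T Z f₀ f) (hγ : 3 < γ)
    (hm : 0 < massMoment f₀) {p : ℝ} (hp : 0 < p) {t₀ t : ℝ} (h0 : 0 ≤ t₀) (h01 : t₀ ≤ t)
    (htT : t ≤ T) (ht1 : t ≤ t₀ + 1) :
    Real.exp (-depletionRate (massMoment f₀) (energyMoment f₀)) * laplace (f t₀) p ≤
      laplace (f t) p + Real.exp (-p) * massMoment f₀ := by
  set m := massMoment f₀
  set e := energyMoment f₀
  have he : 0 ≤ e := by
    have h1 := hf.energyMoment_eq hγ (t := t₀) ⟨h0, h01.trans htT⟩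
    have h2 := (hf.path.dens t₀).energyMoment_nonneg
    linarith
  have hκ := collisionConst_pos
  have hA : 0 ≤ depletionRate m e := by unfold depletionRate; positivity
  -- the inhomogeneous term is absorbed by a constant shift of the Laplace transform
  set c := m * e / (2 * m + e)
  have hc0 : 0 ≤ c := by positivity
  have hcm : c ≤ m := by
    rw [div_le_iff₀ (by positivity)]; nlinarith
  have hce : c * (2 * m + e) = m * e := div_mul_cancel₀ _ (by positivity)
  have key := mul_exp_le_of_le_deriv (Y := fun t => laplace (f t) p + c * Real.exp (-p))
    (Y' := fun t => momentRate (f t) (expTest p)) (a := t₀) (b := t)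
    (c := -depletionRate m e)
    ((continuous_laplace hf.path hγ hp.le).add continuous_const).continuousOn
    (fun s hs => (hasDerivAt_moment hf hγ (isTest_expTest hp.le)
      ⟨h0.trans_lt hs.1, hs.2.trans_le htT⟩).add_const _)
    (fun s hs => by
      have hsT : s ∈ Icc 0 T := ⟨h0.trans hs.1.le, hs.2.le.trans htT⟩
      have h1 := le_momentRate_expTest (hf.path.dens s) hγ (p := p) (σ := 4 / p) (a := 4 / p)
        (b := 4 / p) hp (by rw [mul_div_cancel₀ _ hp.ne']) le_rfl (by simp)
      rw [hf.massMoment_eq hγ hsT, hf.energyMoment_eq hγ hsT] at h1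
      simp only [Ico_self, Measure.restrict_empty, integral_zero_measure] at h1
      refine le_trans (le_of_eq ?_) h1
      show -(collisionConst * (2 * m + e)) * (laplace (f s) p + c * Real.exp (-p)) =
        -(collisionConst * ((2 * m + e) * laplace (f s) p + m * e * Real.exp (-p))) + _
      rw [← hce]; ring)
    (t := t) ⟨h01, le_rfl⟩
  have hE : Real.exp (-depletionRate m e) ≤ Real.exp (-depletionRate m e * (t - t₀)) :=
    Real.exp_le_exp.2 (by nlinarith)
  have hep := Real.exp_pos (-p)
  have hL := laplace_nonneg (hf.path.dens t₀) p
  have hE0 := Real.exp_pos (-depletionRate m e)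
  have h2 : laplace (f t₀) p * Real.exp (-depletionRate m e) ≤
      (laplace (f t₀) p + c * Real.exp (-p)) * Real.exp (-depletionRate m e * (t - t₀)) := by
    refine mul_le_mul ?_ hE hE0.le (by positivity)
    have : 0 ≤ c * Real.exp (-p) := by positivity
    linarith
  have h3 : c * Real.exp (-p) ≤ m * Real.exp (-p) := mul_le_mul_of_nonneg_right hcm hep.le
  linarith

/-- If at all times some interval of length `1/p` carries many particles, then the Laplace
transform grows exponentially. -/
theorem IsSolution.laplace_mul_exp_le (hf : IsSolution γ N T Z f₀ f) (hγ : 3 < γ) {p σ Q : ℝ}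
    (hp : 0 < p) (hpσ : 4 ≤ p * σ) {t₀ t : ℝ} (h0 : 0 ≤ t₀) (h01 : t₀ ≤ t) (htT : t ≤ T)
    (hX : ∀ s ∈ Icc t₀ t, 2 * (Real.exp (-(p * (σ / 2))) * massMoment f₀) ≤ laplace (f s) p)
    (hX' : ∀ s ∈ Icc t₀ t, Real.exp (-p) * massMoment f₀ ≤ laplace (f s) p)
    (hQ : ∀ s ∈ Icc t₀ t, ∃ b, σ ≤ b ∧ Q ≤ (∫ x in Ico b (b + 1 / p), f s x) ^ 2) :
    laplace (f t₀) p * Real.exp (collisionConst *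
      (Q / 36 - 2 * (massMoment f₀ + energyMoment f₀)) * (t - t₀)) ≤ massMoment f₀ := by
  have hκ := collisionConst_pos
  have key := mul_exp_le_of_le_deriv (Y := fun t => laplace (f t) p)
    (Y' := fun t => momentRate (f t) (expTest p)) (a := t₀) (b := t)
    (c := collisionConst * (Q / 36 - 2 * (massMoment f₀ + energyMoment f₀)))
    (continuous_laplace hf.path hγ hp.le).continuousOn
    (fun s hs => hasDerivAt_moment hf hγ (isTest_expTest hp.le)
      ⟨h0.trans_lt hs.1, hs.2.trans_le htT⟩)
    (fun s hs => by
      have hs' : s ∈ Icc t₀ t := ⟨hs.1.le, hs.2.le⟩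
      have hsT : s ∈ Icc 0 T := ⟨h0.trans hs.1.le, hs.2.le.trans htT⟩
      obtain ⟨b, hb, hbQ⟩ := hQ s hs'
      have h1 := le_momentRate_expTest (hf.path.dens s) hγ (p := p) (σ := σ) (a := b)
        (b := b + 1 / p) hp hpσ hb (by field_simp; linarith)
      have he := (hf.path.dens s).energyMoment_nonneg
      rw [hf.massMoment_eq hγ hsT] at h1
      rw [hf.energyMoment_eq hγ hsT] at h1 he
      have hx := hX s hs'
      have hx' := hX' s hs'
      set X := laplace (f s) p
      have hX0 : 0 ≤ X := laplace_nonneg (hf.path.dens s) p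
      set J := (∫ x in Ico b (b + 1 / p), f s x) ^ 2
      have h2 : X / 2 * Q ≤
          (X - Real.exp (-(p * (σ / 2))) * massMoment f₀) * J := by
        calc X / 2 * Q ≤ X / 2 * J := mul_le_mul_of_nonneg_left hbQ (by positivity)
          _ ≤ _ := mul_le_mul_of_nonneg_right (by linarith) (sq_nonneg _)
      have h3 := mul_le_mul_of_nonneg_left hx' he
      have h4 := mul_le_mul_of_nonneg_left h2 hκ.le
      have h5 := mul_le_mul_of_nonneg_left h3 hκ.le
      refine le_trans (le_of_eq ?_) (le_trans (add_le_add (neg_le_neg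
        (mul_le_mul_of_nonneg_left (add_le_add_right (?_ :
          massMoment f₀ * energyMoment f₀ * Real.exp (-p) ≤ energyMoment f₀ * X) _) hκ.le))
        (?_ : collisionConst / 18 * (X / 2 * Q) ≤ _)) h1)
      · ring
      · linarith
      · exact mul_le_mul_of_nonneg_left h2 (by positivity))
    (t := t) ⟨h01, le_rfl⟩
  refine key.trans ?_
  have := laplace_le_massMoment (hf.path.dens t) hγ hp.le
  rwa [hf.massMoment_eq hγ ⟨h0.trans h01, htT⟩] at this

end Along

/-! ### The cascade of concentration scales -/

/-- The ratio between consecutive values of the concentrated mass. The factor `e^{-depletionRate}`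
is the persistence of the Laplace transform, `e^{-1}` its comparison with the mass below `1 / p`. -/
noncomputable def cascadeRatio (m e : ℝ) : ℝ := Real.exp (-depletionRate m e - 1) / 4

theorem cascadeRatio_pos (m e : ℝ) : 0 < cascadeRatio m e := by
  unfold cascadeRatio; positivity

theorem cascadeRatio_le {m e : ℝ} (hm : 0 ≤ m) (he : 0 ≤ e) : cascadeRatio m e ≤ 1 / 4 := by
  have : Real.exp (-depletionRate m e - 1) ≤ 1 := Real.exp_le_one_iff.2 (by
    have := collisionConst_pos
    have : 0 ≤ depletionRate m e := by unfold depletionRate; positivity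
    linarith)
  unfold cascadeRatio
  linarith

/-- The scales `s` that are small enough for one step of the cascade: a mass `s` below the
energy `s^20` is forwarded, within the time `s^10`, to a mass `ω s` below the energy
`(ω s)^20`, where `ω` is `cascadeRatio m e`. The fields ensure that exponentially small terms are
negligible against powers of `s`, that the layer above `(ω s)^20` is far above the energies `s^21`
that are resolved by the Laplace transform (`separate`), and that growth of the latter beats
depletion (`dominate`) and exceeds the total mass within the time `s^10` (`grow`). -/
structure SmallScale (m e ν s : ℝ) : Prop where
  pos : 0 < s
  le_half : s ≤ 1 / 2
  persist : 2 * m * Real.exp (-(1 / s)) ≤ 2 * cascadeRatio m e * s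
  separate : 4 * s ≤ cascadeRatio m e ^ 20
  seed : 2 * m * Real.exp (-(cascadeRatio m e ^ 20 / 2 / s)) ≤ cascadeRatio m e * ν * s ^ 32
  dominate : 576 * (m + e) * s ≤ cascadeRatio m e ^ 2
  grow : 2 * m * Real.exp (-(collisionConst * cascadeRatio m e ^ 2 / 288 / s)) ≤
    cascadeRatio m e * ν * s ^ 32

theorem eventually_exp_neg_le_pow {b C : ℝ} (hb : 0 < b) (hC : 0 < C) (k : ℕ) (D : ℝ) :
    ∀ᶠ s in 𝓝[>] (0 : ℝ), D * Real.exp (-(b / s)) ≤ C * s ^ k := by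
  have h1 : Tendsto (fun s : ℝ => b / s) (𝓝[>] 0) atTop := by
    simp only [div_eq_mul_inv]
    exact tendsto_inv_nhdsGT_zero.const_mul_atTop hb
  have h2 := ((Real.tendsto_pow_mul_exp_neg_atTop_nhds_zero k).comp h1).const_mul D
  rw [mul_zero] at h2
  have h3 : (0 : ℝ) < C * b ^ k := by positivity
  filter_upwards [h2.eventually_le_const h3, self_mem_nhdsWithin] with s hs hs0
  have hs0 : 0 < s := hs0
  simp only [Function.comp_apply] at hs
  rw [div_pow] at hs
  have h4 : D * Real.exp (-(b / s)) * b ^ k ≤ C * s ^ k * b ^ k := by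
    have h5 := mul_le_mul_of_nonneg_right hs (pow_pos hs0 k).le
    calc _ = D * (b ^ k / s ^ k * Real.exp (-(b / s))) * s ^ k := by field_simp
      _ ≤ _ := h5
      _ = _ := by ring
  exact le_of_mul_le_mul_right h4 (pow_pos hb k)

theorem exists_smallScale (m e : ℝ) {ν : ℝ} (hν : 0 < ν) :
    ∃ s₁ : ℝ, 0 < s₁ ∧ ∀ s, 0 < s → s ≤ s₁ → SmallScale m e ν s := by
  have hω := cascadeRatio_pos m e
  have hκ := collisionConst_pos
  have small : ∀ {C : ℝ} (D : ℝ), 0 < C → ∀ᶠ s in 𝓝[>] (0 : ℝ), D * s ≤ C := by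
    intro C D hC
    have h : Tendsto (fun s : ℝ => D * s) (𝓝[>] 0) (𝓝 (D * 0)) :=
      ((continuous_const.mul continuous_id).tendsto 0).mono_left nhdsWithin_le_nhds
    rw [mul_zero] at h
    exact h.eventually_le_const hC
  have key : ∀ᶠ s in 𝓝[>] (0 : ℝ), SmallScale m e ν s := by
    filter_upwards [self_mem_nhdsWithin, small 1 (show (0 : ℝ) < 1 / 2 by norm_num),
      eventually_exp_neg_le_pow one_pos (show 0 < 2 * cascadeRatio m e by positivity) 1 (2 * m),
      small 4 (pow_pos hω 20),
      eventually_exp_neg_le_pow (show 0 < cascadeRatio m e ^ 20 / 2 by positivity)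
        (show 0 < cascadeRatio m e * ν by positivity) 32 (2 * m),
      small (576 * (m + e)) (pow_pos hω 2),
      eventually_exp_neg_le_pow
        (show 0 < collisionConst * cascadeRatio m e ^ 2 / 288 by positivity)
        (show 0 < cascadeRatio m e * ν by positivity) 32 (2 * m)] with s h1 h2 h3 h4 h5 h6 h7
    exact ⟨h1, by linarith, by simpa using h3, h4, h5, h6, h7⟩
  obtain ⟨s₁, h1, h2⟩ := mem_nhdsGT_iff_exists_Ioc_subset.1 key
  exact ⟨s₁, h1, fun s hs hs1 => h2 ⟨hs, hs1⟩⟩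

section Cascade

variable {γ N T ν : ℝ} {Z : Set ℝ} {f₀ : ℝ → ℝ} {f : ℝ → ℝ → ℝ}

/-- One step of the cascade. If the concentrated mass did not move on to the smaller scale, it
would stay in the layer between `(ω s)^20` and `s^19`, and collisions of triples of particles
with two members in that layer would feed the lowest energies at an exponential rate that
exceeds what the total mass permits. -/
theorem IsSolution.cascade_step (hf : IsSolution γ N T Z f₀ f) (hγ : 3 < γ)
    (hm : 0 < massMoment f₀) {s : ℝ} (hs : SmallScale (massMoment f₀) (energyMoment f₀) ν s)
    (hseed : ν / 2 * s ^ 32 ≤ massBelow f₀ (s ^ 21)) {t₀ : ℝ} (h0 : 0 ≤ t₀)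
    (hT : t₀ + s ^ 10 ≤ T) (ht1 : t₀ + s ^ 10 ≤ 1) (hmass : s ≤ massBelow (f t₀) (s ^ 20)) :
    ∃ t ∈ Icc t₀ (t₀ + s ^ 10),
      cascadeRatio (massMoment f₀) (energyMoment f₀) * s ≤
        massBelow (f t) ((cascadeRatio (massMoment f₀) (energyMoment f₀) * s) ^ 20) := by
  set m := massMoment f₀ with hmdef
  set e := energyMoment f₀ with hedef
  set ω := cascadeRatio m e with hωdef
  have hs0 := hs.pos
  have hω : 0 < ω := cascadeRatio_pos m e
  have h4ω : Real.exp (-depletionRate m e) * Real.exp (-1) = 4 * ω := by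
    rw [hωdef, cascadeRatio, ← Real.exp_add, ← sub_eq_add_neg]; ring
  have hpow : ∀ k : ℕ, s ^ (k + 1) ≤ s := fun k =>
    pow_le_of_le_one hs0.le (hs.le_half.trans (by norm_num)) k.succ_ne_zero
  have htT : ∀ t ∈ Icc t₀ (t₀ + s ^ 10), t ∈ Icc 0 T := fun t ht =>
    ⟨h0.trans ht.1, ht.2.trans hT⟩
  by_contra hcon
  push Not at hcon
  -- the mass below `s^19` persists
  have hlayer : ∀ t ∈ Icc t₀ (t₀ + s ^ 10), 2 * ω * s ≤ massBelow (f t) (s ^ 19) := by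
    intro t ht
    have hp : 0 < 1 / s ^ 20 := by positivity
    have h1 := hf.exp_mul_laplace_le hγ hm hp h0 ht.1 (htT t ht).2
      (ht.2.trans (by have := pow_le_one₀ (n := 10) hs0.le
                        (hs.le_half.trans (by norm_num)); linarith))
    have h2 := (hf.path.dens t₀).exp_mul_massBelow_le hγ (R := s ^ 20) hp.le
    have h3 := (hf.path.dens t).laplace_le_massBelow hγ (R := s ^ 19) hp.le
    rw [hf.massMoment_eq hγ (htT t ht)] at h3
    rw [one_div_mul_cancel (by positivity)] at h2
    have e3 : 1 / s ^ 20 * s ^ 19 = 1 / s := by field_simp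
    rw [e3] at h3
    have h4 : Real.exp (-(1 / s ^ 20)) ≤ Real.exp (-(1 / s)) :=
      Real.exp_le_exp.2 (neg_le_neg (one_div_le_one_div_of_le (by positivity) (hpow 19)))
    have h5 := mul_le_mul_of_nonneg_right h4 hm.le
    have h6 := mul_le_mul_of_nonneg_left
      ((mul_le_mul_of_nonneg_left hmass (Real.exp_pos (-1)).le).trans h2)
      (Real.exp_pos (-depletionRate m e)).le
    rw [← mul_assoc, h4ω] at h6
    have h7 := hs.persist
    simp only [← hmdef, ← hedef] at h1 h3 h5 h6 h7 ⊢
    linarith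
  -- the Laplace variable that resolves the energies below `s ^ 21`
  set p := 1 / s ^ 21 with hpdef
  have hp : 0 < p := by positivity
  have hps : 1 / s ≤ p := one_div_le_one_div_of_le (by positivity) (hpow 20)
  have hpσ : p * (ω * s) ^ 20 = ω ^ 20 / s := by rw [hpdef, mul_pow]; field_simp
  have hω20 : ω ^ 20 ≤ 1 := by
    refine pow_le_one₀ hω.le ((cascadeRatio_le hm.le ?_).trans (by norm_num))
    have h1 := hf.energyMoment_eq hγ (t := t₀) (htT t₀ ⟨le_rfl, by linarith [pow_pos hs0 10]⟩)
    rw [hedef, ← h1]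
    exact (hf.path.dens t₀).energyMoment_nonneg
  have hcmp : ω ^ 20 / 2 / s ≤ p :=
    (div_le_div_of_nonneg_right (by linarith) hs0.le).trans hps
  have hexp : Real.exp (-p) ≤ Real.exp (-(ω ^ 20 / 2 / s)) :=
    Real.exp_le_exp.2 (neg_le_neg hcmp)
  have hseed' := hs.seed
  -- the seed at the lowest energies persists
  have hX : ∀ t ∈ Icc t₀ (t₀ + s ^ 10), ω * ν * s ^ 32 ≤ laplace (f t) p := by
    intro t ht
    have h1 := hf.exp_mul_laplace_le hγ hm hp le_rfl (htT t ht).1 (htT t ht).2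
      (by linarith [ht.2])
    have h2 := (hf.path.dens 0).exp_mul_massBelow_le hγ (R := s ^ 21) hp.le
    rw [hpdef, one_div_mul_cancel (by positivity), ← hpdef] at h2
    have h3 : massBelow (f 0) (s ^ 21) = massBelow f₀ (s ^ 21) := by
      refine integral_congr_ae (ae_restrict_of_ae ?_)
      filter_upwards [hf.ae_notMem] with x hx
      rw [hf.init x hx]
    rw [h3] at h2
    have h6 := mul_le_mul_of_nonneg_left
      ((mul_le_mul_of_nonneg_left hseed (Real.exp_pos (-1)).le).trans h2)
      (Real.exp_pos (-depletionRate m e)).le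
    rw [← mul_assoc, h4ω] at h6
    have h7 := mul_le_mul_of_nonneg_left hexp hm.le
    simp only [← hmdef, ← hedef] at h1 h6 h7 hseed' ⊢
    linarith [Real.exp_pos (-p), mul_nonneg hm.le (Real.exp_pos (-p)).le]
  have hωs : ω * s < 1 := by
    have h1 := pow_pos hω 20
    have h2 := hs.separate
    have : ω ≤ 1 := by
      by_contra h
      exact absurd hω20 (not_le.2 (one_lt_pow₀ (not_le.1 h) (by norm_num)))
    have := hs.le_half
    nlinarith
  have hscale : (ω * s) ^ 20 < s ^ 19 := by
    have h1 : (ω * s) ^ 20 = ω ^ 20 * s * s ^ 19 := by ring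
    rw [h1]
    have h2 : ω ^ 20 * s < 1 := by
      have := hs.le_half
      nlinarith
    exact mul_lt_of_lt_one_left (by positivity) h2
  -- an interval of length `s ^ 21` in the layer carries about `ω s · s ^ 21 / (s ^ 19) ^ (3/2)`
  -- particles, whose square is of order `s ^ (-13)`
  have hgrow := hf.laplace_mul_exp_le hγ (p := p) (σ := (ω * s) ^ 20)
    (Q := ω ^ 2 / (4 * s ^ 13)) hp
    (by rw [hpσ, le_div_iff₀ hs0]; exact hs.separate) h0
    (show t₀ ≤ t₀ + s ^ 10 by linarith [pow_pos hs0 10]) hT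
    (fun t ht => by
      have e1 : p * ((ω * s) ^ 20 / 2) = ω ^ 20 / 2 / s := by
        rw [mul_div_assoc', hpσ]; ring
      rw [e1]
      have := hX t ht
      linarith)
    (fun t ht => by
      have h1 := hX t ht
      have h7 := mul_le_mul_of_nonneg_left hexp hm.le
      have : 0 ≤ m * Real.exp (-(ω ^ 20 / 2 / s)) := by positivity
      linarith)
    (fun t ht => by
      obtain ⟨b, hb1, hb2⟩ := (hf.path.dens t).exists_interval_sq_ge hγ (a := (ω * s) ^ 20)
        (Λ := s ^ 19) (r := s ^ 21) (μ := ω * s) (by positivity) hscale (by positivity)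
        (pow_le_pow_of_le_one hs0.le (hs.le_half.trans (by norm_num)) (by norm_num))
        (by positivity) (by have h1 := hlayer t ht
                            have h2 := hcon t ht
                            linarith)
      refine ⟨b, hb1, ?_⟩
      rw [show 1 / p = s ^ 21 by rw [hpdef, one_div_one_div]]
      refine le_of_eq_of_le ?_ hb2
      field_simp)
  have hκ := collisionConst_pos
  -- rate times duration is of order `s ^ (-3)`, which amplifies the seed beyond the total mass
  have h1 : collisionConst * ω ^ 2 / 288 / s ≤ collisionConst *
      (ω ^ 2 / (4 * s ^ 13) / 36 - 2 * (m + e)) * (t₀ + s ^ 10 - t₀) := by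
    have h2 : 2 * (m + e) ≤ ω ^ 2 / (288 * s ^ 13) := by
      rw [le_div_iff₀ (by positivity)]
      have h3 : 576 * (m + e) * s ≤ ω ^ 2 := hs.dominate
      rcases le_or_gt (m + e) 0 with h4 | h4
      · have : 2 * (m + e) * (288 * s ^ 13) ≤ 0 :=
          mul_nonpos_of_nonpos_of_nonneg (by linarith) (by positivity)
        linarith [sq_nonneg ω]
      · have : (m + e) * s ^ 13 ≤ (m + e) * s := mul_le_mul_of_nonneg_left (hpow 12) h4.le
        linarith
    have h5 : ω ^ 2 / (4 * s ^ 13) / 36 - 2 * (m + e) ≥ ω ^ 2 / (288 * s ^ 13) := by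
      have : ω ^ 2 / (4 * s ^ 13) / 36 = 2 * (ω ^ 2 / (288 * s ^ 13)) := by field_simp; norm_num
      linarith
    rw [add_sub_cancel_left]
    calc collisionConst * ω ^ 2 / 288 / s ≤ collisionConst * ω ^ 2 / 288 / s ^ 3 :=
          div_le_div_of_nonneg_left (by positivity) (by positivity) (hpow 2)
      _ = collisionConst * (ω ^ 2 / (288 * s ^ 13)) * s ^ 10 := by field_simp
      _ ≤ _ := by gcongr
  have h2 := hs.grow
  have h3 := hX t₀ ⟨le_rfl, by linarith [pow_pos hs0 10]⟩
  have h4 := (mul_le_mul h3 (Real.exp_le_exp.2 h1) (Real.exp_pos _).le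
    (laplace_nonneg (hf.path.dens t₀) p)).trans hgrow
  have h5 := mul_le_mul_of_nonneg_right h2
    (Real.exp_pos (collisionConst * ω ^ 2 / 288 / s)).le
  rw [mul_assoc (2 * m), ← Real.exp_add, neg_add_cancel, Real.exp_zero] at h5
  linarith

theorem IsDensity.massBelow_le (hh : IsDensity γ N f₀) (hγ : 3 < γ) {R : ℝ} (hR : 0 ≤ R) :
    massBelow f₀ R ≤ N * (R * √R) := by
  have hN := hh.bound_nonneg
  unfold massBelow
  have h1 : ∫ x in Ioc 0 R, f₀ x * √x ≤ ∫ x in Ioc 0 R, N * √R := by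
    refine setIntegral_mono_on (hh.integrable_mul_sqrt hγ).integrableOn
      (integrableOn_const (by simp)) measurableSet_Ioc fun x hx => ?_
    refine mul_le_mul ((hh.le x).trans ?_) (Real.sqrt_le_sqrt hx.2) (Real.sqrt_nonneg x) hN
    exact mul_le_of_le_one_right hN (decay_le_one (by linarith) x)
  refine h1.trans_eq ?_
  simp [hR]
  ring

/-- A solution with sufficiently concentrated initial datum does not exist up to the time
`1/2`: the scales of the cascade accumulate, and a bounded density cannot carry a mass `s` below
the energy `s^20` for arbitrarily small `s`. -/
theorem IsSolution.lt_half (hf : IsSolution γ N T Z f₀ f) (hγ : 3 < γ)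
    (hm : 0 < massMoment f₀) {s : ℝ} (hs0 : 0 < s)
    (hs : ∀ s', 0 < s' → s' ≤ s → SmallScale (massMoment f₀) (energyMoment f₀) ν s')
    (hν : 0 ≤ ν) (hseed : ∀ R, 0 < R → R ≤ s ^ 20 → ν / 2 * (R * √R) ≤ massBelow f₀ R)
    (hmass : s ≤ massBelow f₀ (s ^ 20)) : T < 1 / 2 := by
  by_contra hT
  push Not at hT
  set ω := cascadeRatio (massMoment f₀) (energyMoment f₀) with hωdef
  have hω : 0 < ω := cascadeRatio_pos _ _
  have h0T : (0 : ℝ) ∈ Icc 0 T := ⟨le_rfl, by linarith⟩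
  have hω4 : ω ≤ 1 / 4 := by
    refine cascadeRatio_le hm.le ?_
    rw [← hf.energyMoment_eq hγ h0T]
    exact (hf.path.dens 0).energyMoment_nonneg
  have hs2 := (hs s hs0 le_rfl).le_half
  have hle : ∀ n : ℕ, ω ^ n * s ≤ s := fun n =>
    mul_le_of_le_one_left hs0.le (pow_le_one₀ hω.le (by linarith))
  have hpos : ∀ n : ℕ, 0 < ω ^ n * s := fun n => by positivity
  have hs10 : 2 * s ^ 10 ≤ 1 / 2 := by
    have := pow_le_pow_left₀ hs0.le hs2 10
    norm_num at this ⊢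
    linarith
  -- the `n`-th step takes a time `(ω ^ n s) ^ 10`; as `ω ^ 10 ≤ 1 / 2`, twice that time also pays for
  -- all later steps
  have chain : ∀ n : ℕ, ∃ t, 0 ≤ t ∧ t + 2 * (ω ^ n * s) ^ 10 ≤ 2 * s ^ 10 ∧
      ω ^ n * s ≤ massBelow (f t) ((ω ^ n * s) ^ 20) := by
    intro n
    induction n with
    | zero =>
      refine ⟨0, le_rfl, by simp, ?_⟩
      have h3 : massBelow (f 0) (s ^ 20) = massBelow f₀ (s ^ 20) := by
        refine integral_congr_ae (ae_restrict_of_ae ?_)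
        filter_upwards [hf.ae_notMem] with x hx
        rw [hf.init x hx]
      simpa [h3] using hmass
    | succ n ih =>
      obtain ⟨t₀, ht0, ht1, ht2⟩ := ih
      set z := ω ^ n * s with hz
      have hz0 : 0 < z := hpos n
      have hzs : z ≤ s := hle n
      have hz1 : z ≤ 1 := by linarith
      have hz10 := pow_pos hz0 10
      have hsd : ν / 2 * z ^ 32 ≤ massBelow f₀ (z ^ 21) := by
        refine le_trans ?_ (hseed (z ^ 21) (by positivity) ?_)
        · refine mul_le_mul_of_nonneg_left ?_ (by positivity)
          have : z ^ 11 ≤ √(z ^ 21) := Real.le_sqrt_of_sq_le (by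
            rw [← pow_mul]; exact pow_le_pow_of_le_one hz0.le hz1 (by norm_num))
          calc z ^ 32 = z ^ 21 * z ^ 11 := by ring
            _ ≤ _ := by gcongr
        · exact (pow_le_pow_of_le_one hz0.le hz1 (by norm_num)).trans
            (pow_le_pow_left₀ hz0.le hzs 20)
      obtain ⟨t, ht, htm⟩ := hf.cascade_step hγ hm (hs z hz0 hzs) hsd ht0 (by linarith)
        (by linarith) ht2
      have e1 : ω ^ (n + 1) * s = ω * z := by rw [hz]; ring
      rw [e1]
      refine ⟨t, ht0.trans ht.1, ?_, htm⟩
      have h2 : (ω * z) ^ 10 ≤ 1 / 2 * z ^ 10 := by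
        rw [mul_pow]
        refine mul_le_mul_of_nonneg_right ?_ hz10.le
        have := pow_le_of_le_one hω.le (by linarith) (show (10 : ℕ) ≠ 0 by norm_num)
        linarith
      linarith [ht.2]
  have hN := (hf.path.dens 0).bound_nonneg
  -- boundedness of the density bounds the scales from below
  have hlow : ∀ n : ℕ, 1 ≤ N * (ω ^ n * s) := by
    intro n
    obtain ⟨t, ht0, ht1, ht2⟩ := chain n
    have h1 := ht2.trans ((hf.path.dens t).massBelow_le hγ (by positivity))
    set z := ω ^ n * s with hz
    have hz0 : 0 < z := hpos n
    have hz1 : z ≤ 1 := by linarith [hle n]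
    rw [show z ^ 20 = (z ^ 10) ^ 2 by ring, Real.sqrt_sq (by positivity)] at h1
    have h2 : z * 1 ≤ z * (N * z ^ 29) := by linarith
    have h3 := le_of_mul_le_mul_left h2 hz0
    exact h3.trans (mul_le_mul_of_nonneg_left (pow_le_of_le_one hz0.le hz1 (by norm_num)) hN)
  have hlim : Tendsto (fun n : ℕ => N * (ω ^ n * s)) atTop (𝓝 (N * (0 * s))) :=
    ((tendsto_pow_atTop_nhds_zero_of_lt_one hω.le (by linarith)).mul_const s).const_mul N
  rw [zero_mul, mul_zero] at hlim
  exact absurd (ge_of_tendsto' hlim hlow) (by norm_num)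

/-- The concentration condition provides a single scale `s = ρ ^ (1 / 20)`. The supremum need not
be attained, whence the factor `1 / 2` in the seed; in the mass it is compensated by the `2` in the
concentration condition. -/
theorem Concentrated.exists_scale {h : ℝ → ℝ} {s₁ : ℝ} (hs₁ : 0 < s₁) (hν : 0 < ν)
    (hc : Concentrated ν (s₁ ^ 20) 2 (1 / 20) h) :
    ∃ s, 0 < s ∧ s ≤ s₁ ∧ (∀ R, 0 < R → R ≤ s ^ 20 → ν / 2 * (R * √R) ≤ massBelow h R) ∧
      s ≤ massBelow h (s ^ 20) := by
  have h12 : (ENNReal.ofReal (1 / 2)) < 1 := by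
    rw [← ENNReal.ofReal_one]; exact (ENNReal.ofReal_lt_ofReal_iff one_pos).2 (by norm_num)
  obtain ⟨ρ, hρ⟩ := lt_iSup_iff.1 (h12.trans_le hc)
  obtain ⟨hρm, hρ⟩ := lt_iSup_iff.1 hρ
  obtain ⟨h1, h2⟩ := lt_min_iff.1 hρ
  have hρ0 := hρm.1
  have e20 : (ρ ^ (1 / 20 : ℝ)) ^ 20 = ρ := by
    rw [← Real.rpow_natCast, ← Real.rpow_mul hρ0.le]; norm_num
  have hpos : 0 < ρ ^ (1 / 20 : ℝ) := Real.rpow_pos_of_pos hρ0 _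
  refine ⟨ρ ^ (1 / 20 : ℝ), hpos, ?_, ?_, ?_⟩
  · exact le_of_pow_le_pow_left₀ (show (20 : ℕ) ≠ 0 by norm_num) hs₁.le (by rw [e20]; exact hρm.2)
  · rw [e20]
    intro R hR0 hRρ
    have h3 := h1.trans_le (iInf₂_le R ⟨hR0, hRρ⟩)
    have h4 := (ENNReal.ofReal_lt_ofReal_iff' .. |>.1 h3).1
    have e3 : R ^ (3 / 2 : ℝ) = R * √R := by
      rw [Real.sqrt_eq_rpow, ← Real.rpow_one_add' hR0.le (by norm_num)]; norm_num
    rw [e3, one_div_mul_eq_div, lt_div_iff₀ (by positivity)] at h4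
    linarith
  · rw [e20]
    have h4 := (ENNReal.ofReal_lt_ofReal_iff' .. |>.1 h2).1
    rw [one_div_mul_eq_div, lt_div_iff₀ (by positivity)] at h4
    linarith

end Cascade

/-! ### Insensitivity of the collision rates to null sets -/

section Congr

variable {h k : ℝ → ℝ} {e : ℝ}

theorem ae_comp_add_sub (hk : ∀ᵐ x ∂energyMeasure, h x = k x) (a : ℝ) :
    ∀ᵐ y : ℝ, 0 < a + y - e → h (a + y - e) = k (a + y - e) := by
  have h1 : ∀ᵐ x : ℝ, 0 < x → h x = k x := (ae_restrict_iff' measurableSet_Ioi).1 hk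
  have h2 := (measurePreserving_add_left (volume : Measure ℝ) (a - e)).quasiMeasurePreserving.ae h1
  filter_upwards [h2] with y hy
  rwa [show a + y - e = a - e + y by ring]

/-- Equality at `e` itself is required, since the gain depends pointwise on the density at `ε₁`. -/
theorem gain_congr (hk : ∀ᵐ x ∂energyMeasure, h x = k x) (he : h e = k e) :
    gain h e = gain k e := by
  unfold gain
  congr 1
  refine integral_congr_ae ?_
  filter_upwards [hk] with x hx
  refine integral_congr_ae ?_
  filter_upwards [hk, ae_restrict_of_ae (ae_comp_add_sub (e := e) hk x)] with y hy hxy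
  rcases lt_or_ge 0 (x + y - e) with h0 | h0
  · rw [hx, hy, he, hxy h0]
  · rw [kernelW_eq_zero_of_second (by linarith : x + y ≤ e), mul_zero, mul_zero]

theorem lossRate_congr (hk : ∀ᵐ x ∂energyMeasure, h x = k x) (e : ℝ) :
    lossRate h e = lossRate k e := by
  unfold lossRate
  congr 1
  refine integral_congr_ae ?_
  filter_upwards [hk] with x hx
  refine integral_congr_ae ?_
  filter_upwards [hk, ae_restrict_of_ae (ae_comp_add_sub (e := e) hk x)] with y hy hxy
  rcases lt_or_ge 0 (x + y - e) with h0 | h0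
  · rw [hx, hy, hxy h0]
  · rw [kernelW_eq_zero_of_second (by linarith : x + y ≤ e), mul_zero, mul_zero]

end Congr

/-! ### Uniqueness -/

section Unique

variable {γ N N' T T' : ℝ} {Z Z' : Set ℝ} {f₀ : ℝ → ℝ} {f u : ℝ → ℝ → ℝ}

theorem IsSolution.mono_bound (hf : IsSolution γ N T Z f₀ f) (hN : N ≤ N') :
    IsSolution γ N' T Z f₀ f :=
  { hf with path := ⟨fun t => (hf.path.dens t).mono_bound hN, hf.path.cont⟩ }

theorem IsSolution.mono_time (hf : IsSolution γ N T Z f₀ f) (hT : T' ≤ T) :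
    IsSolution γ N T' Z f₀ f :=
  ⟨hf.path, hf.measZ, hf.nullZ, hf.zero, hf.init, fun e he t ht =>
    (hf.deriv e he t ⟨ht.1, ht.2.trans hT⟩).mono (Icc_subset_Icc_right hT)⟩

/-- A solution may be discarded on a larger null set of energies. This makes two solutions vanish
on the same set, so that their difference can be estimated pointwise. -/
theorem IsSolution.indicator (hf : IsSolution γ N T Z f₀ f) (hZ : Z ⊆ Z')
    (hm : MeasurableSet Z') (h0 : volume Z' = 0) :
    IsSolution γ N T Z' f₀ fun t => Z'ᶜ.indicator (f t) := by
  have hout : ∀ e ∉ Z', ∀ t, Z'ᶜ.indicator (f t) e = f t e := fun e he t =>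
    indicator_of_mem he _
  have hin : ∀ e ∈ Z', ∀ t, Z'ᶜ.indicator (f t) e = 0 := fun e he t =>
    indicator_of_notMem (notMem_compl_iff.2 he) _
  have hae : ∀ t, ∀ᵐ e ∂energyMeasure, Z'ᶜ.indicator (f t) e = f t e := fun t =>
    ae_restrict_of_ae ((measure_eq_zero_iff_ae_notMem.1 h0).mono fun e he => hout e he t)
  refine ⟨⟨fun t => ⟨(hf.path.dens t).meas.indicator hm.compl,
    fun e => indicator_nonneg (fun x _ => (hf.path.dens t).nonneg x) e, fun e => ?_⟩,
    fun e => ?_⟩, hm, h0, hin, fun e he => ?_, fun e he t ht => ?_⟩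
  · exact (indicator_le_self' (fun _ _ => (hf.path.dens t).nonneg _) e).trans
      ((hf.path.dens t).le e)
  · by_cases he : e ∈ Z'
    · simp only [hin e he]; exact continuous_const
    · simp only [hout e he]; exact hf.path.cont e
  · rw [hout e he, hf.init e fun h => he (hZ h)]
  · rw [gain_congr (hae t) (hout e he t), lossRate_congr (hae t)]
    simp only [hout e he]
    exact hf.deriv e (fun h => he (hZ h)) t ht

/-- Two solutions with bounds in the weight `γ` differ, in a weaker weight `β`, by `q ^ n` times a
constant for every `n`. -/
theorem IsSolution.eq_of_same_null (hf : IsSolution γ N T Z f₀ f) (hu : IsSolution γ N T Z f₀ u)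
    (hγ : 3 < γ) (hm : 0 < massMoment f₀) {t : ℝ} (ht : t ∈ Icc 0 T) (e : ℝ) :
    f t e = u t e := by
  obtain ⟨β, hβ, hβγ⟩ := exists_between hγ
  have hN := (hf.path.dens 0).bound_nonneg
  obtain ⟨C, hC, hrate⟩ := exists_rate_difference hβ hβγ hN hm
  have hc1 := contractRatio_lt_one hβ
  have hc0 := contractRatio_pos hβ
  set c := contractRatio β with hc
  have h1c : 0 < 1 - c := by linarith
  set lam := 2 * (C + 1) / (1 - c) with hlam
  have hlam0 : 0 < lam := by positivity
  set q := c + (C + 1) / lam with hq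
  have hq1 : q < 1 := by
    have : (C + 1) / lam = (1 - c) / 2 := by rw [hlam]; field_simp
    rw [hq, this]; linarith
  have hq0 : 0 < q := by positivity
  have key : ∀ n : ℕ, ∀ t ∈ Icc 0 T, ∀ e,
      |f t e - u t e| ≤ q ^ n * (N + 1) * Real.exp (lam * t) * decay β e := by
    intro n
    induction n with
    | zero =>
      intro t ht e
      have h1 := (hf.path.dens t).nonneg e
      have h2 := (hu.path.dens t).nonneg e
      have h3 := (hf.path.dens t).le e
      have h4 := (hu.path.dens t).le e
      have h5 : |f t e - u t e| ≤ N * decay γ e := abs_le.2 ⟨by linarith, by linarith⟩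
      refine h5.trans ?_
      have h6 : 1 ≤ Real.exp (lam * t) := Real.one_le_exp (mul_nonneg hlam0.le ht.1)
      refine mul_le_mul ?_ (decay_le_decay hβγ.le e) (decay_nonneg _ _) (by positivity)
      rw [pow_zero, one_mul]
      nlinarith
    | succ n ih =>
      intro t ht e
      rcases le_or_gt e 0 with he | he
      · simp [(hf.path.dens t).eq_zero he, (hu.path.dens t).eq_zero he, decay_of_nonpos he]
      by_cases heZ : e ∈ Z
      · rw [hf.zero e heZ, hu.zero e heZ, sub_zero, abs_zero]
        exact mul_nonneg (by positivity) (decay_nonneg _ _)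
      have h1 := duhamel_contraction hβ hβγ hlam0 (D := q ^ n * (N + 1)) (by positivity) hC hrate
        hf.path hu.path (fun t ht => (hf.massMoment_eq hγ ht).ge)
        (fun t ht => (hu.massMoment_eq hγ ht).ge) ih he
        (y := fun t => f t e) (z := fun t => u t e) (hf.deriv e heZ) (hu.deriv e heZ)
        (fun t _ => ⟨(hf.path.dens t).nonneg e, (hf.path.dens t).le e⟩)
        (fun t _ => ⟨(hu.path.dens t).nonneg e, (hu.path.dens t).le e⟩)
        (by rw [hf.init e heZ, hu.init e heZ]) ht
      refine h1.trans_eq ?_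
      rw [pow_succ]; ring
  have hlim : Tendsto (fun n : ℕ => q ^ n * (N + 1) * Real.exp (lam * t) * decay β e) atTop
      (𝓝 (0 * (N + 1) * Real.exp (lam * t) * decay β e)) :=
    (((tendsto_pow_atTop_nhds_zero_of_lt_one hq0.le hq1).mul_const _).mul_const _).mul_const _
  simp only [zero_mul] at hlim
  have := ge_of_tendsto' hlim fun n => key n t ht e
  exact sub_eq_zero.1 (abs_eq_zero.1 (le_antisymm this (abs_nonneg _)))

/-- Uniqueness, off the exceptional null sets. -/
theorem IsSolution.eq (hf : IsSolution γ N T Z f₀ f) (hu : IsSolution γ N' T Z' f₀ u)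
    (hγ : 3 < γ) (hm : 0 < massMoment f₀) {t : ℝ} (ht : t ∈ Icc 0 T) {e : ℝ} (he : e ∉ Z)
    (he' : e ∉ Z') : f t e = u t e := by
  have hmeas := hf.measZ.union hu.measZ
  have hnull : volume (Z ∪ Z') = 0 := measure_union_null hf.nullZ hu.nullZ
  have h1 := ((hf.mono_bound (le_max_left N N')).indicator subset_union_left hmeas
    hnull).eq_of_same_null ((hu.mono_bound (le_max_right N N')).indicator subset_union_right
    hmeas hnull) hγ hm ht e
  have h2 : e ∈ (Z ∪ Z')ᶜ := fun h => h.elim he he'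
  rwa [indicator_of_mem h2, indicator_of_mem h2] at h1

end Unique

/-! ### Continuation -/

section Continuation

variable {γ N N' N₀ T T' : ℝ} {f₀ : ℝ → ℝ} {f u : ℝ → ℝ → ℝ}

/-- The weighted bound of a solution is controlled by the datum, the length of the time interval
and a bound of the moments. -/
theorem exists_apriori_bound (hγ : 3 < γ) (hN₀ : 0 ≤ N₀) {F : ℝ} (hF : 0 ≤ F) (τ : ℝ) :
    ∃ N', 0 < N' ∧ ∀ (N T : ℝ) (f₀ : ℝ → ℝ) (f : ℝ → ℝ → ℝ), T ≤ τ → IsDensity γ N₀ f₀ →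
      IsSolution γ N T ∅ f₀ f → (∀ t ∈ Icc 0 T, fullMoment (f t) ≤ F) →
      ∀ t ∈ Icc 0 T, IsDensity γ N' (f t) := by
  have hc1 := gainRatio_lt_one hγ
  have hc0 := gainRatio_pos hγ
  set c := gainRatio γ with hc
  set C := gainConst γ * (F + F ^ 2) with hCdef
  have hgc := gainConst_pos γ
  have hC : 0 ≤ C := by positivity
  have h1c : 0 < 1 - c := by linarith
  set lam := 2 * (C + 1) / (1 - c) with hlam
  have hlam0 : 0 < lam := by positivity
  set q := c + (C + 1) / lam with hq
  have hq1 : q < 1 := by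
    have : (C + 1) / lam = (1 - c) / 2 := by rw [hlam]; field_simp
    rw [hq, this]; linarith
  have hq0 : 0 < q := by positivity
  have h1q : 0 < 1 - q := by linarith
  refine ⟨(N₀ + 1) / (1 - q) * Real.exp (lam * τ), by positivity, ?_⟩
  intro N T f₀ f hT h₀ hf hFb
  have hN := (hf.path.dens 0).bound_nonneg
  -- the geometric series `N₀ + q N₀ + q² N₀ + …` replaces the time-dependent bound `N`
  have key : ∀ n : ℕ, ∀ t ∈ Icc 0 T, ∀ e,
      f t e ≤ (q ^ n * N + (N₀ + 1) / (1 - q)) * Real.exp (lam * t) * decay γ e := by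
    intro n
    induction n with
    | zero =>
      intro t ht e
      refine ((hf.path.dens t).le e).trans (mul_le_mul_of_nonneg_right ?_ (decay_nonneg _ _))
      have h6 : 1 ≤ Real.exp (lam * t) := Real.one_le_exp (mul_nonneg hlam0.le ht.1)
      have h7 : 0 ≤ (N₀ + 1) / (1 - q) := by positivity
      rw [pow_zero, one_mul]
      nlinarith
    | succ n ih =>
      intro t ht e
      rcases le_or_gt e 0 with he | he
      · simp [(hf.path.dens t).eq_zero he, decay_of_nonpos he]
      have hd := decay_pos (β := γ) he
      set D := q ^ n * N + (N₀ + 1) / (1 - q) with hD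
      have hD0 : 0 < D := by positivity
      have h1 := le_exp_barrier (v := fun t => f t e) (r := fun t => gain (f t) e)
        (α := fun t => lossRate (f t) e) (T := T) (c := N₀ * decay γ e) (W := D * decay γ e)
        (q := c) (C := C) hlam0 (by positivity) hc0.le (by positivity) hC
        (fun t _ => lossRate_nonneg (hf.path.dens t) hγ e) (hf.deriv e (notMem_empty e))
        (by rw [hf.init e (notMem_empty e)]; exact h₀.le e)
        (fun t ht => by
          have hd : IsDensity γ (D * Real.exp (lam * t)) (f t) :=
            ⟨(hf.path.dens t).meas, (hf.path.dens t).nonneg, ih t ht⟩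
          have h2 := gain_le hd hγ he
          have h3 := hFb t ht
          have h4 := hd.fullMoment_nonneg
          refine h2.trans (le_trans (mul_le_mul_of_nonneg_left (add_le_add_right
            (mul_le_mul_of_nonneg_left (add_le_add h3 (pow_le_pow_left₀ h4 h3 2)) hgc.le) _)
            (by positivity)) (le_of_eq ?_))
          rw [← hCdef]; ring) ht
      refine h1.trans ?_
      have h2 : N₀ + D * q ≤ q ^ (n + 1) * N + (N₀ + 1) / (1 - q) := by
        have : (N₀ + 1) / (1 - q) = N₀ + 1 + q * ((N₀ + 1) / (1 - q)) := by
          field_simp; ring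
        rw [hD, pow_succ]
        linarith
      calc _ = (N₀ + D * q) * (Real.exp (lam * t) * decay γ e) := by ring
        _ ≤ _ := mul_le_mul_of_nonneg_right h2 (by positivity)
        _ = _ := by ring
  intro t ht
  refine ⟨(hf.path.dens t).meas, (hf.path.dens t).nonneg, fun e => ?_⟩
  have hlim : Tendsto (fun n : ℕ => (q ^ n * N + (N₀ + 1) / (1 - q)) * Real.exp (lam * t) *
      decay γ e) atTop
      (𝓝 ((0 * N + (N₀ + 1) / (1 - q)) * Real.exp (lam * t) * decay γ e)) :=
    ((((tendsto_pow_atTop_nhds_zero_of_lt_one hq0.le hq1).mul_const _).add_const _).mul_const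
      _).mul_const _
  refine (ge_of_tendsto' hlim fun n => key n t ht e).trans ?_
  have h3 : Real.exp (lam * t) ≤ Real.exp (lam * τ) :=
    Real.exp_le_exp.2 (mul_le_mul_of_nonneg_left (ht.2.trans hT) hlam0.le)
  have := decay_nonneg γ e
  rw [zero_mul, zero_add]
  gcongr

/-- A solution continued by a solution that starts at its final state. -/
theorem IsSolution.concat (hf : IsSolution γ N T ∅ f₀ f) (hT : 0 ≤ T)
    (hu : IsSolution γ N T' ∅ (f T) u) :
    IsSolution γ N (T + T') ∅ f₀ fun t => if t ≤ T then f t else u (t - T) := by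
  have hT0 : u (T - T) = f T := by
    rw [sub_self]; exact funext fun e => hu.init e (notMem_empty e)
  have hge : ∀ t, T ≤ t → (if t ≤ T then f t else u (t - T)) = u (t - T) := by
    intro t ht
    rcases ht.eq_or_lt with rfl | h
    · rw [if_pos le_rfl, hT0]
    · rw [if_neg (not_le.2 h)]
  refine ⟨⟨fun t => ?_, fun e => ?_⟩, MeasurableSet.empty, measure_empty,
    fun e he => absurd he (notMem_empty e), fun e he => ?_, fun e he t ht => ?_⟩
  · split_ifs
    exacts [hf.path.dens _, hu.path.dens _]
  · have h1 : Continuous fun t => if t ≤ T then f t e else u (t - T) e := by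
      refine Continuous.if_le (hf.path.cont e)
        ((hu.path.cont e).comp (continuous_id.sub continuous_const)) continuous_id
        continuous_const fun t ht => ?_
      have ht : t = T := ht
      rw [ht, hT0]
    refine h1.congr fun t => ?_
    split_ifs <;> rfl
  · rw [if_pos hT]; exact hf.init e he
  · have hleft : t ≤ T → HasDerivWithinAt (fun t => (if t ≤ T then f t else u (t - T)) e)
        (gain (if t ≤ T then f t else u (t - T)) e - lossRate (if t ≤ T then f t else u (t - T))
          e * (if t ≤ T then f t else u (t - T)) e) (Icc 0 T) t := fun h => by
      rw [if_pos h]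
      exact (hf.deriv e he t ⟨ht.1, h⟩).congr (fun s hs => by rw [if_pos hs.2])
        (by rw [if_pos h])
    have hright : T ≤ t → HasDerivWithinAt (fun t => (if t ≤ T then f t else u (t - T)) e)
        (gain (if t ≤ T then f t else u (t - T)) e - lossRate (if t ≤ T then f t else u (t - T))
          e * (if t ≤ T then f t else u (t - T)) e) (Icc T (T + T')) t := fun h => by
      rw [hge t h]
      have h1 := (hu.deriv e he (t - T) ⟨by linarith, by linarith [ht.2]⟩).scomp t
        (h := fun s => s - T) (h' := 1) (s := Icc T (T + T'))
        ((hasDerivAt_id t).sub_const T).hasDerivWithinAt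
        (fun s hs => ⟨by linarith [hs.1], by linarith [hs.2]⟩)
      rw [one_smul] at h1
      exact h1.congr (fun s hs => by rw [hge s hs.1]; rfl) (by rw [hge t h]; rfl)
    rcases lt_trichotomy t T with h | h | h
    · exact (hleft h.le).mono_of_mem_nhdsWithin
        (mem_nhdsWithin.2 ⟨Iio T, isOpen_Iio, h, fun s hs => ⟨hs.2.1, hs.1.le⟩⟩)
    · refine ((hleft h.le).union (hright h.ge)).mono fun s hs => ?_
      rcases le_total s T with h2 | h2
      exacts [Or.inl ⟨hs.1, h2⟩, Or.inr ⟨h2, hs.2⟩]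
    · exact (hright h.le).mono_of_mem_nhdsWithin
        (mem_nhdsWithin.2 ⟨Ioi T, isOpen_Ioi, h, fun s hs => ⟨hs.1.le, hs.2.2⟩⟩)

end Continuation

/-! ### The maximal solution -/

/-- The times up to which a solution with datum `f₀` exists. -/
def existenceTimes (γ : ℝ) (f₀ : ℝ → ℝ) : Set ℝ :=
  {T | 0 ≤ T ∧ ∃ N f, IsSolution γ N T ∅ f₀ f}

/-- The supremum of the existence times. It is meaningful when these are bounded. -/
noncomputable def maximalTime (γ : ℝ) (f₀ : ℝ → ℝ) : ℝ := sSup (existenceTimes γ f₀)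

open Classical in
/-- The state at time `t` of a solution on `[0, t]`, if there is one, and zero otherwise. By
uniqueness these states fit together. -/
noncomputable def maximalSolution (γ : ℝ) (f₀ : ℝ → ℝ) (t : ℝ) : ℝ → ℝ :=
  if h : ∃ f : ℝ → ℝ → ℝ, ∃ N, IsSolution γ N t ∅ f₀ f then h.choose t else 0

theorem continuous_fullMoment {γ N : ℝ} {f : ℝ → ℝ → ℝ} (hf : IsPath γ N f) (hγ : 3 < γ) :
    Continuous fun t => fullMoment (f t) := by
  refine continuous_of_dominated
    (fun t => ((hf.dens t).integrable_mul_momentWeight hγ).aestronglyMeasurable)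
    (fun t => Eventually.of_forall fun x => ?_)
    (((isDensity_decay γ).integrable_mul_momentWeight hγ).const_mul N)
    (Eventually.of_forall fun x => (hf.cont x).mul_const _)
  have h1 : 0 ≤ momentWeight x := by linarith [one_le_momentWeight x]
  rw [norm_mul, Real.norm_of_nonneg ((hf.dens t).nonneg x), Real.norm_of_nonneg h1, ← mul_assoc]
  exact mul_le_mul_of_nonneg_right ((hf.dens t).le x) h1

/-- For a bounded density, mass and energy control all moments in use. -/
theorem IsDensity.fullMoment_le_of_ae {γ N L : ℝ} {h : ℝ → ℝ} (hh : IsDensity γ N h)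
    (hγ : 3 < γ) (hL : ∀ᵐ x ∂energyMeasure, h x ≤ L) :
    fullMoment h ≤ L + massMoment h + energyMoment h := by
  have h1 : ∀ᵐ x : ℝ, 0 < x → h x ≤ L := (ae_restrict_iff' measurableSet_Ioi).1 hL
  have i1 : Integrable ((Ioc (0 : ℝ) 1).indicator fun _ => L) :=
    (integrable_indicator_iff measurableSet_Ioc).2 (integrableOn_const (by simp))
  have i2 := hh.integrable_mul_sqrt hγ
  have i3 := hh.integrable_mul_mul_sqrt hγ
  have h2 : fullMoment h ≤ ∫ x, (Ioc (0 : ℝ) 1).indicator (fun _ => L) x + h x * √x +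
      h x * (x * √x) := by
    refine integral_mono_ae (hh.integrable_mul_momentWeight hγ) ((i1.add i2).add i3) ?_
    filter_upwards [h1] with x hx
    have h0 := hh.nonneg x
    have hs := mul_nonneg h0 (Real.sqrt_nonneg x)
    unfold momentWeight
    rcases le_or_gt x 0 with hx0 | hx0
    · simp [hh.eq_zero hx0, not_lt.2 hx0]
    rcases le_or_gt x 1 with hx1 | hx1
    · rw [indicator_of_mem (show x ∈ Ioc (0 : ℝ) 1 from ⟨hx0, hx1⟩)]
      linarith [hx hx0]
    · rw [indicator_of_notMem (fun h => not_le.2 hx1 h.2)]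
      have := mul_le_mul_of_nonneg_left (Real.one_le_sqrt.2 hx1.le) h0
      linarith
  have e1 : ∫ x, (Ioc (0 : ℝ) 1).indicator (fun _ => L) x = L := by
    rw [integral_indicator measurableSet_Ioc]; simp
  have e2 : ∫ x, (Ioc (0 : ℝ) 1).indicator (fun _ => L) x + h x * √x + h x * (x * √x) =
      L + massMoment h + energyMoment h := by
    rw [integral_add (f := fun x => (Ioc (0 : ℝ) 1).indicator (fun _ => L) x + h x * √x)
      (i1.add i2) i3, integral_add i1 i2, e1]
    rfl
  exact h2.trans_eq e2

section Maximal

variable {γ N₀ b : ℝ} {f₀ : ℝ → ℝ}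

theorem maximalSolution_eq {N T : ℝ} {f : ℝ → ℝ → ℝ} (hf : IsSolution γ N T ∅ f₀ f)
    (hγ : 3 < γ) (hm : 0 < massMoment f₀) {t : ℝ} (ht : t ∈ Icc 0 T) :
    maximalSolution γ f₀ t = f t := by
  have hft := hf.mono_time ht.2
  have h : ∃ f : ℝ → ℝ → ℝ, ∃ N, IsSolution γ N t ∅ f₀ f := ⟨f, N, hft⟩
  rw [maximalSolution, dif_pos h]
  obtain ⟨N', hN'⟩ := h.choose_spec
  exact funext fun e => hN'.eq hft hγ hm ⟨ht.1, le_rfl⟩ (notMem_empty e) (notMem_empty e)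

theorem exists_mem_existenceTimes (h₀ : IsDensity γ N₀ f₀) (hγ : 3 < γ)
    (hm : 0 < massMoment f₀) : ∃ T ∈ existenceTimes γ f₀, 0 < T := by
  obtain ⟨δ, hδ, h⟩ := exists_local_solution hγ (lt_max_of_lt_right one_pos : 0 < max N₀ 1) hm
  obtain ⟨f, hf⟩ := h f₀ (h₀.mono_bound (le_max_left _ _)) le_rfl
  exact ⟨δ, ⟨hδ.le, _, f, hf⟩, hδ⟩

theorem maximalTime_pos (h₀ : IsDensity γ N₀ f₀) (hγ : 3 < γ) (hm : 0 < massMoment f₀)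
    (hb : BddAbove (existenceTimes γ f₀)) : 0 < maximalTime γ f₀ := by
  obtain ⟨T, hT, hT0⟩ := exists_mem_existenceTimes h₀ hγ hm
  exact hT0.trans_le (le_csSup hb hT)

theorem exists_solution_of_lt_maximalTime (h₀ : IsDensity γ N₀ f₀) (hγ : 3 < γ)
    (hm : 0 < massMoment f₀) {T : ℝ} (hT : T < maximalTime γ f₀) :
    ∃ N f, IsSolution γ N T ∅ f₀ f ∧ ∀ t ∈ Icc 0 T, maximalSolution γ f₀ t = f t := by
  obtain ⟨T₁, hT₁, _⟩ := exists_mem_existenceTimes h₀ hγ hm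
  obtain ⟨T', ⟨_, N, f, hf⟩, hTT'⟩ := exists_lt_of_lt_csSup ⟨T₁, hT₁⟩ hT
  exact ⟨N, f, hf.mono_time hTT'.le, fun t ht =>
    maximalSolution_eq (hf.mono_time hTT'.le) hγ hm ht⟩

/-- If the moments stay bounded, then the solution can be continued. -/
theorem not_fullMoment_bounded (h₀ : IsDensity γ N₀ f₀) (hγ : 3 < γ) (hm : 0 < massMoment f₀)
    (hb : BddAbove (existenceTimes γ f₀)) (F : ℝ) :
    ∃ t ∈ Ico 0 (maximalTime γ f₀), F < fullMoment (maximalSolution γ f₀ t) := by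
  by_contra hcon
  push Not at hcon
  have hpos := maximalTime_pos h₀ hγ hm hb
  obtain ⟨N', hN', hap⟩ := exists_apriori_bound hγ h₀.bound_nonneg (le_max_right F 0)
    (maximalTime γ f₀)
  obtain ⟨δ, hδ, hloc⟩ := exists_local_solution hγ hN' hm
  set T := max (maximalTime γ f₀ - δ / 2) 0 with hTdef
  have hT0 : 0 ≤ T := le_max_right _ _
  have hT : T < maximalTime γ f₀ := max_lt (by linarith) hpos
  obtain ⟨N, f, hf, hfe⟩ := exists_solution_of_lt_maximalTime h₀ hγ hm hT
  have hd := hap N T f₀ f hT.le h₀ hf fun t ht => by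
    rw [← hfe t ht]
    exact (hcon t ⟨ht.1, ht.2.trans_lt hT⟩).trans (le_max_left _ _)
  obtain ⟨u, hu⟩ := hloc (f T) (hd T ⟨hT0, le_rfl⟩) (hf.massMoment_eq hγ ⟨hT0, le_rfl⟩).ge
  have hc := (hf.mono_bound (le_max_left N (2 * N'))).concat hT0
    (hu.mono_bound (le_max_right N (2 * N')))
  have := le_csSup hb (show T + δ ∈ existenceTimes γ f₀ from ⟨by positivity, _, _, hc⟩)
  have h1 : maximalTime γ f₀ - δ / 2 ≤ T := le_max_left _ _
  unfold maximalTime at h1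
  linarith

/-- The blow-up alternative: mass and energy being conserved, a bound of the supremum norm bounds
all moments in use, hence the weighted norm, and the solution could be continued. -/
theorem limsupNorm_maximalSolution (h₀ : IsDensity γ N₀ f₀) (hγ : 3 < γ)
    (hm : 0 < massMoment f₀) (hb : BddAbove (existenceTimes γ f₀)) :
    limsupNorm (maximalSolution γ f₀) (maximalTime γ f₀) = ∞ := by
  by_contra hne
  set Tm := maximalTime γ f₀ with hTm
  have hpos : 0 < Tm := maximalTime_pos h₀ hγ hm hb
  obtain ⟨L, hL⟩ := ENNReal.lt_iff_exists_nnreal_btwn.1 (lt_top_iff_ne_top.2 hne)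
  have hev := eventually_lt_of_limsup_lt hL.1
  obtain ⟨U, hU, V, hV, hUV⟩ := mem_inf_iff_superset.1 hev
  obtain ⟨T₁, hT₁, hT₁U⟩ := (mem_nhdsLT_iff_exists_Ioo_subset' hpos).1 hU
  set T₂ := max T₁ 0 with hT₂
  have hT₂m : T₂ < Tm := max_lt hT₁ hpos
  obtain ⟨N₂, f₂, hf₂, hfe₂⟩ := exists_solution_of_lt_maximalTime h₀ hγ hm hT₂m
  obtain ⟨t, ht, htF⟩ := not_fullMoment_bounded h₀ hγ hm hb
    (max (N₂ * decayMoment γ) (L + massMoment f₀ + energyMoment f₀))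
  refine absurd htF (not_lt.2 ?_)
  rcases le_or_gt t T₂ with h | h
  · rw [hfe₂ t ⟨ht.1, h⟩]
    exact ((hf₂.path.dens t).fullMoment_le hγ).trans (le_max_left _ _)
  refine le_trans ?_ (le_max_right _ _)
  obtain ⟨T₃, ht₃, hT₃⟩ := exists_between ht.2
  obtain ⟨N, f, hf, hfe⟩ := exists_solution_of_lt_maximalTime h₀ hγ hm hT₃
  have h02 : 0 ≤ T₂ := le_max_right _ _
  rw [hfe t ⟨ht.1, ht₃.le⟩]
  -- by continuity, the bound at almost every time is a bound at every time
  set B := L + massMoment f₀ + energyMoment f₀ with hB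
  have hopen : IsOpen (Ioo T₂ T₃ ∩ {s | B < fullMoment (f s)}) :=
    isOpen_Ioo.inter (isOpen_lt continuous_const (continuous_fullMoment hf.path hγ))
  have hnull : volume (Ioo T₂ T₃ ∩ {s | B < fullMoment (f s)}) = 0 := by
    refine measure_mono_null ?_ (mem_ae_iff.1 hV)
    rintro s ⟨hs, hsB⟩ hsV
    have hsm : s ∈ Icc 0 T₃ := ⟨h02.trans hs.1.le, hs.2.le⟩
    have h1 : eLpNorm (maximalSolution γ f₀ s) ∞ energyMeasure < L :=
      hUV ⟨hT₁U ⟨(le_max_left _ _).trans_lt hs.1, hs.2.trans hT₃⟩, hsV⟩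
    rw [hfe s hsm, eLpNorm_exponent_top] at h1
    refine absurd (show B < fullMoment (f s) from hsB) (not_lt.2 ?_)
    rw [hB, ← hf.massMoment_eq hγ hsm, ← hf.energyMoment_eq hγ hsm]
    refine (hf.path.dens s).fullMoment_le_of_ae hγ ?_
    filter_upwards [ae_le_eLpNormEssSup (f := f s) (μ := energyMeasure)] with x hx
    have h2 := hx.trans h1.le
    rw [← ofReal_norm, ENNReal.ofReal_le_coe] at h2
    exact (Real.le_norm_self _).trans h2
  have hempty := hopen.measure_eq_zero_iff (μ := volume) |>.1 hnull
  by_contra hlt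
  exact (hempty ▸ (⟨⟨h, ht₃⟩, not_le.1 hlt⟩ :
    t ∈ Ioo T₂ T₃ ∩ {s | B < fullMoment (f s)}) : t ∈ (∅ : Set ℝ))

end Maximal

/-! ### Densities and the weighted space -/

/-- `energyMeasure` is a definition, so that instance search does not see the restriction of Lebesgue
measure behind it. -/
instance : SFinite energyMeasure :=
  inferInstanceAs (SFinite (volume.restrict (Ioi (0 : ℝ))))

theorem ae_le_of_weightedNorm_le {γ N : ℝ} {h : ℝ → ℝ} (hN : 0 ≤ N)
    (hh : weightedNorm γ h ≤ ENNReal.ofReal N) : ∀ᵐ x ∂energyMeasure, h x ≤ N * decay γ x := by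
  unfold weightedNorm at hh
  rw [eLpNorm_exponent_top] at hh
  filter_upwards [ae_le_eLpNormEssSup (f := fun ε => (1 + ε) ^ γ * h ε) (μ := energyMeasure),
    ae_restrict_mem measurableSet_Ioi] with x hx hx0
  have hx0 : 0 < x := hx0
  have h1 := hx.trans hh
  rw [← ofReal_norm, ENNReal.ofReal_le_ofReal_iff hN] at h1
  have h2 := (Real.le_norm_self _).trans h1
  have h3 : 0 < (1 + x) ^ γ := Real.rpow_pos_of_pos (by linarith) _
  rw [decay_of_pos hx0, Real.rpow_neg (by linarith), ← div_eq_mul_inv, le_div_iff₀ h3]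
  linarith

theorem IsDensity.weightedNorm_le {γ N : ℝ} {h : ℝ → ℝ} (hh : IsDensity γ N h) :
    weightedNorm γ h ≤ ENNReal.ofReal N := by
  unfold weightedNorm
  rw [eLpNorm_exponent_top]
  refine eLpNormEssSup_le_of_ae_bound ?_
  filter_upwards [ae_restrict_mem measurableSet_Ioi] with x hx0
  have hx0 : 0 < x := hx0
  have h3 : 0 < (1 + x) ^ γ := Real.rpow_pos_of_pos (by linarith) _
  have h4 := hh.le x
  rw [decay_of_pos hx0, Real.rpow_neg (by linarith), ← div_eq_mul_inv, le_div_iff₀ h3] at h4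
  rw [Real.norm_of_nonneg (mul_nonneg h3.le (hh.nonneg x))]
  linarith

theorem IsDensity.memWeighted {γ N : ℝ} {h : ℝ → ℝ} (hh : IsDensity γ N h) : MemWeighted γ h :=
  ⟨hh.meas.aemeasurable, Eventually.of_forall hh.nonneg,
    hh.weightedNorm_le.trans_lt ENNReal.ofReal_lt_top⟩

/-- The pointwise truncation of a function to the range of densities. -/
noncomputable def truncate (γ N : ℝ) (h : ℝ → ℝ) (x : ℝ) : ℝ :=
  min (max (h x) 0) (N * decay γ x)

theorem truncate_of_mem {γ N x : ℝ} {h : ℝ → ℝ} (h0 : 0 ≤ h x) (h1 : h x ≤ N * decay γ x) :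
    truncate γ N h x = h x := by
  rw [truncate, max_eq_left h0, min_eq_left h1]

theorem isDensity_truncate {γ N : ℝ} {h : ℝ → ℝ} (hN : 0 ≤ N) (hh : Measurable h) :
    IsDensity γ N (truncate γ N h) :=
  ⟨(hh.max measurable_const).min ((measurable_decay γ).const_mul N),
    fun x => le_min (le_max_right _ _) (mul_nonneg hN (decay_nonneg γ x)),
    fun _ => min_le_right _ _⟩

/-- Every element of the weighted space has a representative with pointwise bounds. -/
theorem MemWeighted.exists_isDensity {γ : ℝ} {h : ℝ → ℝ} (hh : MemWeighted γ h) :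
    ∃ N k, IsDensity γ N k ∧ ∀ᵐ x ∂energyMeasure, h x = k x := by
  refine ⟨(weightedNorm γ h).toReal, truncate γ _ (hh.aemeasurable.mk h),
    isDensity_truncate ENNReal.toReal_nonneg hh.aemeasurable.measurable_mk, ?_⟩
  filter_upwards [hh.aemeasurable.ae_eq_mk, hh.nonneg, ae_le_of_weightedNorm_le (γ := γ) (h := h)
    ENNReal.toReal_nonneg (ENNReal.ofReal_toReal hh.norm_lt_top.ne).ge] with x h1 h2 h3
  rw [h1] at h2 h3
  rw [truncate_of_mem h2 h3, h1]

/-! ### Mild solutions are classical off a null set -/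

/-- The Duhamel map at the energy `e` sees the path only through its rates at `e`. -/
theorem mildMap_congr {f₀ k : ℝ → ℝ} {f g : ℝ → ℝ → ℝ} {T e : ℝ} (h0 : f₀ e = k e)
    (hl : ∀ᵐ s, s ∈ Icc 0 T → lossRate (f s) e = lossRate (g s) e)
    (hg : ∀ᵐ s, s ∈ Icc 0 T → gain (f s) e = gain (g s) e) {t : ℝ} (ht : t ∈ Icc 0 T) :
    mildMap f₀ f t e = mildMap k g t e := by
  have hP : ∀ t ∈ Icc 0 T, Psi 0 f t e = Psi 0 g t e := fun t ht => by
    unfold Psi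
    rw [intervalIntegral.integral_congr_ae (hl.mono fun s hs hst => hs ?_)]
    rw [uIoc_of_le ht.1] at hst
    exact ⟨hst.1.le, hst.2.trans ht.2⟩
  unfold mildMap
  rw [h0, hP t ht]
  congr 1
  refine intervalIntegral.integral_congr_ae (hg.mono fun s hs hst => ?_)
  rw [uIoc_of_le ht.1] at hst
  have hsT : s ∈ Icc 0 T := ⟨hst.1.le, hst.2.trans ht.2⟩
  rw [hs hsT, hP s hsT]

/-- If the Duhamel map reproduces a measurable path almost everywhere, then its values form, off a
null set of energies, a solution that agrees with the path almost everywhere. -/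
theorem exists_isSolution_of_ae_eq_mildMap {γ N T : ℝ} {k : ℝ → ℝ} {w : ℝ → ℝ → ℝ} (hγ : 3 < γ)
    (hT : 0 < T) (hk : Measurable k) (hk0 : ∀ e ≤ 0, k e = 0) (hw : IsMeasurablePath γ N w)
    (heq : ∀ᵐ t ∂(volume.restrict (Icc 0 T)), ∀ᵐ e ∂energyMeasure, w t e = mildMap k w t e) :
    ∃ Z v, IsSolution γ N T Z k v ∧
      ∀ᵐ t ∂(volume.restrict (Icc 0 T)), ∀ᵐ e ∂energyMeasure, w t e = v t e := by
  have hMc := fun e => continuous_mildMap (f₀ := k) hw hγ e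
  have hMm := fun t => measurable_mildMap hw hγ hk t
  have hset : MeasurableSet {p : ℝ × ℝ | w p.1 p.2 = mildMap k w p.1 p.2} :=
    measurableSet_eq_fun hw.meas (measurable_uncurry_of_continuous hMc hMm)
  have hswap : ∀ᵐ e ∂energyMeasure, ∀ᵐ t ∂(volume.restrict (Icc 0 T)),
      w t e = mildMap k w t e := (Measure.ae_ae_comm hset).1 heq
  have hbad : ∀ᵐ e : ℝ, 0 < e → ∀ᵐ t ∂(volume.restrict (Icc 0 T)), w t e = mildMap k w t e :=
    (ae_restrict_iff' measurableSet_Ioi).1 hswap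
  obtain ⟨Z, hZsub, hZm, hZ0⟩ := exists_measurable_superset_of_null (ae_iff.1 hbad)
  have hgood : ∀ e ∉ Z, ∀ᵐ t ∂(volume.restrict (Icc 0 T)), w t e = mildMap k w t e := by
    intro e he
    rcases le_or_gt e 0 with h | h
    · exact Eventually.of_forall fun t => by
        rw [(hw.dens t).eq_zero h, mildMap_of_nonpos hk0 h]
    · by_contra hcon
      exact he (hZsub fun hh => hcon (hh h))
  have hZae : ∀ᵐ e : ℝ, e ∉ Z := measure_eq_zero_iff_ae_notMem.1 hZ0
  set v : ℝ → ℝ → ℝ := fun t => Zᶜ.indicator (mildMap k w (clampTime T t)) with hv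
  have hvout : ∀ e ∉ Z, ∀ t, v t e = mildMap k w (clampTime T t) e := fun e he t =>
    indicator_of_mem he _
  have hvin : ∀ e ∈ Z, ∀ t, v t e = 0 := fun e he t =>
    indicator_of_notMem (notMem_compl_iff.2 he) _
  have hvM : ∀ e ∉ Z, ∀ t ∈ Icc 0 T, v t e = mildMap k w t e := fun e he t ht => by
    rw [hvout e he, clampTime_of_mem ht]
  -- by continuity, the bounds hold at all times
  have hbound : ∀ e ∉ Z, ∀ t ∈ Icc 0 T,
      0 ≤ mildMap k w t e ∧ mildMap k w t e ≤ N * decay γ e := by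
    intro e he t ht
    have hd := mul_nonneg (hw.dens 0).bound_nonneg (decay_nonneg γ e)
    have h1 : EqOn (fun t => mildMap k w t e)
        (fun t => min (max (mildMap k w t e) 0) (N * decay γ e)) (Icc 0 T) := by
      refine Measure.eqOn_Icc_of_ae_eq volume hT.ne ?_ (hMc e).continuousOn
        (((hMc e).max continuous_const).min continuous_const).continuousOn
      filter_upwards [hgood e he] with s hs
      rw [← hs, max_eq_left ((hw.dens s).nonneg e), min_eq_left ((hw.dens s).le e)]
    have h2 : mildMap k w t e = min (max (mildMap k w t e) 0) (N * decay γ e) := h1 ht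
    rw [h2]
    exact ⟨le_min (le_max_right _ _) hd, min_le_right _ _⟩
  have hpath : IsPath γ N v := by
    refine ⟨fun t => ⟨(hMm _).indicator hZm.compl, fun e => ?_, fun e => ?_⟩, fun e => ?_⟩
    · by_cases he : e ∈ Z
      · rw [hvin e he]
      · rw [hvout e he]; exact (hbound e he _ (clampTime_mem hT.le t)).1
    · by_cases he : e ∈ Z
      · rw [hvin e he]; exact mul_nonneg (hw.dens 0).bound_nonneg (decay_nonneg γ e)
      · rw [hvout e he]; exact (hbound e he _ (clampTime_mem hT.le t)).2
    · by_cases he : e ∈ Z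
      · simp only [hvin e he]; exact continuous_const
      · simp only [hvout e he]; exact (hMc e).comp (continuous_clampTime T)
  have hwv : ∀ᵐ t ∂(volume.restrict (Icc 0 T)), ∀ᵐ e ∂energyMeasure, w t e = v t e := by
    filter_upwards [heq, ae_restrict_mem measurableSet_Icc] with t ht htT
    filter_upwards [ht, ae_restrict_of_ae hZae] with e he heZ
    rw [he, hvM e heZ t htT]
  have hwv' := (ae_restrict_iff' (μ := volume) measurableSet_Icc).1 hwv
  have hfix : ∀ e ∉ Z, ∀ t ∈ Icc 0 T, v t e = mildMap k v t e := by
    intro e he t ht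
    rw [hvM e he t ht]
    refine mildMap_congr rfl (hwv'.mono fun s hs hsT => lossRate_congr (hs hsT) e) ?_ ht
    filter_upwards [hwv', (ae_restrict_iff' measurableSet_Icc).1 (hgood e he)] with s hs hs' hsT
    exact gain_congr (hs hsT) (by rw [hs' hsT, hvM e he s hsT])
  refine ⟨Z, v, ⟨hpath, hZm, hZ0, hvin, fun e he => ?_, fun e he t ht => ?_⟩, hwv⟩
  · rw [hvM e he 0 ⟨le_rfl, hT.le⟩, mildMap_zero]
  · have h1 := (hasDerivAt_mildMap (f₀ := k) hpath hγ t e).hasDerivWithinAt (s := Icc 0 T)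
    rw [← hfix e he t ht] at h1
    exact h1.congr (hfix e he) (hfix e he t ht)

/-- A mild solution agrees almost everywhere with a measurable path of densities that has pointwise
bounds, and this path with a classical solution off a null set of energies. The final time is lost,
as mild solutions are only locally bounded in time. -/
theorem IsMildSolution.exists_isSolution {γ N₀ T T' : ℝ} {f₀ k : ℝ → ℝ} {u : ℝ → ℝ → ℝ}
    (hu : IsMildSolution γ 0 T f₀ u) (hγ : 3 < γ) (hk : IsDensity γ N₀ k)
    (hfk : ∀ᵐ e ∂energyMeasure, f₀ e = k e) (hT' : 0 < T') (hTT' : T' < T) :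
    ∃ N Z v, IsSolution γ N T' Z k v ∧
      ∀ᵐ t ∂(volume.restrict (Icc 0 T')), ∀ᵐ e ∂energyMeasure, u t e = v t e := by
  set μ : Measure ℝ := volume.restrict (Icc 0 T') with hμ
  have hsub : Icc 0 T' ⊆ Ico 0 T := fun t ht => ⟨ht.1, ht.2.trans_lt hTT'⟩
  have hle : μ ≤ volume.restrict (Ico 0 T) := Measure.restrict_mono hsub le_rfl
  have hmem : ∀ᵐ t ∂μ, t ∈ Icc 0 T' := ae_restrict_mem measurableSet_Icc
  set S := ⨆ t ∈ Icc 0 T', weightedNorm γ (u t) with hS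
  have hSfin : S < ∞ := hu.mem.locallyBounded _ isCompact_Icc hsub
  set N := S.toReal with hN
  have hN0 : 0 ≤ N := ENNReal.toReal_nonneg
  have hub : ∀ t ∈ Icc 0 T', ∀ᵐ e ∂energyMeasure, 0 ≤ u t e ∧ u t e ≤ N * decay γ e := by
    intro t ht
    have h1 : weightedNorm γ (u t) ≤ ENNReal.ofReal N := by
      rw [hN, ENNReal.ofReal_toReal hSfin.ne, hS]
      exact le_iSup₂ (f := fun t _ => weightedNorm γ (u t)) t ht
    filter_upwards [(hu.mem.mem t (hsub ht)).nonneg, ae_le_of_weightedNorm_le hN0 h1] with e h2 h3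
    exact ⟨h2, h3⟩
  have hmono : μ.prod energyMeasure ≤ (volume.restrict (Ico 0 T)).prod energyMeasure :=
    Measure.prod_mono hle le_rfl
  have hum : AEMeasurable (fun p : ℝ × ℝ => u p.1 p.2) (μ.prod energyMeasure) :=
    hu.mem.aemeasurable.mono_measure hmono
  set g : ℝ × ℝ → ℝ := hum.mk _ with hg
  have hgm : Measurable g := hum.measurable_mk
  have hug : ∀ᵐ p ∂(μ.prod energyMeasure), u p.1 p.2 = g p := hum.ae_eq_mk
  set w : ℝ → ℝ → ℝ := fun t => truncate γ N fun e => g (t, e) with hw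
  have hwp : IsMeasurablePath γ N w :=
    ⟨fun t => isDensity_truncate hN0 (hgm.comp measurable_prodMk_left),
      (hgm.max measurable_const).min (((measurable_decay γ).comp measurable_snd).const_mul N)⟩
  have hgw : ∀ᵐ p ∂(μ.prod energyMeasure), g p = w p.1 p.2 := by
    refine (Measure.ae_prod_iff_ae_ae (measurableSet_eq_fun hgm hwp.meas)).2 ?_
    filter_upwards [Measure.ae_ae_of_ae_prod hug, hmem] with t h1 ht
    filter_upwards [h1, hub t ht] with e h2 h3
    have h2 : u t e = g (t, e) := h2
    rw [h2] at h3
    exact (truncate_of_mem (h := fun e => g (t, e)) h3.1 h3.2).symm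
  have huw : ∀ᵐ p ∂(μ.prod energyMeasure), u p.1 p.2 = w p.1 p.2 := by
    filter_upwards [hug, hgw] with p h1 h2
    rw [h1, h2]
  have hA1 : ∀ᵐ t ∂μ, ∀ᵐ e ∂energyMeasure, u t e = w t e := Measure.ae_ae_of_ae_prod huw
  have hA3 : ∀ᵐ e ∂energyMeasure, ∀ᵐ t ∂μ, u t e = w t e :=
    Measure.ae_ae_of_ae_prod (p := fun p : ℝ × ℝ => u p.2 p.1 = w p.2 p.1)
      (Measure.measurePreserving_swap.quasiMeasurePreserving.ae huw)
  have hA1' := (ae_restrict_iff' (μ := volume) measurableSet_Icc).1 hA1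
  have heq : ∀ᵐ t ∂μ, ∀ᵐ e ∂energyMeasure, w t e = mildMap k w t e := by
    filter_upwards [ae_mono hle hu.eqn, hA1, hmem] with t h1 h2 ht
    filter_upwards [h1, h2, hA3, hfk] with e h3 h4 h5 h6
    rw [← h4, h3]
    refine mildMap_congr (f₀ := f₀) (f := u) h6
      (hA1'.mono fun s hs hsT => lossRate_congr (hs hsT) e) ?_ ht
    filter_upwards [hA1', (ae_restrict_iff' measurableSet_Icc).1 h5] with s hs hs' hsT
    exact gain_congr (hs hsT) (hs' hsT)
  obtain ⟨Z, v, hv, hwv⟩ := exists_isSolution_of_ae_eq_mildMap hγ hT' hk.meas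
    (fun e he => hk.eq_zero he) hwp heq
  refine ⟨N, Z, v, hv, ?_⟩
  filter_upwards [hA1, hwv] with t h1 h2
  filter_upwards [h1, h2] with e h3 h4
  rw [h3, h4]

/-! ### The maximal solution as a mild solution -/

section MaximalMild

variable {γ N₀ : ℝ} {f₀ k : ℝ → ℝ}

/-- The datum `f₀` enters through a representative `k` with pointwise bounds. -/
theorem isMildSolution_maximalSolution (hk : IsDensity γ N₀ k)
    (hfk : ∀ᵐ e ∂energyMeasure, f₀ e = k e) (hγ : 3 < γ) (hm : 0 < massMoment k)
    (hb : BddAbove (existenceTimes γ k)) :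
    IsMildSolution γ 0 (maximalTime γ k) f₀ (maximalSolution γ k) := by
  set Tm := maximalTime γ k with hTm
  have hpos : 0 < Tm := maximalTime_pos hk hγ hm hb
  have hsol : ∀ T, T < Tm → ∃ N f, IsSolution γ N T ∅ k f ∧
      ∀ t ∈ Icc 0 T, maximalSolution γ k t = f t := fun T hT =>
    exists_solution_of_lt_maximalTime hk hγ hm hT
  refine ⟨⟨?_, fun t ht => ?_, fun K hK hKs => ?_⟩, ?_⟩
  · obtain ⟨s, _, hs, hlim⟩ := exists_seq_strictMono_tendsto Tm
    choose N f hf hfe using fun n => hsol (s n) (hs n)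
    refine aemeasurable_of_tendsto_metrizable_ae atTop (f := fun n p => f n p.1 p.2)
      (fun n => (hf n).path.isMeasurablePath.meas.aemeasurable) ?_
    filter_upwards [Measure.quasiMeasurePreserving_fst.ae
      (ae_restrict_mem (μ := (volume : Measure ℝ)) (measurableSet_Ico (a := 0) (b := Tm)))]
      with p hp
    refine tendsto_const_nhds.congr' ?_
    filter_upwards [hlim.eventually_const_lt hp.2] with n hn
    rw [hfe n p.1 ⟨hp.1, hn.le⟩]
  · obtain ⟨N, f, hf, hfe⟩ := hsol t ht.2
    rw [hfe t ⟨ht.1, le_rfl⟩]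
    exact (hf.path.dens t).memWeighted
  · rcases K.eq_empty_or_nonempty with rfl | hne
    · simp
    obtain ⟨T, hT, hmax⟩ := hK.exists_isGreatest hne
    obtain ⟨N, f, hf, hfe⟩ := hsol T (hKs hT).2
    refine lt_of_le_of_lt (iSup₂_le fun t ht => ?_) (ENNReal.ofReal_lt_top (r := N))
    rw [hfe t ⟨(hKs ht).1, hmax ht⟩]
    exact (hf.path.dens t).weightedNorm_le
  · filter_upwards [ae_restrict_mem measurableSet_Ico] with t ht
    obtain ⟨N, f, hf, hfe⟩ := hsol t ht.2
    have htt : t ∈ Icc 0 t := ⟨ht.1, le_rfl⟩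
    filter_upwards [hfk] with e he
    have h1 : f t e = mildMap k f t e := by
      have := eq_duhamel (hf.path.continuous_lossRate hγ e) (hf.path.continuous_gain hγ e)
        (hf.deriv e (notMem_empty e)) htt
      rwa [hf.init e (notMem_empty e)] at this
    rw [hfe t htt, h1]
    exact mildMap_congr (f₀ := k) (k := f₀) he.symm
      (Eventually.of_forall fun s hs => by rw [hfe s hs])
      (Eventually.of_forall fun s hs => by rw [hfe s hs]) htt

/-- A mild solution past the maximal time would stay bounded there, against the blow-up
alternative. The solution obtained from it has an exceptional null set, and does not itself
contradict the definition of `maximalTime`. -/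
theorem IsMildSolution.le_maximalTime {T : ℝ} {u : ℝ → ℝ → ℝ} (hu : IsMildSolution γ 0 T f₀ u)
    (hk : IsDensity γ N₀ k) (hfk : ∀ᵐ e ∂energyMeasure, f₀ e = k e) (hγ : 3 < γ)
    (hm : 0 < massMoment k) (hb : BddAbove (existenceTimes γ k)) : T ≤ maximalTime γ k := by
  by_contra hlt
  obtain ⟨T', h1, h2⟩ := exists_between (not_le.1 hlt)
  have hpos := maximalTime_pos hk hγ hm hb
  obtain ⟨N, Z, v, hv, -⟩ := hu.exists_isSolution hγ hk hfk (hpos.trans h1) h2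
  -- the solution obtained from `u` is bounded past the blow-up time
  have hle : limsupNorm (maximalSolution γ k) (maximalTime γ k) ≤ ENNReal.ofReal N := by
    refine limsup_le_of_le (h := Eventually.filter_mono inf_le_left ?_)
    filter_upwards [Ioo_mem_nhdsLT hpos] with t ht
    obtain ⟨N', f, hf, hfe⟩ := exists_solution_of_lt_maximalTime hk hγ hm ht.2
    rw [hfe t ⟨ht.1.le, le_rfl⟩, eLpNorm_exponent_top]
    refine eLpNormEssSup_le_of_ae_bound (ae_restrict_of_ae ?_)
    filter_upwards [hv.ae_notMem] with e he
    have h3 := hf.eq (hv.mono_time (ht.2.trans h1).le) hγ hm ⟨ht.1.le, le_rfl⟩ (notMem_empty e) he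
    rw [h3, Real.norm_of_nonneg ((hv.path.dens t).nonneg e)]
    exact (hv.path.dens t).le_bound (by linarith) e
  rw [limsupNorm_maximalSolution hk hγ hm hb] at hle
  exact absurd hle (not_le.2 ENNReal.ofReal_lt_top)

theorem IsMildSolution.ae_eq_maximalSolution {T : ℝ} {u : ℝ → ℝ → ℝ}
    (hu : IsMildSolution γ 0 T f₀ u) (hk : IsDensity γ N₀ k)
    (hfk : ∀ᵐ e ∂energyMeasure, f₀ e = k e) (hγ : 3 < γ) (hm : 0 < massMoment k)
    (hb : BddAbove (existenceTimes γ k)) :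
    ∀ᵐ t ∂(volume.restrict (Ico 0 T)), ∀ᵐ e ∂energyMeasure, u t e = maximalSolution γ k t e := by
  have hT := hu.le_maximalTime hk hfk hγ hm hb
  obtain ⟨s, _, hs, hlim⟩ := exists_seq_strictMono_tendsto T
  have key : ∀ n, ∀ᵐ t : ℝ, 0 < s n → t ∈ Icc 0 (s n) →
      ∀ᵐ e ∂energyMeasure, u t e = maximalSolution γ k t e := by
    intro n
    by_cases h0 : 0 < s n
    swap
    · exact Eventually.of_forall fun t h => absurd h h0
    obtain ⟨N, Z, v, hv, huv⟩ := hu.exists_isSolution hγ hk hfk h0 (hs n)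
    obtain ⟨N', f, hf, hfe⟩ := exists_solution_of_lt_maximalTime hk hγ hm ((hs n).trans_le hT)
    filter_upwards [(ae_restrict_iff' (μ := volume) measurableSet_Icc).1 huv] with t ht _ htn
    filter_upwards [ht htn, ae_restrict_of_ae hv.ae_notMem] with e he heZ
    rw [he, hfe t htn, hf.eq hv hγ hm htn (notMem_empty e) heZ]
  refine (ae_restrict_iff' measurableSet_Ico).2 ?_
  filter_upwards [ae_all_iff.2 key] with t ht htT
  obtain ⟨n, hn⟩ := (hlim.eventually_const_lt (max_lt htT.2 (htT.1.trans_lt htT.2) :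
    max t 0 < T)).exists
  exact ht n ((le_max_right _ _).trans_lt hn) ⟨htT.1, (le_max_left _ _).trans hn.le⟩

end MaximalMild

/-! ### Mass and energy of representatives -/

theorem IsDensity.setIntegral_mul_eq {γ N : ℝ} {f₀ k ψ : ℝ → ℝ} (hk : IsDensity γ N k)
    (hfk : ∀ᵐ e ∂energyMeasure, f₀ e = k e) :
    ∫ e in Ioi (0 : ℝ), f₀ e * ψ e = ∫ e, k e * ψ e := by
  have h1 : ∫ e in Ioi (0 : ℝ), f₀ e * ψ e = ∫ e in Ioi (0 : ℝ), k e * ψ e :=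
    integral_congr_ae (hfk.mono fun e he => by simp only [he])
  rw [h1]
  exact setIntegral_eq_integral_of_forall_compl_eq_zero fun e he => by
    rw [hk.eq_zero (not_lt.1 he), zero_mul]

theorem IsDensity.mass_eq {γ N : ℝ} {f₀ k : ℝ → ℝ} (hk : IsDensity γ N k)
    (hfk : ∀ᵐ e ∂energyMeasure, f₀ e = k e) : mass f₀ = 4 * Real.pi * √2 * massMoment k := by
  rw [mass, hk.setIntegral_mul_eq hfk, massMoment]

theorem IsDensity.energy_eq {γ N : ℝ} {f₀ k : ℝ → ℝ} (hk : IsDensity γ N k)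
    (hfk : ∀ᵐ e ∂energyMeasure, f₀ e = k e) : energy f₀ = 4 * Real.pi * √2 * energyMoment k := by
  rw [energy, hk.setIntegral_mul_eq hfk, energyMoment]
  congr 1
  refine integral_congr_ae (Eventually.of_forall fun e => ?_)
  rcases le_or_gt e 0 with he | he
  · simp [hk.eq_zero he]
  · show k e * √(e ^ 3) = k e * (e * √e)
    rw [show e ^ 3 = e ^ 2 * e by ring, Real.sqrt_mul (sq_nonneg e), Real.sqrt_sq he.le]

theorem massBelow_congr {f₀ k : ℝ → ℝ} (hfk : ∀ᵐ e ∂energyMeasure, f₀ e = k e) (R : ℝ) :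
    massBelow f₀ R = massBelow k R := by
  refine integral_congr_ae ?_
  filter_upwards [ae_restrict_of_ae_restrict_of_subset Ioc_subset_Ioi_self hfk] with e he
  rw [he]

end Nordheim

theorem theorem2p1 :
    ∃ θ : ℝ, 0 < θ ∧
      ∀ M E : ℝ, 0 < M → 0 < E →
        ∃ T₀ : ℝ, 0 < T₀ ∧
          ∀ ν : ℝ, 0 < ν →
            ∃ ρ₀ K : ℝ, 0 < ρ₀ ∧ 0 < K ∧
              ∀ γ : ℝ, 3 < γ →
                ∀ f₀ : ℝ → ℝ, Nordheim.MemWeighted γ f₀ →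
                  Nordheim.mass f₀ = M → Nordheim.energy f₀ = E →
                  Nordheim.Concentrated ν ρ₀ K θ f₀ →
                    ∃ (Tmax : ℝ) (f : ℝ → ℝ → ℝ), 0 < Tmax ∧ Tmax < T₀ ∧
                      Nordheim.IsMildSolution γ 0 Tmax f₀ f ∧
                      Nordheim.limsupNorm f Tmax = ∞ ∧
                      -- maximality of `Tmax`, and uniqueness on every time interval
                      ∀ (T : ℝ) (u : ℝ → ℝ → ℝ), 0 < T →
                        Nordheim.IsMildSolution γ 0 T f₀ u →
                          T ≤ Tmax ∧
                            ∀ᵐ t ∂(volume.restrict (Ico 0 T)),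
                              ∀ᵐ ε ∂Nordheim.energyMeasure, u t ε = f t ε := by
  refine ⟨1 / 20, by norm_num, fun M E hM hE => ⟨1, one_pos, fun ν hν => ?_⟩⟩
  -- the smallness of the scale depends on `M`, `E`, `ν` only, whereas the weight `γ` matters for
  -- existence and uniqueness but not for the cascade
  have hc : (0 : ℝ) < 4 * Real.pi * √2 := by positivity
  obtain ⟨s₁, hs₁, hsmall⟩ := Nordheim.exists_smallScale (M / (4 * Real.pi * √2))
    (E / (4 * Real.pi * √2)) hν
  refine ⟨s₁ ^ 20, 2, by positivity, two_pos, fun γ hγ f₀ hf₀ hMf hEf hconc => ?_⟩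
  obtain ⟨N₀, k, hk, hfk⟩ := hf₀.exists_isDensity
  have hm : Nordheim.massMoment k = M / (4 * Real.pi * √2) := by
    rw [← hMf, hk.mass_eq hfk, mul_div_cancel_left₀ _ hc.ne']
  have he : Nordheim.energyMoment k = E / (4 * Real.pi * √2) := by
    rw [← hEf, hk.energy_eq hfk, mul_div_cancel_left₀ _ hc.ne']
  have hm0 : 0 < Nordheim.massMoment k := by rw [hm]; positivity
  obtain ⟨s, hs0, hss₁, hseed, hmass⟩ := hconc.exists_scale hs₁ hν
  simp only [Nordheim.massBelow_congr hfk] at hseed hmass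
  have hlt : ∀ T ∈ Nordheim.existenceTimes γ k, T ≤ 1 / 2 := by
    rintro T ⟨_, N, f, hf⟩
    refine (hf.lt_half hγ hm0 hs0 (fun s' h0 h1 => ?_) hν.le hseed hmass).le
    rw [hm, he]
    exact hsmall s' h0 (h1.trans hss₁)
  have hb : BddAbove (Nordheim.existenceTimes γ k) := ⟨1 / 2, hlt⟩
  have hpos := Nordheim.maximalTime_pos hk hγ hm0 hb
  refine ⟨Nordheim.maximalTime γ k, Nordheim.maximalSolution γ k, hpos, ?_,
    Nordheim.isMildSolution_maximalSolution hk hfk hγ hm0 hb,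
    Nordheim.limsupNorm_maximalSolution hk hγ hm0 hb, fun T u _ hu =>
    ⟨hu.le_maximalTime hk hfk hγ hm0 hb, hu.ae_eq_maximalSolution hk hfk hγ hm0 hb⟩⟩
  obtain ⟨T, hT, _⟩ := Nordheim.exists_mem_existenceTimes hk hγ hm0
  have : Nordheim.maximalTime γ k ≤ 1 / 2 := csSup_le ⟨T, hT⟩ hlt
  linarith
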